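/- Let $1/2<H<1$, $T>0$, and let $B=(B^1,\dots,B^d)$ be a $d$-dimensional fractional Brownian motion on $[0,T]$ with Hurst parameter $H$, i.e. a centered Gaussian process with almost surely continuous paths and $$\mathbf E[B_t^iB_s^j]=\tfrac12\left(t^{2H}+s^{2H}-|t-s|^{2H}\right)\mathbf 1_{(i=j)},\qquad s,t\in[0,T].$$ Let $a\in\mathbb R^m$ and let $\mu,\sigma^1,\dots,\sigma^d:\mathbb R^m\to\mathbb R^m$ be of class $\mathcal C_b^2$ (twice differentiable, bounded together with their derivatives of order one and two). Let $Y$ be the solution of $$Y_t=a+\int_0^t\mu(Y_s)\,ds+\sum_{j=1}^d\int_0^t\sigma^j(Y_s)\,dB^j_s,\qquad t\in[0,T],$$ where the integrals against $B$ are pathwise Young integrals and where, almost surely, $Y$ is Hölder continuous of some order $\beta>1/2$. For $M\ge 1$ put $\tau_k=kT/M$ and let $\bar Y^M$ be the Euler scheme with $M$ steps: $\bar Y^M_0=a$ and, for $k=0,\dots,M-1$ and $t\in[\tau_k,\tau_{k+1}]$, $$\bar Y^M_t=\bar Y^M_{\tau_k}+\mu(\bar Y^M_{\tau_k})(t-\tau_k)+\sum_{j=1}^d\sigma^j(\bar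 Y^M_{\tau_k})\,(B^j_t-B^j_{\tau_k}).$$ For $f:[0,T]\to\mathbb R^m$ let $$\|f\|_{\gamma,T}=\sup_{t\in[0,T]}|f_t|+\sup_{0\le s<t\le T}\frac{|f_t-f_s|}{|t-s|^\gamma}.$$ Then for every $0<\gamma<H$ there exists a random variable $C=C_{\gamma,T}$, not depending on $M$ and with finite moments of all orders, such that almost surely, for all $M\ge1$, $$\|Y-\bar Y^M\|_{\gamma,T}\le C\,M^{1-2\gamma}.$$ Consequently the mean square error is of order $M^{1-2\gamma}$: for every $0<\gamma<H$ there is a constant $K$ such that, for all $M\ge1$, both $$\sup_{\tau\in[0,T]}\left(\mathbf E|Y_\tau-\bar Y^M_\tau|^2\right)^{1/2}\le K\,M^{1-2\gamma}\qquad\text{and}\qquad\sup_{\tau\in[0,T]}\mathbf E|Y_\tau-\bar Y^M_\tau|^2\le K\,M^{1-2\gamma}.$$ -/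

import Mathlib

open MeasureTheory ProbabilityTheory
open scoped NNReal ENNReal

noncomputable section

namespace FractionalEuler

/-- `B`, restricted to the time interval `[0, T]`, is a `d`-dimensional fractional Brownian motion
with Hurst parameter `H`: a centered Gaussian process with almost surely continuous paths and
covariance `E[B_t^i B_s^j] = 1/2 (t^{2H} + s^{2H} - |t - s|^{2H}) 1_{i = j}`. -/
structure IsFractionalBrownianMotion {Ω : Type*} [MeasurableSpace Ω] (P : Measure Ω) {d : ℕ}
    (H T : ℝ) (B : ℝ → Ω → EuclideanSpace ℝ (Fin d)) : Prop where
  gaussian : IsGaussianProcess (fun (t : Set.Icc (0 : ℝ) T) (ω : Ω) => B t ω) P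
  centered : ∀ t ∈ Set.Icc (0 : ℝ) T, ∀ i : Fin d, ∫ ω, B t ω i ∂P = 0
  covariance : ∀ t ∈ Set.Icc (0 : ℝ) T, ∀ s ∈ Set.Icc (0 : ℝ) T, ∀ i j : Fin d,
    ∫ ω, B t ω i * B s ω j ∂P =
      if i = j then 1 / 2 * (t ^ (2 * H) + s ^ (2 * H) - |t - s| ^ (2 * H)) else 0
  continuous_paths : ∀ᵐ ω ∂P, ContinuousOn (fun t => B t ω) (Set.Icc (0 : ℝ) T)

/-- The class `C_b^n`: `n` times differentiable functions, bounded together with all their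
derivatives up to order `n`. -/
def IsCb {E F : Type*} [NormedAddCommGroup E] [NormedSpace ℝ E] [NormedAddCommGroup F]
    [NormedSpace ℝ F] (n : ℕ) (f : E → F) : Prop :=
  (∀ k < n, Differentiable ℝ (iteratedFDeriv ℝ k f)) ∧
    ∀ k ≤ n, ∃ K : ℝ, ∀ x, ‖iteratedFDeriv ℝ k f x‖ ≤ K

/-- `I` is the Young integral `∫_s^t g_u db_u` of a vector valued `g` against a real valued `b`:
the limit of the Riemann sums `∑ g(τ_i) (b(τ_{i+1}) - b(τ_i))` over the partitions
`s = τ_0 ≤ τ_1 ≤ ⋯ ≤ τ_n = t`, as the mesh tends to zero. -/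
def HasYoungIntegral {E : Type*} [NormedAddCommGroup E] [NormedSpace ℝ E]
    (g : ℝ → E) (b : ℝ → ℝ) (s t : ℝ) (I : E) : Prop :=
  ∀ ε > 0, ∃ δ > 0, ∀ (n : ℕ) (τ : ℕ → ℝ), Monotone τ → τ 0 = s → τ n = t →
    (∀ i < n, τ (i + 1) - τ i < δ) →
      ‖∑ i ∈ Finset.range n, (b (τ (i + 1)) - b (τ i)) • g (τ i) - I‖ < ε

/-- The path `y` is a solution on `[0, T]` of
`y_t = a + ∫_0^t μ(y_s) ds + ∑_j ∫_0^t σ^j(y_s) db_s^j`,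
the integrals against `b` being Young integrals; as usual in the Young setting, solutions are
Hölder continuous of some order `β > 1/2`. -/
def IsYoungSolution {m d : ℕ}
    (μ : EuclideanSpace ℝ (Fin m) → EuclideanSpace ℝ (Fin m))
    (σ : Fin d → EuclideanSpace ℝ (Fin m) → EuclideanSpace ℝ (Fin m))
    (a : EuclideanSpace ℝ (Fin m)) (T : ℝ)
    (b : ℝ → EuclideanSpace ℝ (Fin d)) (y : ℝ → EuclideanSpace ℝ (Fin m)) : Prop :=
  (∃ β C : ℝ≥0, 1 / 2 < β ∧ HolderOnWith C β y (Set.Icc 0 T)) ∧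
    ∀ t ∈ Set.Icc (0 : ℝ) T, ∃ J : Fin d → EuclideanSpace ℝ (Fin m),
      (∀ j, HasYoungIntegral (fun s => σ j (y s)) (fun s => b s j) 0 t (J j)) ∧
        y t = a + (∫ s in (0 : ℝ)..t, μ (y s)) + ∑ j, J j

/-- One step of the Euler scheme from `y` over the time interval `[s, t]`. -/
def eulerStep {m d : ℕ}
    (μ : EuclideanSpace ℝ (Fin m) → EuclideanSpace ℝ (Fin m))
    (σ : Fin d → EuclideanSpace ℝ (Fin m) → EuclideanSpace ℝ (Fin m))
    (b : ℝ → EuclideanSpace ℝ (Fin d)) (s t : ℝ) (y : EuclideanSpace ℝ (Fin m)) :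
    EuclideanSpace ℝ (Fin m) :=
  y + (t - s) • μ y + ∑ j, (b t j - b s j) • σ j y

/-- The Euler scheme with `M` steps at the grid points: `eulerGrid μ σ a T b M k` is the value at
time `τ_k = k T / M`. -/
def eulerGrid {m d : ℕ}
    (μ : EuclideanSpace ℝ (Fin m) → EuclideanSpace ℝ (Fin m))
    (σ : Fin d → EuclideanSpace ℝ (Fin m) → EuclideanSpace ℝ (Fin m))
    (a : EuclideanSpace ℝ (Fin m)) (T : ℝ)
    (b : ℝ → EuclideanSpace ℝ (Fin d)) (M : ℕ) : ℕ → EuclideanSpace ℝ (Fin m)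
  | 0 => a
  | k + 1 => eulerStep μ σ b (k * T / M) ((k + 1 : ℕ) * T / M) (eulerGrid μ σ a T b M k)

/-- The Euler scheme with `M` steps as a path on `[0, T]`: at a time `t` in `[τ_k, τ_{k+1})`, one
Euler step over `[τ_k, t]` is made from the value at the grid point `τ_k = k T / M`. -/
def eulerPath {m d : ℕ}
    (μ : EuclideanSpace ℝ (Fin m) → EuclideanSpace ℝ (Fin m))
    (σ : Fin d → EuclideanSpace ℝ (Fin m) → EuclideanSpace ℝ (Fin m))
    (a : EuclideanSpace ℝ (Fin m)) (T : ℝ)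
    (b : ℝ → EuclideanSpace ℝ (Fin d)) (M : ℕ) (t : ℝ) : EuclideanSpace ℝ (Fin m) :=
  eulerStep μ σ b (⌊t * M / T⌋₊ * T / M) t (eulerGrid μ σ a T b M ⌊t * M / T⌋₊)

/-- At the grid points the path is the Euler scheme. -/
theorem eulerPath_grid {m d : ℕ}
    (μ : EuclideanSpace ℝ (Fin m) → EuclideanSpace ℝ (Fin m))
    (σ : Fin d → EuclideanSpace ℝ (Fin m) → EuclideanSpace ℝ (Fin m))
    (a : EuclideanSpace ℝ (Fin m)) {T : ℝ} (hT : 0 < T)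
    (b : ℝ → EuclideanSpace ℝ (Fin d)) {M : ℕ} (hM : 1 ≤ M) (k : ℕ) :
    eulerPath μ σ a T b M (k * T / M) = eulerGrid μ σ a T b M k := by
  have hM' : (M : ℝ) ≠ 0 := by positivity
  have h : (k * T / M : ℝ) * M / T = k := by field_simp
  simp [eulerPath, eulerStep, h]

/-- The Hölder norm of order `γ` on `[0, T]`: the supremum norm plus the Hölder seminorm
(`∞` if `f` is not `γ`-Hölder continuous on `[0, T]`). -/
def holderNorm {E : Type*} [NormedAddCommGroup E] (γ : ℝ≥0) (T : ℝ) (f : ℝ → E) : ℝ≥0∞ :=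
  (⨆ t : Set.Icc (0 : ℝ) T, ‖f t‖ₑ) + eHolderNorm γ (fun t : Set.Icc (0 : ℝ) T => f t)

end FractionalEuler

end

open FractionalEuler

/-! The problem is pathwise. Drift and diffusion are merged into one field `V` driven by `x_t = (t,
B_t)`, which is Hölder of order `α` with `max γ (1/2) < α < H`; the rate `M ^ (1 - 2α)` is proved,
and it is at least as good as `M ^ (1 - 2γ)`.

The central object is the remainder `R_st = w_t - w_s - V(w_s)(x_t - x_s)` (`eulerRemainder`). It
fails to be additive only by `(V(w_j) - V(w_i))(x_k - x_j)`, a product of two terms of order `α`;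
since `2α > 1`, `discrete_sewing` bounds `R` by the total length to the power `2α`, plus a linear
accumulation of what is known on single steps. On windows of length `Δ` with `K N Δ^α` small, this
bounds the Hölder constants of the solution and of the Euler scheme by `2 K N`
(`local_holder_of_sewing`).

On one step of length `h = T / M` the scheme has remainder zero and the solution has remainder
`O(h^{2α}) = O(h^{2α-1}) h`. The difference of the two remainders is again sewn; its defect is a
second-order difference of `V`, which the `C_b^2` bounds make proportional to the error
(`four_point`). On a window the Hölder seminorm of the error is then absorbed, and from one window
to the next the error at most doubles, up to an additive `O(h^{2α-1})` (`euler_compare_window`,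
`euler_compare_grid`).

There are about `T / Δ` windows and `Δ` is proportional to `N ^ (-1/α)`, so the error constant is `Γ
exp(Γ N^{1/α})` (`euler_error`). The exponent `1/α` is below `2`, whereas the Hölder constant `N` of
fractional Brownian motion has a finite moment `E exp(η N²)`, obtained by dyadic chaining
(`exists_sup_gaussian`); hence all moments are finite. The mean square bounds follow by integrating
the pathwise one. -/

namespace FractionalEuler

/-! ### Discrete sewing -/

/-- The constant in the sewing lemma of exponent `θ > 1`. -/
noncomputable def sewingConst (θ : ℝ) : ℝ := 2 / (1 - 2 ^ (1 - θ))

lemma two_rpow_one_sub_lt_one {θ : ℝ} (hθ : 1 < θ) : (2 : ℝ) ^ (1 - θ) < 1 :=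
  Real.rpow_lt_one_of_one_lt_of_neg (by norm_num) (by linarith)

lemma two_le_sewingConst {θ : ℝ} (hθ : 1 < θ) : 2 ≤ sewingConst θ := by
  have h := two_rpow_one_sub_lt_one hθ
  have h' : (0 : ℝ) < 2 ^ (1 - θ) := by positivity
  rw [sewingConst, le_div_iff₀ (by linarith)]
  linarith

/-- This fixed point equation closes the induction in `discrete_sewing`: two halves of an interval
cost `2 ^ (1 - θ)` times the whole, and cutting adds two defects. -/
lemma sewingConst_eq {θ : ℝ} (hθ : 1 < θ) :
    sewingConst θ * 2 ^ (1 - θ) + 2 = sewingConst θ := by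
  have h := two_rpow_one_sub_lt_one hθ
  have : (1 : ℝ) - 2 ^ (1 - θ) ≠ 0 := by linarith
  rw [sewingConst]
  field_simp
  ring

/-- A two-parameter family whose defect of additivity over a partition is of order `θ > 1`, and
which is small over the intervals of the partition, is small over unions of such intervals. -/
lemma discrete_sewing {E : Type*} [NormedAddCommGroup E] {θ κ ρ : ℝ} (hθ : 1 < θ) (hκ : 0 ≤ κ)
    {τ : ℕ → ℝ} (hτ : Monotone τ) {l n : ℕ} {R : ℕ → ℕ → E}
    (hδ : ∀ i j k, l ≤ i → i ≤ j → j ≤ k → k ≤ n →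
      ‖R i k - R i j - R j k‖ ≤ κ * (τ k - τ i) ^ θ)
    (hR : ∀ i, l ≤ i → i < n → ‖R i (i + 1)‖ ≤ ρ * (τ (i + 1) - τ i)) :
    ∀ i j, l ≤ i → i ≤ j → j ≤ n →
      ‖R i j‖ ≤ sewingConst θ * κ * (τ j - τ i) ^ θ + ρ * (τ j - τ i) := by
  have hS := two_le_sewingConst hθ
  have hzero : ∀ i, l ≤ i → i ≤ n → R i i = 0 := fun i hi hin => by
    have := hδ i i i hi le_rfl le_rfl hin
    rw [sub_self, sub_self, Real.zero_rpow (by linarith), mul_zero, zero_sub, norm_neg] at this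
    exact norm_le_zero_iff.1 this
  intro i j
  induction hd : j - i using Nat.strong_induction_on generalizing i j with
  | _ N ih =>
    intro hi hij hj
    rcases hij.eq_or_lt with rfl | hlt
    · rw [hzero i hi hj, norm_zero, sub_self, Real.zero_rpow (by linarith)]
      simp
    set w := τ j - τ i with hw
    have hw0 : 0 ≤ w := sub_nonneg.2 (hτ hij)
    -- The grid need not contain the midpoint. With `m` the last index before `j` lying in the first
    -- half, the pieces on either side of the single step `[τ m, τ (m + 1)]` have length at most `w
    -- / 2`, and that step is left to `hR`.
    obtain ⟨m, him, hmj, hm1, hm2⟩ : ∃ m, i ≤ m ∧ m < j ∧ τ m - τ i ≤ w / 2 ∧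
        τ j - τ (m + 1) ≤ w / 2 := by
      classical
      let p : ℕ → Prop := fun m => i ≤ m ∧ τ m - τ i ≤ w / 2
      have hpi : p i := ⟨le_rfl, by rw [sub_self]; linarith⟩
      have hb : i ≤ j - 1 := by omega
      have hspec : p (Nat.findGreatest p (j - 1)) := Nat.findGreatest_spec hb hpi
      refine ⟨Nat.findGreatest p (j - 1), hspec.1, ?_, hspec.2, ?_⟩
      · have := Nat.findGreatest_le (P := p) (j - 1)
        omega
      · by_contra hcon
        push Not at hcon
        have hle := Nat.findGreatest_le (P := p) (j - 1)
        rcases hle.eq_or_lt with he | hl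
        · rw [he, Nat.sub_add_cancel (by omega), sub_self] at hcon
          linarith
        · refine Nat.findGreatest_is_greatest (P := p) (n := j - 1)
            (k := Nat.findGreatest p (j - 1) + 1) (Nat.lt_succ_self _) (by omega) ⟨?_, ?_⟩
          · exact hspec.1.trans (Nat.le_succ _)
          · linarith
    have e1 := ih (m - i) (by omega) i m rfl hi him (by omega)
    have e2 := ih (j - (m + 1)) (by omega) (m + 1) j rfl (by omega) (by omega) hj
    have e3 := hR m (by omega) (by omega)
    have e4 := hδ i m j hi him hmj.le hj
    have e5 := hδ m (m + 1) j (by omega) (by omega) hmj hj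
    have h1 : 0 ≤ τ m - τ i := sub_nonneg.2 (hτ him)
    have h2 : 0 ≤ τ j - τ (m + 1) := sub_nonneg.2 (hτ hmj)
    have h3 : (τ m - τ i) ^ θ ≤ (w / 2) ^ θ := Real.rpow_le_rpow h1 hm1 (by linarith)
    have h4 : (τ j - τ (m + 1)) ^ θ ≤ (w / 2) ^ θ := Real.rpow_le_rpow h2 hm2 (by linarith)
    have h5 : (τ j - τ m) ^ θ ≤ w ^ θ :=
      Real.rpow_le_rpow (sub_nonneg.2 (hτ hmj.le)) (by linarith) (by linarith)
    have hhalf : 2 * (w / 2) ^ θ = 2 ^ (1 - θ) * w ^ θ := by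
      rw [Real.div_rpow hw0 (by norm_num), Real.rpow_sub (by norm_num), Real.rpow_one]
      ring
    -- Three pieces and two defects, each defect at most `κ * w ^ θ`; the linear `ρ` terms of the
    -- three pieces add up exactly to `ρ * w`.
    have hsplit : R i j = R i m + R m (m + 1) + R (m + 1) j + (R i j - R i m - R m j) +
        (R m j - R m (m + 1) - R (m + 1) j) := by abel
    have hnorm : ‖R i j‖ ≤ ‖R i m‖ + ‖R m (m + 1)‖ + ‖R (m + 1) j‖ +
        ‖R i j - R i m - R m j‖ + ‖R m j - R m (m + 1) - R (m + 1) j‖ := by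
      conv_lhs => rw [hsplit]
      exact (norm_add_le _ _).trans (add_le_add_left ((norm_add_le _ _).trans
        (add_le_add_left (norm_add₃_le) _)) _)
    have hSk : 0 ≤ sewingConst θ * κ := by positivity
    calc ‖R i j‖ ≤ (sewingConst θ * κ * (w / 2) ^ θ + ρ * (τ m - τ i)) +
          ρ * (τ (m + 1) - τ m) + (sewingConst θ * κ * (w / 2) ^ θ + ρ * (τ j - τ (m + 1))) +
          κ * w ^ θ + κ * w ^ θ := by
          have a1 := mul_le_mul_of_nonneg_left h3 hSk
          have a2 := mul_le_mul_of_nonneg_left h4 hSk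
          have a3 := mul_le_mul_of_nonneg_left h5 hκ
          linarith
      _ = sewingConst θ * κ * (2 * (w / 2) ^ θ) + 2 * κ * w ^ θ + ρ * w := by rw [hw]; ring
      _ = (sewingConst θ * 2 ^ (1 - θ) + 2) * κ * w ^ θ + ρ * w := by rw [hhalf]; ring
      _ = _ := by rw [sewingConst_eq hθ]

/-! ### Vector fields and local expansions -/

/-- A map `V` with bounds of order `K` on its values, its Lipschitz constant, and its second order
differences; the last one is the form in which `C_b^2` regularity is used. -/
structure IsBoundedField {E G : Type*} [NormedAddCommGroup E] [NormedAddCommGroup G]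
    (V : E → G) (K : ℝ) : Prop where
  one_le : 1 ≤ K
  norm_le : ∀ a, ‖V a‖ ≤ K
  lipschitz : ∀ a b, ‖V a - V b‖ ≤ K * ‖a - b‖
  four_point : ∀ a b c e, ‖(V a - V b) - (V c - V e)‖ ≤
    K * ‖(a - b) - (c - e)‖ + K * (‖a - c‖ + ‖b - e‖) * ‖c - e‖

/-- The remainder in the first order expansion of `w` along the field `V` driven by `x`. -/
def eulerRemainder {ι E U : Type*} [NormedAddCommGroup E] [NormedSpace ℝ E]
    [NormedAddCommGroup U] [NormedSpace ℝ U] (V : E → U →L[ℝ] E) (x : ι → U) (w : ι → E)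
    (s t : ι) : E :=
  w t - w s - V (w s) (x t - x s)

variable {ι E U : Type*} [NormedAddCommGroup E] [NormedSpace ℝ E]
    [NormedAddCommGroup U] [NormedSpace ℝ U] {V : E → U →L[ℝ] E} {K N α : ℝ}

/-- The increments of `w` cancel, and what is left pairs the change of the field over the first
interval with the driver over the second. Both factors are of order `α`, which gives the exponent `2
* α > 1` needed for sewing. -/
lemma eulerRemainder_defect (V : E → U →L[ℝ] E) (x : ι → U) (w : ι → E) (i j k : ι) :
    eulerRemainder V x w i k - eulerRemainder V x w i j - eulerRemainder V x w j k =
      (V (w j) - V (w i)) (x k - x j) := by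
  simp only [eulerRemainder, sub_apply, map_sub]
  abel

lemma norm_increment_le (hV : IsBoundedField V K) (x : ι → U) (w : ι → E) {s t : ι} {r : ℝ}
    (hr : ‖x t - x s‖ ≤ r) : ‖w t - w s‖ ≤ K * r + ‖eulerRemainder V x w s t‖ := by
  have h : w t - w s = V (w s) (x t - x s) + eulerRemainder V x w s t := by
    rw [eulerRemainder]; abel
  have h2 : ‖V (w s) (x t - x s)‖ ≤ K * r :=
    ((V (w s)).le_opNorm _).trans
      (mul_le_mul (hV.norm_le _) hr (norm_nonneg _) (by linarith [hV.one_le]))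
  rw [h]
  exact (norm_add_le _ _).trans (by linarith)

/-! ### A priori Hölder bounds by absorption -/

/-- The map `Q ↦ A + Q / 2` contracts to its fixed point `2 * A`. A crude initial constant `G` is
needed only to start the iteration and disappears in the limit. -/
lemma iterate_halving {P : ℝ → Prop} {A G : ℝ} (hA : 0 ≤ A) (hG : 0 ≤ G) (h0 : P G)
    (hstep : ∀ Q, 0 ≤ Q → P Q → P (A + Q / 2)) (n : ℕ) : ∃ Q, Q ≤ 2 * A + G / 2 ^ n ∧ P Q := by
  have : ∃ Q, 0 ≤ Q ∧ Q ≤ 2 * A + G / 2 ^ n ∧ P Q := by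
    induction n with
    | zero => exact ⟨G, hG, by simp; linarith, h0⟩
    | succ n ih =>
      obtain ⟨Q, hQ0, hQ, hP⟩ := ih
      refine ⟨A + Q / 2, by linarith, ?_, hstep Q hQ0 hP⟩
      have : G / 2 ^ (n + 1) = G / 2 ^ n / 2 := by rw [pow_succ]; field_simp
      rw [this]
      linarith
  obtain ⟨Q, -, h1, h2⟩ := this
  exact ⟨Q, h1, h2⟩

/-- A bound which can be improved from `Q` to `A + Q / 2` holds with `2 * A`. -/
lemma holder_of_halving {J : Type*} {A G : ℝ} (hA : 0 ≤ A) (hG : 0 ≤ G) {f c : J → ℝ}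
    (h0 : ∀ j, f j ≤ G * c j) (hc : ∀ j, 0 ≤ c j)
    (hstep : ∀ Q, 0 ≤ Q → (∀ j, f j ≤ Q * c j) → ∀ j, f j ≤ (A + Q / 2) * c j) (j : J) :
    f j ≤ 2 * A * c j := by
  have key := iterate_halving (P := fun Q => ∀ j, f j ≤ Q * c j) hA hG h0 hstep
  have hlim : Filter.Tendsto (fun n : ℕ => (2 * A + G * (1 / 2) ^ n) * c j) Filter.atTop
      (nhds ((2 * A + G * 0) * c j)) := by
    refine Filter.Tendsto.mul_const _ (Filter.Tendsto.const_add _ (Filter.Tendsto.const_mul _ ?_))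
    exact tendsto_pow_atTop_nhds_zero_of_lt_one (by norm_num) (by norm_num)
  rw [mul_zero, add_zero] at hlim
  refine ge_of_tendsto' hlim fun n => ?_
  obtain ⟨Q, hQ, hP⟩ := key n
  refine (hP j).trans (mul_le_mul_of_nonneg_right (hQ.trans_eq ?_) (hc j))
  rw [one_div, inv_pow, div_eq_mul_inv]

lemma rpow_two_mul {t : ℝ} (ht : 0 ≤ t) (α : ℝ) : t ^ (2 * α) = t ^ α * t ^ α := by
  rw [mul_comm, Real.rpow_mul ht, Real.rpow_two, sq]

/-- If the remainders of `w` can be controlled by sewing, then `w` is Hölder continuous at small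
scales with a constant depending only on the field and the driver. -/
lemma local_holder_of_sewing [Preorder ι] (hV : IsBoundedField V K) (hN : 0 ≤ N) (hα : 0 ≤ α)
    {τ : ι → ℝ} (hτ : Monotone τ) {I : Set ι} {x : ι → U} {w : ι → E} {Δ S G : ℝ}
    (hS : 0 ≤ S)
    (hx : ∀ i ∈ I, ∀ j ∈ I, i ≤ j → ‖x j - x i‖ ≤ N * (τ j - τ i) ^ α)
    (hsew : ∀ κ, 0 ≤ κ → (∀ i ∈ I, ∀ j ∈ I, ∀ k ∈ I, i ≤ j → j ≤ k → τ k - τ i ≤ Δ →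
        ‖(V (w j) - V (w i)) (x k - x j)‖ ≤ κ * (τ k - τ i) ^ (2 * α)) →
      ∀ i ∈ I, ∀ j ∈ I, i ≤ j → τ j - τ i ≤ Δ →
        ‖eulerRemainder V x w i j‖ ≤ S * κ * (τ j - τ i) ^ (2 * α))
    (hG : 0 ≤ G)
    (h0 : ∀ i ∈ I, ∀ j ∈ I, i ≤ j → τ j - τ i ≤ Δ → ‖w j - w i‖ ≤ G * (τ j - τ i) ^ α)
    (hsmall : S * (K * N * Δ ^ α) ≤ 1 / 2) :
    ∀ i ∈ I, ∀ j ∈ I, i ≤ j → τ j - τ i ≤ Δ →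
      ‖w j - w i‖ ≤ 2 * (K * N) * (τ j - τ i) ^ α ∧
      ‖eulerRemainder V x w i j‖ ≤ 2 * S * (K * N) ^ 2 * (τ j - τ i) ^ (2 * α) := by
  have hK := hV.one_le
  -- `hsew` leaves open how the sewing is done: on a grid it is `discrete_sewing` itself, for a path
  -- in continuous time it is a limit along finer and finer partitions.
  have hdef : ∀ Q, 0 ≤ Q →
      (∀ i ∈ I, ∀ j ∈ I, i ≤ j → τ j - τ i ≤ Δ → ‖w j - w i‖ ≤ Q * (τ j - τ i) ^ α) →
      ∀ i ∈ I, ∀ j ∈ I, i ≤ j → τ j - τ i ≤ Δ →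
        ‖eulerRemainder V x w i j‖ ≤ S * (K * Q * N) * (τ j - τ i) ^ (2 * α) := by
    intro Q hQ hw
    refine hsew _ (by positivity) fun i hi j hj k hk hij hjk hik => ?_
    have h1 := hτ hij
    have h2 := hτ hjk
    have e1 : (τ j - τ i) ^ α ≤ (τ k - τ i) ^ α :=
      Real.rpow_le_rpow (by linarith) (by linarith) hα
    have e2 : (τ k - τ j) ^ α ≤ (τ k - τ i) ^ α :=
      Real.rpow_le_rpow (by linarith) (by linarith) hα
    have hpos : 0 ≤ (τ k - τ i) ^ α := Real.rpow_nonneg (by linarith) _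
    have e3 : ‖V (w j) - V (w i)‖ ≤ K * (Q * (τ k - τ i) ^ α) :=
      (hV.lipschitz _ _).trans (mul_le_mul_of_nonneg_left
        ((hw i hi j hj hij (by linarith)).trans (mul_le_mul_of_nonneg_left e1 hQ)) (by linarith))
    have e4 : ‖x k - x j‖ ≤ N * (τ k - τ i) ^ α :=
      (hx j hj k hk hjk).trans (mul_le_mul_of_nonneg_left e2 hN)
    calc _ ≤ K * (Q * (τ k - τ i) ^ α) * (N * (τ k - τ i) ^ α) :=
          (ContinuousLinearMap.le_opNorm _ _).trans
            (mul_le_mul e3 e4 (norm_nonneg _) (by positivity))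
      _ = _ := by rw [rpow_two_mul (by linarith)]; ring
  have hhold : ∀ i ∈ I, ∀ j ∈ I, i ≤ j → τ j - τ i ≤ Δ →
      ‖w j - w i‖ ≤ 2 * (K * N) * (τ j - τ i) ^ α := by
    intro i hi j hj hij hd
    let J := {q : ι × ι // q.1 ∈ I ∧ q.2 ∈ I ∧ q.1 ≤ q.2 ∧ τ q.2 - τ q.1 ≤ Δ}
    refine holder_of_halving (J := J) (A := K * N) (by positivity) hG
      (f := fun q => ‖w q.1.2 - w q.1.1‖) (c := fun q => (τ q.1.2 - τ q.1.1) ^ α)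
      (fun q => h0 _ q.2.1 _ q.2.2.1 q.2.2.2.1 q.2.2.2.2)
      (fun q => Real.rpow_nonneg (sub_nonneg.2 (hτ q.2.2.2.1)) _) ?_ ⟨(i, j), hi, hj, hij, hd⟩
    rintro Q hQ hw ⟨⟨i, j⟩, hi, hj, hij, hd⟩
    have h1 := hdef Q hQ (fun i hi j hj hij hd => hw ⟨(i, j), hi, hj, hij, hd⟩) i hi j hj hij hd
    have h2 := norm_increment_le hV x w (hx i hi j hj hij)
    have hτij : 0 ≤ τ j - τ i := sub_nonneg.2 (hτ hij)
    have hpos : 0 ≤ (τ j - τ i) ^ α := Real.rpow_nonneg hτij _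
    have h3 : (τ j - τ i) ^ α ≤ Δ ^ α := Real.rpow_le_rpow hτij hd hα
    -- One of the two factors of order `α` is bounded by `Δ ^ α` and spent on `hsmall`; the Hölder
    -- bound `Q` thereby improves to `K * N + Q / 2`.
    have h4 : S * (K * Q * N) * (τ j - τ i) ^ (2 * α) ≤ Q / 2 * (τ j - τ i) ^ α := by
      rw [rpow_two_mul hτij, ← mul_assoc]
      refine mul_le_mul_of_nonneg_right ?_ hpos
      calc _ ≤ S * (K * Q * N) * Δ ^ α := mul_le_mul_of_nonneg_left h3 (by positivity)
        _ = S * (K * N * Δ ^ α) * Q := by ring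
        _ ≤ 1 / 2 * Q := mul_le_mul_of_nonneg_right hsmall hQ
        _ = Q / 2 := by ring
    show ‖w j - w i‖ ≤ (K * N + Q / 2) * (τ j - τ i) ^ α
    linarith
  intro i hi j hj hij hd
  refine ⟨hhold i hi j hj hij hd, (hdef _ (by positivity) hhold i hi j hj hij hd).trans_eq ?_⟩
  ring

/-- A sequence is Hölder continuous on finite windows of a strictly increasing time grid. -/
lemma exists_holder_of_strictMono {F : Type*} [SeminormedAddCommGroup F] {τ : ℕ → ℝ}
    (hτ : StrictMono τ) (w : ℕ → F) (M : ℕ) (α : ℝ) :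
    ∃ G, 0 ≤ G ∧ ∀ i j, i ≤ j → j ≤ M → ‖w j - w i‖ ≤ G * (τ j - τ i) ^ α := by
  have hnn : ∀ i j, i ≤ j → 0 ≤ (τ j - τ i) ^ α := fun i j hij =>
    Real.rpow_nonneg (sub_nonneg.2 (hτ.monotone hij)) _
  obtain ⟨G, hG⟩ := ((Finset.range (M + 1) ×ˢ Finset.range (M + 1)).image
    fun q => ‖w q.2 - w q.1‖ / (τ q.2 - τ q.1) ^ α).bddAbove
  refine ⟨max G 0, le_max_right _ _, fun i j hij hj => ?_⟩
  rcases hij.eq_or_lt with rfl | hlt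
  · rw [sub_self, norm_zero]
    exact mul_nonneg (le_max_right _ _) (hnn _ _ le_rfl)
  · have hpos : 0 < (τ j - τ i) ^ α := Real.rpow_pos_of_pos (sub_pos.2 (hτ hlt)) _
    rw [← div_le_iff₀ hpos]
    refine le_trans (hG ?_) (le_max_left _ _)
    refine Finset.mem_coe.2 (Finset.mem_image.2 ⟨(i, j), ?_, rfl⟩)
    simp only [Finset.mem_product, Finset.mem_range]
    omega

/-- Local Hölder bound for the Euler scheme on a grid. -/
lemma euler_grid_local_holder (hV : IsBoundedField V K) (hN : 0 ≤ N) (hα : 1 / 2 < α)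
    {τ : ℕ → ℝ} (hτ : StrictMono τ) {M : ℕ} {x : ℕ → U} {w : ℕ → E} {Δ : ℝ}
    (hx : ∀ i j, i ≤ j → j ≤ M → ‖x j - x i‖ ≤ N * (τ j - τ i) ^ α)
    (hw : ∀ i < M, eulerRemainder V x w i (i + 1) = 0)
    (hsmall : sewingConst (2 * α) * (K * N * Δ ^ α) ≤ 1 / 2) {i j : ℕ} (hij : i ≤ j) (hj : j ≤ M)
    (hd : τ j - τ i ≤ Δ) : ‖w j - w i‖ ≤ 2 * (K * N) * (τ j - τ i) ^ α := by
  obtain ⟨G, hG0, hG⟩ := exists_holder_of_strictMono hτ w M α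
  have hS := two_le_sewingConst (θ := 2 * α) (by linarith)
  refine (local_holder_of_sewing hV hN (by linarith) hτ.monotone (I := Set.Iic M)
    (by linarith) (fun i _ j hj hij => hx i j hij hj) ?_ hG0 (fun i _ j hj hij _ => hG i j hij hj)
    hsmall i (hij.trans hj) j hj hij hd).1
  intro κ hκ hdef i hi j hj hij hd
  -- Here `ρ = 0`, because an Euler step has no remainder.
  have := discrete_sewing (θ := 2 * α) (by linarith) hκ hτ.monotone (l := i) (n := j)
    (R := eulerRemainder V x w) (ρ := 0) ?_ ?_ i j le_rfl hij le_rfl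
  · simpa using this
  · intro a b c ha hab hbc hc
    rw [eulerRemainder_defect]
    have h1 := hτ.monotone ha
    have h2 := hτ.monotone hc
    have hcM : c ≤ M := hc.trans hj
    exact hdef a ((hab.trans hbc).trans hcM) b (hbc.trans hcM) c hcM hab hbc (by linarith)
  · intro a ha haj
    rw [hw a (lt_of_lt_of_le haj hj)]
    simp

/-- A path whose remainders are of order `θ > 1` with some constant has local Hölder norm and
remainders of order `2 * α` bounded in terms of the field and the driver. -/
lemma solution_local_holder (hV : IsBoundedField V K) (hN : 0 ≤ N) (hα : 1 / 2 < α) (hα1 : α < 1)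
    {T : ℝ} (hT : 0 < T) {x : ℝ → U} {y : ℝ → E} {Δ θ C : ℝ} (hθ : 1 < θ)
    (hx : ∀ s ∈ Set.Icc 0 T, ∀ t ∈ Set.Icc 0 T, s ≤ t → ‖x t - x s‖ ≤ N * (t - s) ^ α)
    (hy : ∀ s ∈ Set.Icc 0 T, ∀ t ∈ Set.Icc 0 T, s ≤ t →
      ‖eulerRemainder V x y s t‖ ≤ C * (t - s) ^ θ)
    (hsmall : sewingConst (2 * α) * (K * N * Δ ^ α) ≤ 1 / 2) :
    ∀ s ∈ Set.Icc 0 T, ∀ t ∈ Set.Icc 0 T, s ≤ t → t - s ≤ Δ →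
      ‖y t - y s‖ ≤ 2 * (K * N) * (t - s) ^ α ∧
      ‖eulerRemainder V x y s t‖ ≤
        2 * sewingConst (2 * α) * (K * N) ^ 2 * (t - s) ^ (2 * α) := by
  have hS := two_le_sewingConst (θ := 2 * α) (by linarith)
  have hK := hV.one_le
  have hC : 0 ≤ C := by
    have := (norm_nonneg _).trans (hy 0 ⟨le_rfl, hT.le⟩ T ⟨hT.le, le_rfl⟩ hT.le)
    rw [sub_zero] at this
    exact nonneg_of_mul_nonneg_left this (Real.rpow_pos_of_pos hT _)
  refine local_holder_of_sewing hV hN (by linarith) (τ := id) monotone_id (by linarith) hx ?_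
    (G := K * N + C * T ^ (θ - α)) (by positivity) ?_ hsmall
  · intro κ hκ hdef s hs t ht hst hd
    -- Sewing along `n + 1` equal pieces. The a priori remainder `C * h ^ θ` of a piece counts as `ρ
    -- * h` with `ρ = C * h ^ (θ - 1)`, which vanishes as `n → ∞` because `θ > 1`; so neither `C`
    -- nor `θ` survives in the final bound.
    have hbound : ∀ n : ℕ, ‖eulerRemainder V x y s t‖ ≤
        sewingConst (2 * α) * κ * (t - s) ^ (2 * α) +
          C * ((t - s) / (n + 1 : ℕ)) ^ (θ - 1) * (t - s) := by
      intro n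
      set h : ℝ := (t - s) / (n + 1 : ℕ) with hh
      have hn : (0 : ℝ) < (n + 1 : ℕ) := by positivity
      have hh0 : 0 ≤ h := div_nonneg (sub_nonneg.2 hst) hn.le
      have hmono : Monotone fun i : ℕ => s + i * h := fun i j hij => by
        have : (i : ℝ) ≤ j := by exact_mod_cast hij
        have := mul_le_mul_of_nonneg_right this hh0
        dsimp only
        linarith
      have hend : s + (n + 1 : ℕ) * h = t := by
        rw [hh, mul_div_cancel₀ _ hn.ne']; ring
      have hmem : ∀ i, i ≤ n + 1 → s + (i : ℕ) * h ∈ Set.Icc 0 T := fun i hi => by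
        have h1 := hmono (Nat.zero_le i)
        have h2 := hmono hi
        dsimp only at h1 h2
        rw [hend] at h2
        rw [Nat.cast_zero, zero_mul, add_zero] at h1
        exact ⟨hs.1.trans h1, h2.trans ht.2⟩
      have := discrete_sewing (θ := 2 * α) (by linarith) hκ hmono (l := 0) (n := n + 1)
        (R := fun i j => eulerRemainder V x y (s + i * h) (s + j * h)) (ρ := C * h ^ (θ - 1)) ?_ ?_
        0 (n + 1) le_rfl (Nat.zero_le _) le_rfl
      · rw [hend, Nat.cast_zero, zero_mul, add_zero] at this
        exact this
      · intro i j k _ hij hjk hk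
        rw [eulerRemainder_defect]
        refine hdef _ (hmem i (by omega)) _ (hmem j (by omega)) _ (hmem k hk) (hmono hij)
          (hmono hjk) ?_
        have h1 := hmono (Nat.zero_le i)
        have h2 := hmono hk
        dsimp only [id] at h1 h2 hd ⊢
        rw [hend] at h2
        rw [Nat.cast_zero, zero_mul, add_zero] at h1
        linarith
      · intro i _ hi
        have hstep : s + (i + 1 : ℕ) * h - (s + i * h) = h := by push_cast; ring
        refine (hy _ (hmem i hi.le) _ (hmem (i + 1) hi) (hmono (Nat.le_succ i))).trans_eq ?_
        rw [hstep, mul_assoc, Real.rpow_sub_one' hh0 (by linarith)]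
        rcases hh0.eq_or_lt with h0 | h0
        · rw [← h0, Real.zero_rpow (by linarith)]; simp
        · rw [div_mul_cancel₀ _ h0.ne']
    have hlim : Filter.Tendsto (fun n : ℕ => sewingConst (2 * α) * κ * (t - s) ^ (2 * α) +
          C * ((t - s) / (n + 1 : ℕ)) ^ (θ - 1) * (t - s)) Filter.atTop
        (nhds (sewingConst (2 * α) * κ * (t - s) ^ (2 * α) + C * 0 ^ (θ - 1) * (t - s))) := by
      refine Filter.Tendsto.const_add _ (Filter.Tendsto.mul_const _ (Filter.Tendsto.const_mul _ ?_))
      refine Filter.Tendsto.rpow_const ?_ (Or.inr (by linarith))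
      exact ((tendsto_const_div_atTop_nhds_zero_nat (t - s)).comp (Filter.tendsto_add_atTop_nat 1))
    rw [Real.zero_rpow (by linarith), mul_zero, zero_mul, add_zero] at hlim
    exact ge_of_tendsto' hlim hbound
  · intro s hs t ht hst _
    have h1 := norm_increment_le hV x y (hx s hs t ht hst)
    have h2 := hy s hs t ht hst
    have hts : 0 ≤ t - s := sub_nonneg.2 hst
    have h3 : (t - s) ^ θ ≤ T ^ (θ - α) * (t - s) ^ α := by
      have : (t - s) ^ θ = (t - s) ^ (θ - α) * (t - s) ^ α := by
        rw [← Real.rpow_add' hts (by linarith)]; ring_nf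
      rw [this]
      refine mul_le_mul_of_nonneg_right (Real.rpow_le_rpow hts ?_ (by linarith))
        (Real.rpow_nonneg hts _)
      linarith [hs.1, ht.2]
    have h4 := mul_le_mul_of_nonneg_left h3 hC
    simp only [id]
    linarith

end FractionalEuler

namespace FractionalEuler

/-! ### Comparison of a solution with the Euler scheme -/

variable {E U : Type*} [NormedAddCommGroup E] [NormedSpace ℝ E]
    [NormedAddCommGroup U] [NormedSpace ℝ U] {V : E → U →L[ℝ] E} {K N α : ℝ}

/-- Comparison of an approximate and an exact Euler scheme over a short time window. -/
lemma euler_compare_window (hV : IsBoundedField V K) (hN : 0 ≤ N) (hα : 1 / 2 < α) (hα1 : α < 1)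
    {τ : ℕ → ℝ} (hτ : StrictMono τ) {l n : ℕ} {x : ℕ → U} {z u : ℕ → E} {Δ ρ : ℝ}
    (hln : l ≤ n) (hd : τ n - τ l ≤ Δ) (hρ : 0 ≤ ρ)
    (hx : ∀ i j, l ≤ i → i ≤ j → j ≤ n → ‖x j - x i‖ ≤ N * (τ j - τ i) ^ α)
    (hz : ∀ i j, l ≤ i → i ≤ j → j ≤ n → ‖z j - z i‖ ≤ 2 * (K * N) * (τ j - τ i) ^ α)
    (hu : ∀ i j, l ≤ i → i ≤ j → j ≤ n → ‖u j - u i‖ ≤ 2 * (K * N) * (τ j - τ i) ^ α)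
    (hRz : ∀ i, l ≤ i → i < n → ‖eulerRemainder V x z i (i + 1)‖ ≤ ρ * (τ (i + 1) - τ i))
    (hRu : ∀ i, l ≤ i → i < n → eulerRemainder V x u i (i + 1) = 0)
    (hsmall : 8 * sewingConst (2 * α) * (K * N * Δ ^ α) ≤ 1) {i j : ℕ} (hi : l ≤ i) (hij : i ≤ j)
    (hj : j ≤ n) :
    ‖(z j - u j) - (z i - u i)‖ ≤
      (4 * (K * N) * ‖z l - u l‖ + 2 * (ρ * Δ ^ (1 - α))) * (τ j - τ i) ^ α := by
  have hS := two_le_sewingConst (θ := 2 * α) (by linarith)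
  set S := sewingConst (2 * α) with hSdef
  have hK := hV.one_le
  have hΔ : 0 ≤ Δ := (sub_nonneg.2 (hτ.monotone hln)).trans hd
  set ε := K * N * Δ ^ α with hε
  have hε0 : 0 ≤ ε := by positivity
  have hSε : S * ε ≤ 1 / 8 := by linarith
  -- From `S * ε ≤ 1 / 8` and `S ≥ 2`.
  have hε1 : ε ≤ 1 / 16 := by nlinarith
  have hsub : ∀ i j, l ≤ i → i ≤ j → j ≤ n → 0 ≤ τ j - τ i ∧ τ j - τ i ≤ Δ := by
    intro i j hi hij hj
    have h1 := hτ.monotone hi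
    have h2 := hτ.monotone hij
    have h3 := hτ.monotone hj
    exact ⟨by linarith, by linarith⟩
  have hpow : ∀ i j, l ≤ i → i ≤ j → j ≤ n →
      0 ≤ (τ j - τ i) ^ α ∧ (τ j - τ i) ^ α ≤ Δ ^ α := fun i j hi hij hj =>
    ⟨Real.rpow_nonneg (hsub i j hi hij hj).1 _,
      Real.rpow_le_rpow (hsub i j hi hij hj).1 (hsub i j hi hij hj).2 (by linarith)⟩
  let J := {q : ℕ × ℕ // l ≤ q.1 ∧ q.1 ≤ q.2 ∧ q.2 ≤ n}
  obtain ⟨G, hG0, hG⟩ := exists_holder_of_strictMono hτ (fun k => z k - u k) n α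
  set e0 := ‖z l - u l‖ with he0
  have hmain := holder_of_halving (J := J) (A := 2 * (K * N) * e0 + ρ * Δ ^ (1 - α)) (G := G)
    (f := fun q => ‖(z q.1.2 - u q.1.2) - (z q.1.1 - u q.1.1)‖)
    (c := fun q => (τ q.1.2 - τ q.1.1) ^ α) (by positivity) hG0
    (fun q => hG _ _ q.2.2.1 q.2.2.2) (fun q => (hpow _ _ q.2.1 q.2.2.1 q.2.2.2).1) ?_
    ⟨(i, j), hi, hij, hj⟩
  · refine hmain.trans_eq ?_
    ring
  intro Q hQ hw
  have hw : ∀ i j, l ≤ i → i ≤ j → j ≤ n →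
      ‖(z j - u j) - (z i - u i)‖ ≤ Q * (τ j - τ i) ^ α :=
    fun i j hi hij hj => hw ⟨(i, j), hi, hij, hj⟩
  set X := e0 + Q * Δ ^ α with hX
  have hX0 : 0 ≤ X := by positivity
  have hsup : ∀ i, l ≤ i → i ≤ n → ‖z i - u i‖ ≤ X := by
    intro i hi hin
    have h1 := hw l i le_rfl hi hin
    have h2 := mul_le_mul_of_nonneg_left (hpow l i le_rfl hi hin).2 hQ
    have h3 : ‖z i - u i‖ ≤ ‖(z i - u i) - (z l - u l)‖ + ‖z l - u l‖ :=
      norm_le_norm_sub_add _ _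
    linarith
  -- In `κ`, the term `K * Q` comes from the increments of the error, and `4 * (K * (K * N)) * X`
  -- from the Hölder constants `2 * (K * N)` of both `z` and `u` times the supremum `X` of the
  -- error.
  have hsew := discrete_sewing (θ := 2 * α) (κ := (K * Q + 4 * (K * (K * N)) * X) * N) (ρ := ρ)
    (by linarith) (by positivity) hτ.monotone (l := l) (n := n)
    (R := fun i j => eulerRemainder V x z i j - eulerRemainder V x u i j) ?_ ?_
  · rintro ⟨⟨i, j⟩, hi, hij, hj⟩
    show ‖(z j - u j) - (z i - u i)‖ ≤ _ * (τ j - τ i) ^ α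
    have h1 := hsew i j hi hij hj
    obtain ⟨hp, hp'⟩ := hpow i j hi hij hj
    obtain ⟨ht, ht'⟩ := hsub i j hi hij hj
    rw [rpow_two_mul ht] at h1
    have h2 : ρ * (τ j - τ i) ≤ ρ * Δ ^ (1 - α) * (τ j - τ i) ^ α := by
      have : τ j - τ i = (τ j - τ i) ^ (1 - α) * (τ j - τ i) ^ α := by
        rw [← Real.rpow_add' ht (by norm_num)]; simp
      rw [mul_assoc]
      refine mul_le_mul_of_nonneg_left ?_ hρ
      conv_lhs => rw [this]
      exact mul_le_mul_of_nonneg_right (Real.rpow_le_rpow ht ht' (by linarith)) hp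
    have h3 : S * ((K * Q + 4 * (K * (K * N)) * X) * N) * ((τ j - τ i) ^ α * (τ j - τ i) ^ α) ≤
        (1 / 8 * Q + 1 / 2 * (K * N * X)) * (τ j - τ i) ^ α := by
      rw [← mul_assoc]
      refine mul_le_mul_of_nonneg_right ?_ hp
      calc _ ≤ S * ((K * Q + 4 * (K * (K * N)) * X) * N) * Δ ^ α :=
            mul_le_mul_of_nonneg_left hp' (by positivity)
        _ = S * ε * (Q + 4 * (K * N * X)) := by rw [hε]; ring
        _ ≤ 1 / 8 * (Q + 4 * (K * N * X)) :=
            mul_le_mul_of_nonneg_right hSε (by positivity)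
        _ = _ := by ring
    have h4 : ‖(V (z i) - V (u i)) (x j - x i)‖ ≤ K * N * X * (τ j - τ i) ^ α := by
      refine (ContinuousLinearMap.le_opNorm _ _).trans ((mul_le_mul ((hV.lipschitz _ _).trans
        (mul_le_mul_of_nonneg_left (hsup i hi (hij.trans hj)) (by linarith)))
        (hx i j hi hij hj) (norm_nonneg _) (by positivity)).trans_eq ?_)
      ring
    have h5 : (z j - u j) - (z i - u i) = (V (z i) - V (u i)) (x j - x i) +
        (eulerRemainder V x z i j - eulerRemainder V x u i j) := by
      simp only [eulerRemainder, sub_apply]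
      abel
    have h6 : ‖(z j - u j) - (z i - u i)‖ ≤
        (3 / 2 * (K * N * X) + 1 / 8 * Q + ρ * Δ ^ (1 - α)) * (τ j - τ i) ^ α := by
      rw [h5]
      refine (norm_add_le _ _).trans ?_
      linarith
    -- Since `K * N * X = K * N * e0 + ε * Q`, the total coefficient of `Q` is at most `3 / 32 + 1 /
    -- 8 < 1 / 2`, so `Q` can be absorbed.
    refine h6.trans (mul_le_mul_of_nonneg_right ?_ hp)
    have h7 : K * N * X = K * N * e0 + ε * Q := by rw [hX, hε]; ring
    have h8 : ε * Q ≤ 1 / 16 * Q := mul_le_mul_of_nonneg_right hε1 hQ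
    have h9 : 0 ≤ K * N * e0 := by positivity
    rw [h7]
    linarith
  · intro a b c ha hab hbc hc
    have hbn := hbc.trans hc
    -- The defect is a second-order difference of `V`. It must be small both in the error and in
    -- time; a Lipschitz bound gives only one of the two, `four_point` gives both.
    have hform : (eulerRemainder V x z a c - eulerRemainder V x u a c) -
        (eulerRemainder V x z a b - eulerRemainder V x u a b) -
        (eulerRemainder V x z b c - eulerRemainder V x u b c) =
        ((V (z b) - V (u b)) - (V (z a) - V (u a))) (x c - x b) := by
      have e1 := eulerRemainder_defect V x z a b c
      have e2 := eulerRemainder_defect V x u a b c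
      have : ((V (z b) - V (u b)) - (V (z a) - V (u a))) (x c - x b) =
          (V (z b) - V (z a)) (x c - x b) - (V (u b) - V (u a)) (x c - x b) := by
        simp only [sub_apply]; abel
      rw [this, ← e1, ← e2]
      abel
    rw [hform]
    have hac := hsub a c ha (hab.trans hbc) hc
    set W := (τ c - τ a) ^ α with hW
    have hW0 : 0 ≤ W := (hpow a c ha (hab.trans hbc) hc).1
    have m1 : (τ b - τ a) ^ α ≤ W := Real.rpow_le_rpow (hsub a b ha hab hbn).1
      (by linarith [hτ.monotone hbc]) (by linarith)
    have m2 : (τ c - τ b) ^ α ≤ W := Real.rpow_le_rpow (hsub b c (ha.trans hab) hbc hc).1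
      (by linarith [hτ.monotone hab]) (by linarith)
    have hKN : 0 ≤ 2 * (K * N) := by positivity
    have b1 := (hw a b ha hab hbn).trans (mul_le_mul_of_nonneg_left m1 hQ)
    have b2 := (hz a b ha hab hbn).trans (mul_le_mul_of_nonneg_left m1 hKN)
    have b3 := (hu a b ha hab hbn).trans (mul_le_mul_of_nonneg_left m1 hKN)
    have b4 := hsup a ha (hab.trans hbn)
    have b5 : ‖(V (z b) - V (u b)) - (V (z a) - V (u a))‖ ≤
        (K * Q + 4 * (K * (K * N)) * X) * W := by
      refine (hV.four_point _ _ _ _).trans ?_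
      have c1 : K * ‖z b - u b - (z a - u a)‖ ≤ K * (Q * W) :=
        mul_le_mul_of_nonneg_left b1 (by linarith)
      have c2 : K * (‖z b - z a‖ + ‖u b - u a‖) * ‖z a - u a‖ ≤
          K * (2 * (K * N) * W + 2 * (K * N) * W) * X :=
        mul_le_mul (mul_le_mul_of_nonneg_left (add_le_add b2 b3) (by linarith)) b4
          (norm_nonneg _) (by positivity)
      refine (add_le_add c1 c2).trans_eq ?_
      ring
    calc _ ≤ (K * Q + 4 * (K * (K * N)) * X) * W * (N * W) :=
          (ContinuousLinearMap.le_opNorm _ _).trans (mul_le_mul b5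
            ((hx b c (ha.trans hab) hbc hc).trans (mul_le_mul_of_nonneg_left m2 hN))
            (norm_nonneg _) (by positivity))
      _ = _ := by rw [rpow_two_mul hac.1]; ring
  · intro a ha han
    rw [hRu a ha han, sub_zero]
    exact hRz a ha han

/-- Comparison of an approximate and an exact Euler scheme over a grid, by iteration over time
windows of `p` steps. -/
lemma euler_compare_grid (hV : IsBoundedField V K) (hN : 0 ≤ N) (hα : 1 / 2 < α) (hα1 : α < 1)
    {τ : ℕ → ℝ} (hτ : StrictMono τ) {M p : ℕ} {x : ℕ → U} {z u : ℕ → E} {Δ ρ : ℝ}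
    (hp : ∀ i, τ (i + p) - τ i ≤ Δ) (hρ : 0 ≤ ρ) (hΔ : 0 ≤ Δ)
    (hx : ∀ i j, i ≤ j → j ≤ M → ‖x j - x i‖ ≤ N * (τ j - τ i) ^ α)
    (hz : ∀ i j, i ≤ j → j ≤ M → τ j - τ i ≤ Δ → ‖z j - z i‖ ≤ 2 * (K * N) * (τ j - τ i) ^ α)
    (hu : ∀ i j, i ≤ j → j ≤ M → τ j - τ i ≤ Δ → ‖u j - u i‖ ≤ 2 * (K * N) * (τ j - τ i) ^ α)
    (hRz : ∀ i < M, ‖eulerRemainder V x z i (i + 1)‖ ≤ ρ * (τ (i + 1) - τ i))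
    (hRu : ∀ i < M, eulerRemainder V x u i (i + 1) = 0)
    (hsmall : 8 * sewingConst (2 * α) * (K * N * Δ ^ α) ≤ 1) (h0 : z 0 = u 0) (b : ℕ) :
    ∀ i ≤ M, i ≤ b * p → ‖z i - u i‖ ≤ (2 ^ b - 1) * (2 * (ρ * Δ)) := by
  have hS := two_le_sewingConst (θ := 2 * α) (by linarith)
  have hK := hV.one_le
  have hmono := hτ.monotone
  have hρΔ : 0 ≤ 2 * (ρ * Δ) := by positivity
  induction b with
  | zero =>
    intro i _ hi
    obtain rfl : i = 0 := by simpa using hi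
    simp [h0]
  | succ b ih =>
    intro i hiM hi
    have h2 : (2 : ℝ) ^ (b + 1) = 2 * 2 ^ b := by ring
    have h1 : (1 : ℝ) ≤ 2 ^ b := one_le_pow₀ (by norm_num)
    rcases le_total i (b * p) with hib | hib
    · refine (ih i hiM hib).trans (mul_le_mul_of_nonneg_right ?_ hρΔ)
      linarith
    · have hwin : ∀ j k, b * p ≤ j → j ≤ k → k ≤ i → τ k - τ j ≤ Δ := by
        intro j k hj hjk hk
        have a1 := hmono hj
        have a2 : τ k ≤ τ (b * p + p) := hmono (hk.trans (hi.trans_eq (by ring)))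
        have a3 := hp (b * p)
        linarith
      have hcmp := euler_compare_window hV hN hα hα1 hτ (l := b * p) (n := i) (Δ := Δ) hib
        (hwin _ _ le_rfl hib le_rfl) hρ (fun j k _ hjk hk => hx j k hjk (hk.trans hiM))
        (fun j k hj hjk hk => hz j k hjk (hk.trans hiM) (hwin j k hj hjk hk))
        (fun j k hj hjk hk => hu j k hjk (hk.trans hiM) (hwin j k hj hjk hk))
        (fun j _ hj => hRz j (hj.trans_le hiM)) (fun j _ hj => hRu j (hj.trans_le hiM)) hsmall
        le_rfl hib le_rfl
      set e := ‖z (b * p) - u (b * p)‖ with he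
      have he' := ih (b * p) (hib.trans hiM) le_rfl
      have hw0 : 0 ≤ τ i - τ (b * p) := sub_nonneg.2 (hmono hib)
      have hw1 : (τ i - τ (b * p)) ^ α ≤ Δ ^ α :=
        Real.rpow_le_rpow hw0 (hwin _ _ le_rfl hib le_rfl) (by linarith)
      have hε : 0 ≤ K * N * Δ ^ α := by positivity
      have hε1 : K * N * Δ ^ α ≤ 1 / 16 := by nlinarith
      have hΔα : Δ ^ (1 - α) * Δ ^ α = Δ := by
        rw [← Real.rpow_add' hΔ (by norm_num)]; simp
      -- A window adds at most `e + 2 * (ρ * Δ)` to the error `e` at its left end. The recursion `e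
      -- ↦ 2 * e + 2 * (ρ * Δ)` started at zero gives the factor `2 ^ b - 1`.
      have hstep : (4 * (K * N) * e + 2 * (ρ * Δ ^ (1 - α))) * (τ i - τ (b * p)) ^ α ≤
          e + 2 * (ρ * Δ) := by
        calc _ ≤ (4 * (K * N) * e + 2 * (ρ * Δ ^ (1 - α))) * Δ ^ α :=
              mul_le_mul_of_nonneg_left hw1 (by positivity)
          _ = 4 * (K * N * Δ ^ α) * e + 2 * (ρ * (Δ ^ (1 - α) * Δ ^ α)) := by ring
          _ ≤ 1 * e + 2 * (ρ * Δ) := by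
              rw [hΔα]
              have : 4 * (K * N * Δ ^ α) ≤ 1 := by linarith
              have := mul_le_mul_of_nonneg_right this (norm_nonneg (z (b * p) - u (b * p)))
              linarith
          _ = _ := by ring
      have hnorm : ‖z i - u i‖ ≤ ‖(z i - u i) - (z (b * p) - u (b * p))‖ + e :=
        norm_le_norm_sub_add _ _
      rw [h2]
      nlinarith

end FractionalEuler

namespace FractionalEuler

variable {E U : Type*} [NormedAddCommGroup E] [NormedSpace ℝ E]
    [NormedAddCommGroup U] [NormedSpace ℝ U] {V : E → U →L[ℝ] E} {K N α T : ℝ}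

/-! ### From the grid to continuous time -/

lemma strictMono_grid (hT : 0 < T) {M : ℕ} (hM : 1 ≤ M) :
    StrictMono fun k : ℕ => (k : ℝ) * T / M := by
  intro i j hij
  have hM' : (0 : ℝ) < M := by positivity
  have : (i : ℝ) < j := by exact_mod_cast hij
  dsimp only
  gcongr

lemma grid_self {M : ℕ} (hM : 1 ≤ M) : (M : ℝ) * T / M = T := by
  have hM' : (M : ℝ) ≠ 0 := by positivity
  field_simp

lemma grid_mem_Icc (hT : 0 < T) {M : ℕ} (hM : 1 ≤ M) {k : ℕ} (hk : k ≤ M) :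
    (k : ℝ) * T / M ∈ Set.Icc 0 T := by
  refine ⟨by positivity, ?_⟩
  have := (strictMono_grid hT hM).monotone hk
  rwa [grid_self hM] at this

lemma exists_grid_cell (hT : 0 < T) {M : ℕ} (hM : 1 ≤ M) {t : ℝ} (ht : t ∈ Set.Icc 0 T) :
    ∃ k < M, t ∈ Set.Icc ((k : ℝ) * T / M) ((k + 1 : ℕ) * T / M) := by
  have hM' : (0 : ℝ) < M := by positivity
  rcases ht.2.eq_or_lt with rfl | hlt
  -- At `t = T` the floor would be `M`, which is no cell; the closed last cell contains `T`.
  · refine ⟨M - 1, by omega, (grid_mem_Icc hT hM (by omega)).2, ?_⟩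
    rw [Nat.sub_add_cancel hM, grid_self hM]
  · have h0 : 0 ≤ t * M / T := div_nonneg (mul_nonneg ht.1 hM'.le) hT.le
    refine ⟨⌊t * M / T⌋₊, ?_, ?_, ?_⟩
    · rw [Nat.floor_lt h0, div_lt_iff₀ hT, mul_comm]
      exact mul_lt_mul_of_pos_left hlt hM'
    · have := Nat.floor_le h0
      rw [le_div_iff₀ hT] at this
      rwa [div_le_iff₀ hM']
    · have := (Nat.lt_floor_add_one (t * M / T)).le
      rw [div_le_iff₀ hT] at this
      rw [le_div_iff₀ hM']
      exact_mod_cast this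

/-- Hölder bounds in the cells of a grid and between grid points give a Hölder bound. -/
lemma holder_of_cells {F : Type*} [SeminormedAddCommGroup F] (hT : 0 < T) (hα : 0 ≤ α)
    {M : ℕ} (hM : 1 ≤ M) {f : ℝ → F} {Q₁ Q₂ : ℝ}
    (hQ₁ : 0 ≤ Q₁) (hQ₂ : 0 ≤ Q₂)
    (hcell : ∀ k < M, ∀ s ∈ Set.Icc ((k : ℝ) * T / M) ((k + 1 : ℕ) * T / M),
      ∀ t ∈ Set.Icc ((k : ℝ) * T / M) ((k + 1 : ℕ) * T / M), s ≤ t →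
        ‖f t - f s‖ ≤ Q₁ * (t - s) ^ α)
    (hgrid : ∀ i j : ℕ, i ≤ j → j ≤ M →
      ‖f (j * T / M) - f (i * T / M)‖ ≤ Q₂ * (j * T / M - i * T / M) ^ α)
    {s t : ℝ} (hs : s ∈ Set.Icc 0 T) (ht : t ∈ Set.Icc 0 T) (hst : s ≤ t) :
    ‖f t - f s‖ ≤ (2 * Q₁ + Q₂) * (t - s) ^ α := by
  obtain ⟨k, hk, hks⟩ := exists_grid_cell hT hM hs
  obtain ⟨l, hl, hlt⟩ := exists_grid_cell hT hM ht
  have hmono := (strictMono_grid hT hM).monotone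
  have hp : 0 ≤ (t - s) ^ α := Real.rpow_nonneg (sub_nonneg.2 hst) _
  rcases lt_trichotomy k l with h | rfl | h
  · have h1 : ((k + 1 : ℕ) : ℝ) * T / M ≤ l * T / M := hmono (Nat.succ_le_of_lt h)
    have a1 := hcell k hk s hks _ ⟨hmono (Nat.le_succ k), le_rfl⟩ hks.2
    have a2 := hgrid (k + 1) l h hl.le
    have a3 := hcell l hl _ ⟨le_rfl, hmono (Nat.le_succ l)⟩ t hlt hlt.1
    have b : ∀ c d, s ≤ c → c ≤ d → d ≤ t → (d - c) ^ α ≤ (t - s) ^ α := fun c d h1 h2 h3 =>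
      Real.rpow_le_rpow (by linarith) (by linarith) hα
    have c1 := mul_le_mul_of_nonneg_left (b _ _ le_rfl hks.2 (h1.trans hlt.1)) hQ₁
    have c2 := mul_le_mul_of_nonneg_left (b _ _ hks.2 h1 hlt.1) hQ₂
    have c3 := mul_le_mul_of_nonneg_left (b _ _ (hks.2.trans h1) hlt.1 le_rfl) hQ₁
    have : f t - f s = (f (((k + 1 : ℕ) : ℝ) * T / M) - f s) +
        (f (l * T / M) - f (((k + 1 : ℕ) : ℝ) * T / M)) + (f t - f (l * T / M)) := by abel
    rw [this]
    refine norm_add₃_le.trans ?_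
    linarith
  · have := hcell k hk s hks t hlt hst
    have h2 : 0 ≤ (Q₁ + Q₂) * (t - s) ^ α := by positivity
    linarith
  · have h1 : ((l + 1 : ℕ) : ℝ) * T / M ≤ k * T / M := hmono (Nat.succ_le_of_lt h)
    obtain rfl : s = t := le_antisymm hst (hlt.2.trans (h1.trans hks.1))
    rw [sub_self, norm_zero]
    positivity

/-- A local Hölder bound gives a global one. -/
lemma holder_of_local {F : Type*} [SeminormedAddCommGroup F] (hα : 0 ≤ α) {f : ℝ → F}
    {Δ G : ℝ} (hΔ : 0 < Δ) (hG : 0 ≤ G)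
    (hf : ∀ s ∈ Set.Icc 0 T, ∀ t ∈ Set.Icc 0 T, s ≤ t → t - s ≤ Δ →
      ‖f t - f s‖ ≤ G * (t - s) ^ α)
    {s t : ℝ} (hs : s ∈ Set.Icc 0 T) (ht : t ∈ Set.Icc 0 T) (hst : s ≤ t) :
    ‖f t - f s‖ ≤ (T / Δ + 1) * G * (t - s) ^ α := by
  have hts : 0 ≤ t - s := sub_nonneg.2 hst
  obtain ⟨n, hn1, hn2, hn0⟩ : ∃ n : ℕ, (t - s) ≤ n * Δ ∧ (n : ℝ) ≤ T / Δ + 1 ∧ 0 < n := by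
    refine ⟨⌊(t - s) / Δ⌋₊ + 1, ?_, ?_, Nat.succ_pos _⟩
    · have := (Nat.lt_floor_add_one ((t - s) / Δ)).le
      rw [div_le_iff₀ hΔ] at this
      exact_mod_cast this
    · have h1 := Nat.floor_le (div_nonneg hts hΔ.le)
      have h2 : (t - s) / Δ ≤ T / Δ := by
        gcongr
        linarith [hs.1, ht.2]
      push_cast
      linarith
  have hn' : (0 : ℝ) < n := by exact_mod_cast hn0
  set h := (t - s) / n with hh
  have hh0 : 0 ≤ h := by positivity
  have hhΔ : h ≤ Δ := by rw [hh, div_le_iff₀ hn']; linarith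
  have hnh : n * h = t - s := by rw [hh]; field_simp
  have hk : ∀ k : ℕ, k ≤ n → ‖f (s + k * h) - f s‖ ≤ k * (G * (t - s) ^ α) := by
    intro k
    induction k with
    | zero => intro _; simp
    | succ k ih =>
      intro hk
      have hle : (k + 1 : ℕ) * h ≤ n * h :=
        mul_le_mul_of_nonneg_right (by exact_mod_cast hk) hh0
      have hk0 : 0 ≤ (k : ℝ) * h := by positivity
      have hkk : ((k + 1 : ℕ) : ℝ) * h = k * h + h := by push_cast; ring
      have h1 := hf (s + k * h) ⟨by linarith [hs.1], by linarith [ht.2]⟩ (s + (k + 1 : ℕ) * h)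
        ⟨by linarith [hs.1], by linarith [ht.2]⟩ (by linarith) (by linarith)
      have h2 : (s + (k + 1 : ℕ) * h - (s + k * h)) ^ α ≤ (t - s) ^ α :=
        Real.rpow_le_rpow (by linarith) (by linarith) hα
      have h3 := mul_le_mul_of_nonneg_left h2 hG
      have h4 := ih (by omega)
      have h5 : ‖f (s + (k + 1 : ℕ) * h) - f s‖ ≤
          ‖f (s + (k + 1 : ℕ) * h) - f (s + k * h)‖ + ‖f (s + k * h) - f s‖ :=
        norm_sub_le_norm_sub_add_norm_sub _ _ _
      have h6 : ((k + 1 : ℕ) : ℝ) * (G * (t - s) ^ α) =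
        k * (G * (t - s) ^ α) + G * (t - s) ^ α := by push_cast; ring
      rw [h6]
      linarith
  have := hk n le_rfl
  rw [hnh, add_sub_cancel] at this
  rw [mul_assoc]
  exact this.trans (mul_le_mul_of_nonneg_right hn2 (by positivity))

/-! ### The error of the Euler scheme, pathwise -/

/-- A crude bound for the error of the Euler scheme, used for few time steps. -/
lemma euler_error_coarse (hV : IsBoundedField V K) (hN : 0 ≤ N) (hα : 1 / 2 < α)
    (hT : 0 < T) {x : ℝ → U} {y u : ℝ → E} {Δ : ℝ} (hΔ : 0 < Δ)
    (hx : ∀ s ∈ Set.Icc 0 T, ∀ t ∈ Set.Icc 0 T, s ≤ t → ‖x t - x s‖ ≤ N * (t - s) ^ α)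
    (hy : ∀ s ∈ Set.Icc 0 T, ∀ t ∈ Set.Icc 0 T, s ≤ t → t - s ≤ Δ →
      ‖y t - y s‖ ≤ 2 * (K * N) * (t - s) ^ α)
    {M : ℕ} (hM : 1 ≤ M) (hMΔ : M ≤ T / Δ)
    (hu : ∀ k < M, ∀ t ∈ Set.Icc ((k : ℝ) * T / M) ((k + 1 : ℕ) * T / M),
      u t = u (k * T / M) + V (u (k * T / M)) (x t - x (k * T / M)))
    {s t : ℝ} (hs : s ∈ Set.Icc 0 T) (ht : t ∈ Set.Icc 0 T) (hst : s ≤ t) :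
    ‖(y t - u t) - (y s - u s)‖ ≤ 9 * (K * N) * (T / Δ + 1) * (t - s) ^ α := by
  have hK := hV.one_le
  have hmono := (strictMono_grid hT hM).monotone
  have hA : 0 ≤ K * N := by positivity
  have hr : 0 ≤ T / Δ := by positivity
  have hyg : ∀ s ∈ Set.Icc 0 T, ∀ t ∈ Set.Icc 0 T, s ≤ t →
      ‖y t - y s‖ ≤ (T / Δ + 1) * (2 * (K * N)) * (t - s) ^ α :=
    fun s hs t ht hst => holder_of_local (by linarith) hΔ (by positivity) hy hs ht hst
  have hIcc : ∀ k < M, ∀ t ∈ Set.Icc ((k : ℝ) * T / M) ((k + 1 : ℕ) * T / M),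
      t ∈ Set.Icc 0 T := fun k hk t ht =>
    ⟨(grid_mem_Icc hT hM hk.le).1.trans ht.1, ht.2.trans (grid_mem_Icc hT hM hk).2⟩
  have hucell : ∀ k < M, ∀ s ∈ Set.Icc ((k : ℝ) * T / M) ((k + 1 : ℕ) * T / M),
      ∀ t ∈ Set.Icc ((k : ℝ) * T / M) ((k + 1 : ℕ) * T / M), s ≤ t →
        ‖u t - u s‖ ≤ K * N * (t - s) ^ α := by
    intro k hk s hs t ht hst
    rw [hu k hk s hs, hu k hk t ht, add_sub_add_left_eq_sub, ← map_sub, sub_sub_sub_cancel_right,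
      mul_assoc]
    exact (ContinuousLinearMap.le_opNorm _ _).trans (mul_le_mul (hV.norm_le _)
      (hx s (hIcc k hk s hs) t (hIcc k hk t ht) hst) (norm_nonneg _) (by linarith))
  -- With such long steps the window estimates do not apply to `u`, so its cell increments are
  -- simply summed; there are at most `M ≤ T / Δ` of them.
  have hugrid : ∀ i d : ℕ, i + d ≤ M → ‖u ((i + d : ℕ) * T / M) - u (i * T / M)‖ ≤
      d * (K * N * (((i + d : ℕ) : ℝ) * T / M - i * T / M) ^ α) := by
    intro i d
    induction d with
    | zero => intro _; simp
    | succ d ih =>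
      intro hd
      have h1 := ih (by omega)
      have h2 := hucell (i + d) (by omega) _ ⟨le_rfl, hmono (Nat.le_succ _)⟩ _
        ⟨hmono (Nat.le_succ _), le_rfl⟩ (hmono (Nat.le_succ _))
      have m1 : (i : ℝ) * T / M ≤ (i + d : ℕ) * T / M := hmono (Nat.le_add_right i d)
      have m2 : ((i + d : ℕ) : ℝ) * T / M ≤ (i + d + 1 : ℕ) * T / M := hmono (Nat.le_succ _)
      set W := (((i + d + 1 : ℕ) : ℝ) * T / M - i * T / M) ^ α with hW
      have w1 : (((i + d : ℕ) : ℝ) * T / M - i * T / M) ^ α ≤ W :=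
        Real.rpow_le_rpow (by linarith) (by linarith) (by linarith)
      have w2 : (((i + d + 1 : ℕ) : ℝ) * T / M - (i + d : ℕ) * T / M) ^ α ≤ W :=
        Real.rpow_le_rpow (by linarith) (by linarith) (by linarith)
      have h3 : ‖u ((i + d + 1 : ℕ) * T / M) - u (i * T / M)‖ ≤
          ‖u ((i + d + 1 : ℕ) * T / M) - u ((i + d : ℕ) * T / M)‖ +
            ‖u ((i + d : ℕ) * T / M) - u (i * T / M)‖ :=
        norm_sub_le_norm_sub_add_norm_sub _ _ _
      have h4 := mul_le_mul_of_nonneg_left w2 hA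
      have h5 := mul_le_mul_of_nonneg_left (mul_le_mul_of_nonneg_left w1 hA) (Nat.cast_nonneg d)
      have h6 : ((d + 1 : ℕ) : ℝ) * (K * N * W) = d * (K * N * W) + K * N * W := by
        push_cast; ring
      show ‖u ((i + d + 1 : ℕ) * T / M) - u (i * T / M)‖ ≤ _
      rw [show i + (d + 1) = i + d + 1 from rfl, ← hW, h6]
      linarith
  have hnorm : ∀ s t, ‖(y t - u t) - (y s - u s)‖ ≤ ‖y t - y s‖ + ‖u t - u s‖ := fun s t => by
    rw [show (y t - u t) - (y s - u s) = (y t - y s) - (u t - u s) by abel]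
    exact norm_sub_le _ _
  refine (holder_of_cells (α := α) hT (by linarith) hM (f := fun t => y t - u t)
    (Q₁ := (T / Δ + 1) * (2 * (K * N)) + K * N)
    (Q₂ := (T / Δ + 1) * (2 * (K * N)) + T / Δ * (K * N)) (by positivity) (by positivity)
    ?_ ?_ hs ht hst).trans ?_
  · intro k hk s hs t ht hst
    have h1 := hyg s (hIcc k hk s hs) t (hIcc k hk t ht) hst
    have h2 := hucell k hk s hs t ht hst
    refine (hnorm s t).trans ?_
    linarith
  · intro i j hij hj
    obtain ⟨d, rfl⟩ := Nat.exists_eq_add_of_le hij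
    have m1 : (i : ℝ) * T / M ≤ (i + d : ℕ) * T / M := hmono hij
    have h1 := hyg _ (grid_mem_Icc hT hM (hij.trans hj)) _ (grid_mem_Icc hT hM hj) m1
    have h2 := hugrid i d hj
    have hW : 0 ≤ (((i + d : ℕ) : ℝ) * T / M - i * T / M) ^ α :=
      Real.rpow_nonneg (sub_nonneg.2 m1) _
    have hd : (d : ℝ) ≤ T / Δ := by
      refine le_trans ?_ hMΔ
      exact_mod_cast (by omega : d ≤ M)
    have h3 := mul_le_mul_of_nonneg_right hd (mul_nonneg hA hW)
    refine (hnorm _ _).trans ?_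
    linarith
  · refine mul_le_mul_of_nonneg_right ?_ (Real.rpow_nonneg (sub_nonneg.2 hst) _)
    have : 0 ≤ K * N * (T / Δ) := by positivity
    nlinarith

end FractionalEuler

/-! ### Small time steps, and the pathwise error theorem -/

namespace FractionalEuler

variable {E U : Type*} [NormedAddCommGroup E] [NormedSpace ℝ E]
    [NormedAddCommGroup U] [NormedSpace ℝ U] {V : E → U →L[ℝ] E} {K N α T : ℝ}

/-- The error of the Euler scheme when the time steps are small. -/
lemma euler_error_fine (hV : IsBoundedField V K) (hN : 1 ≤ N) (hα : 1 / 2 < α) (hα1 : α < 1)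
    (hT : 0 < T) {x : ℝ → U} {y u : ℝ → E} {Δ : ℝ} (hΔ : 0 < Δ)
    (hsmall : 8 * sewingConst (2 * α) * (K * N * Δ ^ α) = 1)
    (hx : ∀ s ∈ Set.Icc 0 T, ∀ t ∈ Set.Icc 0 T, s ≤ t → ‖x t - x s‖ ≤ N * (t - s) ^ α)
    (hy : ∀ s ∈ Set.Icc 0 T, ∀ t ∈ Set.Icc 0 T, s ≤ t → t - s ≤ Δ →
      ‖y t - y s‖ ≤ 2 * (K * N) * (t - s) ^ α ∧
      ‖eulerRemainder V x y s t‖ ≤ 2 * sewingConst (2 * α) * (K * N) ^ 2 * (t - s) ^ (2 * α))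
    {M : ℕ} (hM : 1 ≤ M) (hMΔ : T / M ≤ Δ)
    (hu : ∀ k < M, ∀ t ∈ Set.Icc ((k : ℝ) * T / M) ((k + 1 : ℕ) * T / M),
      u t = u (k * T / M) + V (u (k * T / M)) (x t - x (k * T / M)))
    (h0 : y 0 = u 0)
    {s t : ℝ} (hs : s ∈ Set.Icc 0 T) (ht : t ∈ Set.Icc 0 T) (hst : s ≤ t) :
    ‖(y t - u t) - (y s - u s)‖ ≤
      (6 * sewingConst (2 * α) * T ^ (1 - α) + 68 * sewingConst (2 * α) ^ 2 +
        4 * sewingConst (2 * α)) * T ^ (2 * α - 1) * (K * N) ^ 3 * Real.exp (2 * (T / Δ) + 1) *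
        (M : ℝ) ^ (1 - 2 * α) * (t - s) ^ α := by
  have hK := hV.one_le
  have hS := two_le_sewingConst (θ := 2 * α) (by linarith)
  set S := sewingConst (2 * α) with hSdef
  have hA : 1 ≤ K * N := one_le_mul_of_one_le_of_one_le hK hN
  set A := K * N with hAdef
  have hmono := (strictMono_grid hT hM).monotone
  have hM' : (0 : ℝ) < M := by positivity
  set h := T / M with hh
  have hh0 : 0 < h := by positivity
  have hstep : ∀ k : ℕ, ((k + 1 : ℕ) : ℝ) * T / M - k * T / M = h := fun k => by
    push_cast; rw [hh]; ring
  have hΔα : 0 < Δ ^ α := Real.rpow_pos_of_pos hΔ _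
  have hε : A * Δ ^ α ≤ 1 / 16 := by nlinarith [mul_pos (lt_of_lt_of_le one_pos hA) hΔα]
  have hΔ1 : Δ ≤ 1 := by
    by_contra hcon
    have := Real.one_le_rpow (not_le.1 hcon).le (by linarith : 0 ≤ α)
    nlinarith
  have hIcc : ∀ k < M, ∀ t ∈ Set.Icc ((k : ℝ) * T / M) ((k + 1 : ℕ) * T / M),
      t ∈ Set.Icc 0 T := fun k hk t ht =>
    ⟨(grid_mem_Icc hT hM hk.le).1.trans ht.1, ht.2.trans (grid_mem_Icc hT hM hk).2⟩
  set g := h ^ (2 * α - 1) with hg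
  have hg0 : 0 ≤ g := by positivity
  have hgh : h ^ (2 * α) = g * h := by
    rw [hg, Real.rpow_sub_one hh0.ne', div_mul_cancel₀ _ hh0.ne']
  have hhα : h ^ α ≤ T ^ (1 - α) * g := by
    have h1 : h ^ α = h ^ (1 - α) * g := by
      rw [hg, ← Real.rpow_add hh0]; ring_nf
    have h2 : h ≤ T := div_le_self hT.le (by exact_mod_cast hM)
    rw [h1]
    exact mul_le_mul_of_nonneg_right (Real.rpow_le_rpow hh0.le h2 (by linarith)) hg0
  -- The solution's remainder on one step is at most `2 * S * A ^ 2 * h ^ (2 * α) = ρ * h`. Through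
  -- `g = h ^ (2 * α - 1)`, `ρ` carries the final rate in `M`.
  set ρ := 2 * S * A ^ 2 * g with hρdef
  have hρ : 0 ≤ ρ := by positivity
  -- the windows
  have hΔh : 1 ≤ Δ / h := (one_le_div hh0).2 hMΔ
  set p := ⌊Δ / h⌋₊ with hp
  have hp1 : 1 ≤ p := Nat.one_le_floor_iff _ |>.2 hΔh
  have hp1' : (1 : ℝ) ≤ p := by exact_mod_cast hp1
  have hpΔ : p * h ≤ Δ := by
    rw [← le_div_iff₀ hh0]; exact Nat.floor_le (by positivity)
  have hp2 : Δ / h ≤ 2 * p := by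
    have := (Nat.lt_floor_add_one (Δ / h)).le
    rw [← hp] at this
    linarith
  -- `b` windows of `p` steps cover the grid. As `p ≥ 1`, rounding `Δ / h` down loses at most a
  -- factor `2`, whence `b ≤ 2 * (T / Δ) + 1`.
  set b := M / p + 1 with hb
  have hbp : M ≤ b * p := by
    have h1 := Nat.div_add_mod M p
    have h2 := Nat.mod_lt M hp1
    rw [hb, add_mul, one_mul, mul_comm]
    omega
  have hbexp : (2 : ℝ) ^ b ≤ Real.exp (2 * (T / Δ) + 1) := by
    have h1 : ((M / p : ℕ) : ℝ) ≤ 2 * (T / Δ) := by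
      refine Nat.cast_div_le.trans ?_
      rw [div_le_iff₀ (by linarith)]
      have h3 : Δ * M ≤ 2 * p * T := by
        have : Δ / h = Δ * M / T := by rw [hh]; field_simp
        rwa [this, div_le_iff₀ hT] at hp2
      rw [mul_assoc, div_mul_eq_mul_div, ← mul_div_assoc, le_div_iff₀ hΔ]
      linarith
    have h2 : (2 : ℝ) ≤ Real.exp 1 := by
      have := Real.add_one_le_exp (1 : ℝ); linarith
    calc (2 : ℝ) ^ b ≤ Real.exp 1 ^ b := pow_le_pow_left₀ (by norm_num) h2 _
      _ = Real.exp b := by rw [← Real.exp_nat_mul, mul_one]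
      _ ≤ _ := Real.exp_le_exp.2 (by rw [hb]; push_cast; linarith)
  set D := Real.exp (2 * (T / Δ) + 1) with hD
  have hD1 : 1 ≤ D := Real.one_le_exp (by positivity)
  -- grid quantities
  let τ : ℕ → ℝ := fun k => (k : ℝ) * T / M
  have hτ : StrictMono τ := strictMono_grid hT hM
  have hτI : ∀ k ≤ M, τ k ∈ Set.Icc 0 T := fun k hk => grid_mem_Icc hT hM hk
  have hxg : ∀ i j, i ≤ j → j ≤ M → ‖x (τ j) - x (τ i)‖ ≤ N * (τ j - τ i) ^ α :=
    fun i j hij hj => hx _ (hτI i (hij.trans hj)) _ (hτI j hj) (hτ.monotone hij)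
  have hRu : ∀ i < M, eulerRemainder V (fun k => x (τ k)) (fun k => u (τ k)) i (i + 1) = 0 := by
    intro i hi
    have := hu i hi _ ⟨hmono (Nat.le_succ i), le_rfl⟩
    simp only [eulerRemainder, τ]
    rw [this]
    abel
  have hzg : ∀ i j, i ≤ j → j ≤ M → τ j - τ i ≤ Δ →
      ‖y (τ j) - y (τ i)‖ ≤ 2 * (K * N) * (τ j - τ i) ^ α :=
    fun i j hij hj hd => (hy _ (hτI i (hij.trans hj)) _ (hτI j hj) (hτ.monotone hij) hd).1
  have hug : ∀ i j, i ≤ j → j ≤ M → τ j - τ i ≤ Δ →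
      ‖u (τ j) - u (τ i)‖ ≤ 2 * (K * N) * (τ j - τ i) ^ α :=
    fun i j hij hj hd => euler_grid_local_holder hV (by linarith) hα hτ
      (x := fun k => x (τ k)) (w := fun k => u (τ k)) hxg hRu (by linarith) hij hj hd
  have hRz : ∀ i < M, ‖eulerRemainder V (fun k => x (τ k)) (fun k => y (τ k)) i (i + 1)‖ ≤
      ρ * (τ (i + 1) - τ i) := by
    intro i hi
    have hs : τ (i + 1) - τ i = h := hstep i
    have := (hy _ (hτI i hi.le) _ (hτI (i + 1) hi) (hτ.monotone (Nat.le_succ i))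
      (by rw [hs]; exact hMΔ)).2
    rw [hs] at this ⊢
    rw [hgh] at this
    refine this.trans_eq ?_
    rw [hρdef]; ring
  set X := D * (2 * ρ) with hX
  have hX0 : 0 ≤ X := by positivity
  have hsup : ∀ i ≤ M, ‖y (τ i) - u (τ i)‖ ≤ X := by
    intro i hi
    have := euler_compare_grid hV (by linarith) hα hα1 hτ (M := M) (p := p) (Δ := Δ) (ρ := ρ)
      (x := fun k => x (τ k)) (z := fun k => y (τ k)) (u := fun k => u (τ k)) ?_ hρ hΔ.le
      hxg hzg hug hRz hRu hsmall.le (by simpa [τ] using h0) b i hi (hi.trans hbp)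
    · refine this.trans ?_
      have h1 : ρ * Δ ≤ ρ := mul_le_of_le_one_right hρ hΔ1
      exact mul_le_mul (by linarith) (by linarith) (by positivity) (by linarith)
    · intro i
      refine le_trans (le_of_eq ?_) hpΔ
      simp only [τ]
      push_cast; rw [hh]; ring
  have hgrid : ∀ i j : ℕ, i ≤ j → j ≤ M → ‖(y (τ j) - u (τ j)) - (y (τ i) - u (τ i))‖ ≤
      (16 * S * A * X + 2 * ρ) * (τ j - τ i) ^ α := by
    intro i j hij hj
    have hτ0 : 0 ≤ τ j - τ i := sub_nonneg.2 (hτ.monotone hij)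
    have hW : 0 ≤ (τ j - τ i) ^ α := Real.rpow_nonneg hτ0 _
    have hAX : 0 ≤ A * X := by positivity
    rcases le_total (τ j - τ i) Δ with hd | hd
    · have hwin : ∀ k l, i ≤ k → k ≤ l → l ≤ j → τ l - τ k ≤ Δ := by
        intro k l hk hkl hl
        have h1 := hτ.monotone hk
        have h2 := hτ.monotone hl
        linarith
      refine (euler_compare_window hV (by linarith) hα hα1 hτ (l := i) (n := j)
        (x := fun k => x (τ k)) (z := fun k => y (τ k)) (u := fun k => u (τ k)) hij hd hρ
        (fun k l _ hkl hl => hxg k l hkl (hl.trans hj))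
        (fun k l hk hkl hl => hzg k l hkl (hl.trans hj) (hwin k l hk hkl hl))
        (fun k l hk hkl hl => hug k l hkl (hl.trans hj) (hwin k l hk hkl hl))
        (fun k _ hk => hRz k (hk.trans_le hj)) (fun k _ hk => hRu k (hk.trans_le hj)) hsmall.le
        le_rfl hij le_rfl).trans ?_
      refine mul_le_mul_of_nonneg_right ?_ hW
      have h1 := mul_le_mul_of_nonneg_left (hsup i (hij.trans hj)) (by linarith : 0 ≤ 4 * A)
      have h2 : ρ * Δ ^ (1 - α) ≤ ρ :=
        mul_le_of_le_one_right hρ (Real.rpow_le_one hΔ.le hΔ1 (by linarith))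
      have h3 : 2 * (A * X) ≤ S * (A * X) := mul_le_mul_of_nonneg_right hS hAX
      linarith
    · have h1 := hsup i (hij.trans hj)
      have h2 := hsup j hj
      have h3 : Δ ^ α ≤ (τ j - τ i) ^ α := Real.rpow_le_rpow hΔ.le hd (by linarith)
      -- For points further apart than `Δ` the supremum bound is enough: equality in `hsmall` makes
      -- `Δ ^ α` comparable to `1 / A`, so `2 * X` is already a Hölder bound.
      have h4 : 2 * X = 16 * S * A * X * Δ ^ α := by
        have : 16 * S * A * X * Δ ^ α = 2 * X * (8 * S * (A * Δ ^ α)) := by ring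
        rw [this, hsmall, mul_one]
      have h5 : 16 * S * A * X * Δ ^ α ≤ 16 * S * A * X * (τ j - τ i) ^ α :=
        mul_le_mul_of_nonneg_left h3 (by positivity)
      have h6 : 0 ≤ ρ * (τ j - τ i) ^ α := by positivity
      refine (norm_sub_le _ _).trans ?_
      linarith
  refine (holder_of_cells (α := α) hT (by linarith) hM (f := fun t => y t - u t)
    (Q₁ := 3 * S * A ^ 2 * h ^ α + A * X) (Q₂ := 16 * S * A * X + 2 * ρ) (by positivity)
    (by positivity) ?_ hgrid hs ht hst).trans ?_
  · intro k hk s hs t ht hst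
    have hts0 : 0 ≤ t - s := sub_nonneg.2 hst
    have hts : t - s ≤ h := by
      have := hstep k
      linarith [hs.1, ht.2]
    have hW : 0 ≤ (t - s) ^ α := Real.rpow_nonneg hts0 _
    have hWh : (t - s) ^ α ≤ h ^ α := Real.rpow_le_rpow hts0 hts (by linarith)
    have e1 := (hy s (hIcc k hk s hs) t (hIcc k hk t ht) hst (hts.trans hMΔ)).2
    have hsk : s - k * T / M ≤ h := by
      have := hstep k
      linarith [hs.2]
    have e2 := (hy _ (hτI k hk.le) s (hIcc k hk s hs) hs.1 (hsk.trans hMΔ)).1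
    have e3 : (s - τ k) ^ α ≤ h ^ α := Real.rpow_le_rpow (sub_nonneg.2 hs.1) hsk (by linarith)
    have e4 : ‖y s - u (τ k)‖ ≤ 2 * A * h ^ α + X := by
      have h1 : ‖y s - u (τ k)‖ ≤ ‖y s - y (τ k)‖ + ‖y (τ k) - u (τ k)‖ :=
        norm_sub_le_norm_sub_add_norm_sub _ _ _
      have h2 := mul_le_mul_of_nonneg_left e3 (by linarith : 0 ≤ 2 * A)
      have h3 := hsup k hk.le
      linarith
    -- Inside a cell the scheme follows the driver with the field frozen at `u (τ k)`. The error
    -- increment is thus the solution's remainder from `s` plus the mismatch of `V (y s)` and the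
    -- frozen field.
    have e5 : (y t - u t) - (y s - u s) =
        eulerRemainder V x y s t + (V (y s) - V (u (τ k))) (x t - x s) := by
      rw [hu k hk s hs, hu k hk t ht]
      simp only [eulerRemainder, sub_apply, map_sub, τ]
      abel
    have e6 : ‖(V (y s) - V (u (τ k))) (x t - x s)‖ ≤
        K * (2 * A * h ^ α + X) * (N * (t - s) ^ α) :=
      (ContinuousLinearMap.le_opNorm _ _).trans (mul_le_mul ((hV.lipschitz _ _).trans
        (mul_le_mul_of_nonneg_left e4 (by linarith)))
        (hx s (hIcc k hk s hs) t (hIcc k hk t ht) hst) (norm_nonneg _) (by positivity))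
    have e7 : 2 * S * A ^ 2 * (t - s) ^ (2 * α) ≤ 2 * S * A ^ 2 * h ^ α * (t - s) ^ α := by
      rw [rpow_two_mul hts0, ← mul_assoc]
      exact mul_le_mul_of_nonneg_right (mul_le_mul_of_nonneg_left hWh (by positivity)) hW
    have e8 : K * (2 * A * h ^ α + X) * (N * (t - s) ^ α) =
        (2 * A ^ 2 * h ^ α + A * X) * (t - s) ^ α := by rw [hAdef]; ring
    have e9 : 2 * (A ^ 2 * h ^ α * (t - s) ^ α) ≤ S * (A ^ 2 * h ^ α * (t - s) ^ α) :=
      mul_le_mul_of_nonneg_right hS (by positivity)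
    show ‖(y t - u t) - (y s - u s)‖ ≤ _
    rw [e5]
    refine (norm_add_le _ _).trans ?_
    linarith
  · refine mul_le_mul_of_nonneg_right ?_ (Real.rpow_nonneg (sub_nonneg.2 hst) _)
    have hgM : g = T ^ (2 * α - 1) * (M : ℝ) ^ (1 - 2 * α) := by
      rw [hg, hh, Real.div_rpow hT.le hM'.le, div_eq_mul_inv, ← Real.rpow_neg hM'.le, neg_sub]
    have hA2 : A ^ 2 ≤ D * A ^ 3 := by
      have h1 : A ^ 2 ≤ A ^ 3 := pow_le_pow_right₀ hA (by norm_num)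
      have h2 : 0 ≤ A ^ 3 := by positivity
      nlinarith
    have hT0 : 0 ≤ T ^ (1 - α) := by positivity
    calc _ = 6 * S * A ^ 2 * h ^ α + (2 * A * X + 16 * S * A * X) + 2 * ρ := by ring
      _ ≤ 6 * S * A ^ 2 * (T ^ (1 - α) * g) + 17 * S * A * X + 2 * ρ := by
        have h1 := mul_le_mul_of_nonneg_left hhα (by positivity : 0 ≤ 6 * S * A ^ 2)
        have h2 : 2 * (A * X) ≤ S * (A * X) := mul_le_mul_of_nonneg_right hS (by positivity)
        linarith
      _ = (6 * S * T ^ (1 - α) + 4 * S) * g * A ^ 2 + 68 * S ^ 2 * g * (D * A ^ 3) := by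
        rw [hX, hρdef]; ring
      _ ≤ (6 * S * T ^ (1 - α) + 4 * S) * g * (D * A ^ 3) + 68 * S ^ 2 * g * (D * A ^ 3) := by
        have := mul_le_mul_of_nonneg_left hA2
          (by positivity : 0 ≤ (6 * S * T ^ (1 - α) + 4 * S) * g)
        linarith
      _ = _ := by rw [hgM]; ring

/-- The pathwise error of the Euler scheme in Hölder norm; as `α > 1 / 2`, the constant is
integrable to any power when the Hölder constant `N` of the driver has Gaussian tails. -/
theorem euler_error (hV : IsBoundedField V K) (hα : 1 / 2 < α) (hα1 : α < 1) (hT : 0 < T) :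
    ∃ Γ, 0 ≤ Γ ∧ ∀ N, 1 ≤ N → ∀ (x : ℝ → U) (y : ℝ → E),
      (∀ s ∈ Set.Icc 0 T, ∀ t ∈ Set.Icc 0 T, s ≤ t → ‖x t - x s‖ ≤ N * (t - s) ^ α) →
      (∃ C θ : ℝ, 1 < θ ∧ ∀ s ∈ Set.Icc 0 T, ∀ t ∈ Set.Icc 0 T, s ≤ t →
        ‖eulerRemainder V x y s t‖ ≤ C * (t - s) ^ θ) →
      ∀ (M : ℕ) (u : ℝ → E), 1 ≤ M →
      (∀ k < M, ∀ t ∈ Set.Icc ((k : ℝ) * T / M) ((k + 1 : ℕ) * T / M),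
        u t = u (k * T / M) + V (u (k * T / M)) (x t - x (k * T / M))) → y 0 = u 0 →
      ∀ s ∈ Set.Icc 0 T, ∀ t ∈ Set.Icc 0 T, s ≤ t → ‖(y t - u t) - (y s - u s)‖ ≤
        Γ * Real.exp (Γ * N ^ (1 / α)) * (M : ℝ) ^ (1 - 2 * α) * (t - s) ^ α := by
  have hK := hV.one_le
  have hS := two_le_sewingConst (θ := 2 * α) (by linarith)
  set S := sewingConst (2 * α) with hSdef
  set C₁ := (6 * S * T ^ (1 - α) + 68 * S ^ 2 + 4 * S) * T ^ (2 * α - 1) with hC₁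
  have hC₁0 : 0 ≤ C₁ := by positivity
  set R := (8 * S * K) ^ (1 / α) with hR
  have hR0 : 0 ≤ R := by positivity
  set Γ₁ := (C₁ + 9) * K ^ 3 * 6 * Real.exp 1 with hΓ₁
  have hΓ₁0 : 0 ≤ Γ₁ := by positivity
  set Γ₂ := 2 * T * R + 1 with hΓ₂
  have hΓ₂0 : 0 ≤ Γ₂ := by positivity
  refine ⟨Γ₁ + Γ₂, by positivity, ?_⟩
  intro N hN x y hx ⟨C, θ, hθ, hy⟩ M u hM hu h0 s hs t ht hst
  have hM' : (0 : ℝ) < M := by positivity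
  have hA : 1 ≤ K * N := one_le_mul_of_one_le_of_one_le hK hN
  -- The longest window allowed by the smallness condition. It makes `T / Δ` a multiple of `N ^ (1 /
  -- α)`, the source of the exponent in the error constant.
  set Δ := ((8 * S * (K * N)) ^ (1 / α))⁻¹ with hΔdef
  have hΔ : 0 < Δ := by positivity
  have hsmall : 8 * S * (K * N * Δ ^ α) = 1 := by
    rw [hΔdef, Real.inv_rpow (by positivity), ← Real.rpow_mul (by positivity),
      one_div_mul_cancel (by linarith), Real.rpow_one, ← mul_assoc]
    exact mul_inv_cancel₀ (by positivity)
  have hTΔ : T / Δ = T * R * N ^ (1 / α) := by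
    rw [hΔdef, div_inv_eq_mul, hR, mul_assoc T, ← Real.mul_rpow (by positivity) (by linarith)]
    ring_nf
  have hloc := solution_local_holder hV (by linarith : 0 ≤ N) hα hα1 hT (Δ := Δ) hθ hx hy
    (by linarith)
  have hW : 0 ≤ (t - s) ^ α := Real.rpow_nonneg (sub_nonneg.2 hst) _
  have hMp : 0 ≤ (M : ℝ) ^ (1 - 2 * α) := by positivity
  set D := Real.exp (2 * (T / Δ) + 1) with hD
  have hr : 0 ≤ T / Δ := by positivity
  have hkey : ‖(y t - u t) - (y s - u s)‖ ≤
      (C₁ + 9) * (K * N) ^ 3 * D * (M : ℝ) ^ (1 - 2 * α) * (t - s) ^ α := by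
    rcases le_total (T / M) Δ with hMΔ | hMΔ
    · refine (euler_error_fine hV hN hα hα1 hT hΔ hsmall hx hloc hM hMΔ hu h0 hs ht hst).trans ?_
      have : 0 ≤ 9 * (K * N) ^ 3 * D * (M : ℝ) ^ (1 - 2 * α) * (t - s) ^ α := by positivity
      linarith
    · have hMT : (M : ℝ) ≤ T / Δ := by
        rw [le_div_iff₀ hM'] at hMΔ
        rw [le_div_iff₀ hΔ]
        linarith
      refine (euler_error_coarse hV (by linarith) hα hT hΔ hx
        (fun s hs t ht hst hd => (hloc s hs t ht hst hd).1) hM hMT hu hs ht hst).trans ?_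
      refine mul_le_mul_of_nonneg_right ?_ hW
      -- For few steps the rate is not small: `M ^ (2 * α - 1) ≤ M ≤ T / Δ`, so inserting `M ^ (1 -
      -- 2 * α)` costs one more factor `T / Δ + 1`.
      have h1 : 1 ≤ (T / Δ + 1) * (M : ℝ) ^ (1 - 2 * α) := by
        have h2 : (1 : ℝ) = (M : ℝ) ^ (2 * α - 1) * (M : ℝ) ^ (1 - 2 * α) := by
          rw [← Real.rpow_add hM']; simp
        have h3 : (M : ℝ) ^ (2 * α - 1) ≤ M := by
          conv_rhs => rw [← Real.rpow_one (M : ℝ)]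
          exact Real.rpow_le_rpow_of_exponent_le (by exact_mod_cast hM) (by linarith)
        calc (1 : ℝ) = (M : ℝ) ^ (2 * α - 1) * (M : ℝ) ^ (1 - 2 * α) := h2
          _ ≤ _ := mul_le_mul_of_nonneg_right (by linarith) hMp
      have h4 : (T / Δ + 1) * (T / Δ + 1) ≤ D := by
        have h5 := Real.add_one_le_exp (T / Δ)
        calc _ ≤ Real.exp (T / Δ) * Real.exp (T / Δ) :=
              mul_le_mul h5 h5 (by positivity) (by positivity)
          _ = Real.exp (2 * (T / Δ)) := by rw [← Real.exp_add]; ring_nf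
          _ ≤ D := Real.exp_le_exp.2 (by linarith)
      have h6 : K * N ≤ (K * N) ^ 3 := le_self_pow₀ hA (by norm_num)
      have hA3 : 0 ≤ (K * N) ^ 3 := by positivity
      calc 9 * (K * N) * (T / Δ + 1) ≤
            9 * (K * N) * (T / Δ + 1) * ((T / Δ + 1) * (M : ℝ) ^ (1 - 2 * α)) :=
            le_mul_of_one_le_right (by positivity) h1
        _ = 9 * (K * N) * ((T / Δ + 1) * (T / Δ + 1)) * (M : ℝ) ^ (1 - 2 * α) := by ring
        _ ≤ 9 * (K * N) ^ 3 * D * (M : ℝ) ^ (1 - 2 * α) := by gcongr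
        _ ≤ _ := by
          have : 0 ≤ C₁ * (K * N) ^ 3 * D * (M : ℝ) ^ (1 - 2 * α) := by positivity
          linarith
  refine hkey.trans (mul_le_mul_of_nonneg_right (mul_le_mul_of_nonneg_right ?_ hMp) hW)
  set v := N ^ (1 / α) with hv
  have hNv : N ≤ v := by
    conv_lhs => rw [← Real.rpow_one N]
    refine Real.rpow_le_rpow_of_exponent_le hN ?_
    rw [le_div_iff₀ (by linarith)]
    linarith
  -- The polynomial factor joins the exponential, because `1 / α ≥ 1` and `N ≥ 1` give `N ≤ N ^ (1 /
  -- α)`.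
  have hN3 : N ^ 3 ≤ 6 * Real.exp v := by
    have h1 := Real.pow_div_factorial_le_exp N (by linarith) 3
    have h2 : ((Nat.factorial 3 : ℕ) : ℝ) = 6 := by norm_num [Nat.factorial]
    rw [h2, div_le_iff₀ (by norm_num)] at h1
    have h3 := Real.exp_le_exp.2 hNv
    linarith
  have hDv : D = Real.exp 1 * Real.exp (2 * T * R * v) := by
    rw [hD, hTΔ, ← Real.exp_add]; ring_nf
  calc (C₁ + 9) * (K * N) ^ 3 * D = (C₁ + 9) * K ^ 3 * N ^ 3 * D := by ring
    _ ≤ (C₁ + 9) * K ^ 3 * (6 * Real.exp v) * D := by gcongr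
    _ = Γ₁ * Real.exp (Γ₂ * v) := by
        rw [hDv, hΓ₁, hΓ₂, add_mul (2 * T * R), one_mul, Real.exp_add]
        ring
    _ ≤ (Γ₁ + Γ₂) * Real.exp ((Γ₁ + Γ₂) * v) := by
        have hv0 : 0 ≤ v := by positivity
        gcongr <;> linarith

end FractionalEuler

namespace FractionalEuler

/-! ### Fields of class `C_b^2` -/

section Field

variable {E F G : Type*} [NormedAddCommGroup E] [NormedAddCommGroup F] [NormedAddCommGroup G]

lemma IsBoundedField.add {f g : E → F} {K K' : ℝ} (hf : IsBoundedField f K)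
    (hg : IsBoundedField g K') : IsBoundedField (fun a => f a + g a) (K + K') where
  one_le := by linarith [hf.one_le, hg.one_le]
  norm_le a := (norm_add_le _ _).trans (add_le_add (hf.norm_le a) (hg.norm_le a))
  lipschitz a b := by
    rw [add_sub_add_comm, add_mul]
    exact (norm_add_le _ _).trans (add_le_add (hf.lipschitz a b) (hg.lipschitz a b))
  four_point a b c e := by
    rw [add_sub_add_comm, add_sub_add_comm (f c), add_sub_add_comm]
    refine (norm_add_le _ _).trans
      ((add_le_add (hf.four_point a b c e) (hg.four_point a b c e)).trans_eq ?_)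
    ring

lemma isBoundedField_zero : IsBoundedField (fun _ : E => (0 : F)) 1 where
  one_le := le_rfl
  norm_le a := by simp
  lipschitz a b := by simp
  four_point a b c e := by
    simp only [sub_self, norm_zero]
    positivity

lemma exists_isBoundedField_sum {ι : Type*} (s : Finset ι) {f : ι → E → F}
    (hf : ∀ i, ∃ K, IsBoundedField (f i) K) :
    ∃ K, IsBoundedField (fun a => ∑ i ∈ s, f i a) K := by
  classical
  induction s using Finset.induction_on with
  | empty => exact ⟨1, by simpa using isBoundedField_zero⟩
  | insert i s hi ih =>
    obtain ⟨K, hK⟩ := ih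
    obtain ⟨K', hK'⟩ := hf i
    simp only [Finset.sum_insert hi]
    exact ⟨_, hK'.add hK⟩

variable [NormedSpace ℝ F] [NormedSpace ℝ G]

lemma IsBoundedField.clm_comp {f : E → F} {K : ℝ} (hf : IsBoundedField f K) (L : F →L[ℝ] G) :
    IsBoundedField (fun a => L (f a)) ((‖L‖ + 1) * K) where
  one_le := one_le_mul_of_one_le_of_one_le (by linarith [norm_nonneg L]) hf.one_le
  norm_le a := (L.le_opNorm _).trans (mul_le_mul (by linarith) (hf.norm_le a) (norm_nonneg _)
    (by positivity))
  lipschitz a b := by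
    rw [← map_sub, mul_assoc]
    exact (L.le_opNorm _).trans (mul_le_mul (by linarith) (hf.lipschitz a b) (norm_nonneg _)
      (by positivity))
  four_point a b c e := by
    rw [← map_sub, ← map_sub, ← map_sub]
    refine (L.le_opNorm _).trans ((mul_le_mul (by linarith : ‖L‖ ≤ ‖L‖ + 1)
      (hf.four_point a b c e) (norm_nonneg _) (by positivity)).trans_eq ?_)
    ring

variable [NormedSpace ℝ E]

/-- Maps of class `C_b^2` satisfy the four point inequality. -/
lemma IsCb.exists_isBoundedField {f : E → F} (hf : IsCb 2 f) : ∃ K, IsBoundedField f K := by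
  obtain ⟨hd, hb⟩ := hf
  obtain ⟨K₀, hK₀⟩ := hb 0 (by norm_num)
  obtain ⟨K₁, hK₁⟩ := hb 1 (by norm_num)
  obtain ⟨K₂, hK₂⟩ := hb 2 le_rfl
  set K := max 1 (max K₀ (max K₁ K₂)) with hK
  have hK1 : 1 ≤ K := le_max_left _ _
  have h0 : ∀ x, ‖f x‖ ≤ K := fun x => by
    rw [← norm_iteratedFDeriv_zero (𝕜 := ℝ) (f := f)]
    exact (hK₀ x).trans ((le_max_left _ _).trans (le_max_right _ _))
  have h1 : ∀ x, ‖fderiv ℝ f x‖ ≤ K := fun x => by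
    rw [← norm_iteratedFDeriv_one]
    exact (hK₁ x).trans ((le_max_left _ _).trans ((le_max_right _ _).trans (le_max_right _ _)))
  have h2 : ∀ x, ‖iteratedFDeriv ℝ 2 f x‖ ≤ K := fun x =>
    (hK₂ x).trans ((le_max_right _ _).trans ((le_max_right _ _).trans (le_max_right _ _)))
  have hdf : Differentiable ℝ f := by
    have := hd 0 (by norm_num)
    rwa [iteratedFDeriv_zero_eq_comp, LinearIsometryEquiv.comp_differentiable_iff] at this
  have hlip1 : ∀ x z, ‖iteratedFDeriv ℝ 1 f x - iteratedFDeriv ℝ 1 f z‖ ≤ K * ‖x - z‖ :=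
    fun x z => Convex.norm_image_sub_le_of_norm_fderiv_le (𝕜 := ℝ) (s := Set.univ)
      (fun w _ => hd 1 (by norm_num) w)
      (fun w _ => by rw [norm_fderiv_iteratedFDeriv]; exact h2 w) convex_univ trivial trivial
  have hlip : ∀ x z, ‖fderiv ℝ f x - fderiv ℝ f z‖ ≤ K * ‖x - z‖ := fun x z => by
    refine ContinuousLinearMap.opNorm_le_bound _ (by positivity) fun v => ?_
    have h3 : (fderiv ℝ f x - fderiv ℝ f z) v =
        (iteratedFDeriv ℝ 1 f x - iteratedFDeriv ℝ 1 f z) (fun _ => v) := by simp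
    rw [h3]
    refine (ContinuousMultilinearMap.le_opNorm _ _).trans ?_
    simp only [Finset.univ_unique, Finset.prod_const, Finset.card_singleton, pow_one]
    exact mul_le_mul_of_nonneg_right (hlip1 x z) (norm_nonneg _)
  refine ⟨K, hK1, h0, fun a b => Convex.norm_image_sub_le_of_norm_fderiv_le (𝕜 := ℝ)
    (s := Set.univ) (fun w _ => hdf w) (fun w _ => h1 w) convex_univ trivial trivial, ?_⟩
  intro a b c e
  have hline : ∀ p q : E, ∀ θ : ℝ, HasDerivAt (fun θ : ℝ => f (q + θ • (p - q)))
      (fderiv ℝ f (q + θ • (p - q)) (p - q)) θ := by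
    intro p q θ
    have h3 : HasDerivAt (fun θ : ℝ => q + θ • (p - q)) (p - q) θ := by
      simpa using ((hasDerivAt_id θ).smul_const (p - q)).const_add q
    exact (hdf _).hasFDerivAt.comp_hasDerivAt θ h3
  -- Mean value inequality along the segments from `b` to `a` and from `e` to `c`, run
  -- simultaneously. The derivative `f'(p)(a - b) - f'(q)(c - e)` splits into `f'(p)` on the
  -- difference of directions and `f'(p) - f'(q)` on `c - e`, which match the two terms of `C`.
  have hmain := norm_image_sub_le_of_norm_deriv_le_segment_01'
    (f := fun θ : ℝ => f (b + θ • (a - b)) - f (e + θ • (c - e)))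
    (f' := fun θ => fderiv ℝ f (b + θ • (a - b)) (a - b) - fderiv ℝ f (e + θ • (c - e)) (c - e))
    (C := K * ‖(a - b) - (c - e)‖ + K * (‖a - c‖ + ‖b - e‖) * ‖c - e‖)
    (fun θ _ => ((hline a b θ).sub (hline c e θ)).hasDerivWithinAt) ?_
  · have h3 : (f (b + (1 : ℝ) • (a - b)) - f (e + (1 : ℝ) • (c - e))) -
        (f (b + (0 : ℝ) • (a - b)) - f (e + (0 : ℝ) • (c - e))) = f a - f b - (f c - f e) := by
      simp only [one_smul, zero_smul, add_zero, add_sub_cancel]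
      abel
    rwa [h3] at hmain
  · intro θ hθ
    set p := b + θ • (a - b)
    set q := e + θ • (c - e)
    have h3 : fderiv ℝ f p (a - b) - fderiv ℝ f q (c - e) =
        fderiv ℝ f p ((a - b) - (c - e)) + (fderiv ℝ f p - fderiv ℝ f q) (c - e) := by
      rw [sub_apply, map_sub (fderiv ℝ f p) (a - b)]; abel
    have h4 : ‖p - q‖ ≤ ‖a - c‖ + ‖b - e‖ := by
      have h5 : p - q = (1 - θ) • (b - e) + θ • (a - c) := by
        simp only [p, q]; module
      rw [h5]
      refine (norm_add_le _ _).trans ?_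
      rw [norm_smul, norm_smul, Real.norm_of_nonneg hθ.1,
        Real.norm_of_nonneg (by linarith [hθ.2] : 0 ≤ 1 - θ)]
      have h6 : (1 - θ) * ‖b - e‖ ≤ ‖b - e‖ :=
        mul_le_of_le_one_left (norm_nonneg _) (by linarith [hθ.1])
      have h7 : θ * ‖a - c‖ ≤ ‖a - c‖ := mul_le_of_le_one_left (norm_nonneg _) hθ.2.le
      linarith
    rw [h3]
    refine (norm_add_le _ _).trans (add_le_add ?_ ?_)
    · exact (ContinuousLinearMap.le_opNorm _ _).trans
        (mul_le_mul_of_nonneg_right (h1 p) (norm_nonneg _))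
    · exact (ContinuousLinearMap.le_opNorm _ _).trans (mul_le_mul_of_nonneg_right
        ((hlip p q).trans (mul_le_mul_of_nonneg_left h4 (by linarith))) (norm_nonneg _))

end Field

/-! ### Young integrals -/

/-- The Young-Loève estimate. -/
lemma HasYoungIntegral.norm_increment_sub_le {E : Type*} [NormedAddCommGroup E] [NormedSpace ℝ E]
    {g : ℝ → E} {b : ℝ → ℝ} {s t : ℝ} {I J : E} {α β L N : ℝ} (hα : 0 ≤ α) (hβ : 0 ≤ β)
    (hαβ : 1 < α + β) (hL : 0 ≤ L) (hN : 0 ≤ N) (hs : 0 ≤ s) (hst : s ≤ t)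
    (hI : HasYoungIntegral g b 0 s I) (hJ : HasYoungIntegral g b 0 t J)
    (hg : ∀ p ∈ Set.Icc s t, ∀ q ∈ Set.Icc s t, p ≤ q → ‖g q - g p‖ ≤ L * (q - p) ^ β)
    (hb : ∀ p ∈ Set.Icc s t, ∀ q ∈ Set.Icc s t, p ≤ q → |b q - b p| ≤ N * (q - p) ^ α) :
    ‖J - I - (b t - b s) • g s‖ ≤ sewingConst (α + β) * (N * L) * (t - s) ^ (α + β) := by
  refine le_of_forall_pos_le_add fun ε hε => ?_
  obtain ⟨δ₁, hδ₁, h₁⟩ := hI (ε / 2) (by linarith)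
  obtain ⟨δ₂, hδ₂, h₂⟩ := hJ (ε / 2) (by linarith)
  -- Both integrals start at `0`. They are approximated on one partition having `s` as its `n`-th
  -- point, so that the Riemann sums subtract to a sum over `[s, t]`; this `n` makes the mesh fine
  -- enough for both.
  obtain ⟨n, hn⟩ := exists_nat_gt (t / min δ₁ δ₂)
  have hδ : 0 < min δ₁ δ₂ := lt_min hδ₁ hδ₂
  have ht : 0 ≤ t := hs.trans hst
  have hn0 : (0 : ℝ) < n := lt_of_le_of_lt (by positivity) hn
  have hts : 0 ≤ t - s := sub_nonneg.2 hst
  rw [div_lt_iff₀ hδ] at hn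
  -- a partition through `s`
  let τ : ℕ → ℝ := fun k => (min k n : ℕ) * (s / n) + (k - n : ℕ) * ((t - s) / n)
  have hτ : Monotone τ := by
    intro i j hij
    have h3 : ((min i n : ℕ) : ℝ) ≤ (min j n : ℕ) := by
      exact_mod_cast min_le_min_right n hij
    have h4 : ((i - n : ℕ) : ℝ) ≤ (j - n : ℕ) := by
      exact_mod_cast Nat.sub_le_sub_right hij n
    simp only [τ]
    gcongr
  have hτ0 : τ 0 = 0 := by simp [τ]
  have hτn : τ n = s := by
    simp only [τ, min_self, Nat.sub_self, Nat.cast_zero, zero_mul, add_zero]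
    field_simp
  have hτ2n : τ (n + n) = t := by
    simp only [τ, Nat.add_sub_cancel, min_eq_right (Nat.le_add_left n n)]
    field_simp
    ring
  have hmesh : ∀ i, τ (i + 1) - τ i < min δ₁ δ₂ := by
    intro i
    rcases lt_or_ge i n with hi | hi
    · have e1 : min (i + 1) n = i + 1 := min_eq_left hi
      have e2 : min i n = i := min_eq_left hi.le
      have e3 : i + 1 - n = 0 := by omega
      have e4 : i - n = 0 := by omega
      simp only [τ, e1, e2, e3, e4]
      push_cast
      have : (i + 1 : ℝ) * (s / n) + 0 * ((t - s) / n) - (i * (s / n) + 0 * ((t - s) / n)) =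
        s / n := by ring
      rw [this, div_lt_iff₀ hn0]
      linarith
    · have e1 : min (i + 1) n = n := min_eq_right (by omega)
      have e2 : min i n = n := min_eq_right hi
      have e3 : i + 1 - n = (i - n) + 1 := by omega
      simp only [τ, e1, e2, e3]
      push_cast
      have : (n : ℝ) * (s / n) + (((i - n : ℕ) : ℝ) + 1) * ((t - s) / n) -
        (n * (s / n) + ((i - n : ℕ) : ℝ) * ((t - s) / n)) = (t - s) / n := by ring
      rw [this, div_lt_iff₀ hn0]
      linarith
  have hsumI := h₁ n τ hτ hτ0 hτn fun i _ => (hmesh i).trans_le (min_le_left _ _)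
  have hsumJ := h₂ (n + n) τ hτ hτ0 hτ2n fun i _ => (hmesh i).trans_le (min_le_right _ _)
  set Q : ℕ → ℕ → E := fun i j => ∑ k ∈ Finset.Ico i j, (b (τ (k + 1)) - b (τ k)) • g (τ k)
    with hQ
  have hmem : ∀ i, n ≤ i → i ≤ n + n → τ i ∈ Set.Icc s t := fun i hi hi' => by
    rw [← hτn, ← hτ2n]
    exact ⟨hτ hi, hτ hi'⟩
  -- `ρ = 0` because on a single interval the Riemann sum is its one-term approximation. The bound
  -- does not depend on the mesh.
  have hsew := discrete_sewing (θ := α + β) (κ := N * L) (ρ := 0) hαβ (by positivity) hτ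
    (l := n) (n := n + n) (R := fun i j => Q i j - (b (τ j) - b (τ i)) • g (τ i)) ?_ ?_
    n (n + n) le_rfl (by omega) le_rfl
  · rw [hτn, hτ2n, zero_mul, add_zero] at hsew
    rw [Finset.range_eq_Ico] at hsumI hsumJ
    have hcons : Q 0 n + Q n (n + n) = Q 0 (n + n) :=
      Finset.sum_Ico_consecutive _ (Nat.zero_le _) (by omega)
    have hdec : J - I - (b t - b s) • g s = (Q n (n + n) - (b t - b s) • g s) +
        ((Q 0 n - I) - (Q 0 (n + n) - J)) := by
      rw [← hcons]; abel
    rw [hdec]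
    refine (norm_add_le _ _).trans (add_le_add hsew ((norm_sub_le _ _).trans ?_))
    linarith
  · intro i j k hi hij hjk hk
    have hcons : Q i j + Q j k = Q i k := Finset.sum_Ico_consecutive _ hij hjk
    have hdec : (Q i k - (b (τ k) - b (τ i)) • g (τ i)) -
        (Q i j - (b (τ j) - b (τ i)) • g (τ i)) - (Q j k - (b (τ k) - b (τ j)) • g (τ j)) =
        (b (τ k) - b (τ j)) • (g (τ j) - g (τ i)) := by
      rw [← hcons]; module
    rw [hdec, norm_smul, Real.norm_eq_abs]
    have mi := hmem i hi (by omega)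
    have mj := hmem j (by omega) (by omega)
    have mk := hmem k (by omega) hk
    have t1 := hτ hij
    have t2 := hτ hjk
    have e1 : (τ j - τ i) ^ β ≤ (τ k - τ i) ^ β :=
      Real.rpow_le_rpow (by linarith) (by linarith) hβ
    have e2 : (τ k - τ j) ^ α ≤ (τ k - τ i) ^ α :=
      Real.rpow_le_rpow (by linarith) (by linarith) hα
    calc _ ≤ (N * (τ k - τ i) ^ α) * (L * (τ k - τ i) ^ β) :=
          mul_le_mul ((hb _ mj _ mk t2).trans (mul_le_mul_of_nonneg_left e2 hN))
            ((hg _ mi _ mj t1).trans (mul_le_mul_of_nonneg_left e1 hL)) (norm_nonneg _)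
            (mul_nonneg hN (Real.rpow_nonneg (by linarith) _))
      _ = _ := by
        rw [Real.rpow_add_of_nonneg (by linarith) hα hβ]
        ring
  · intro i _ _
    simp [hQ]

lemma HasYoungIntegral.eq_zero {E : Type*} [NormedAddCommGroup E] [NormedSpace ℝ E]
    {g : ℝ → E} {b : ℝ → ℝ} {s : ℝ} {I : E} (hI : HasYoungIntegral g b s s I) : I = 0 := by
  rw [← norm_le_zero_iff]
  refine le_of_forall_pos_le_add fun ε hε => ?_
  obtain ⟨δ, hδ, h⟩ := hI ε hε
  have := h 0 (fun _ => s) monotone_const rfl rfl (by simp)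
  simpa using this.le

/-! ### Young solutions -/

section Solution

variable {m d : ℕ}
    {μ : EuclideanSpace ℝ (Fin m) → EuclideanSpace ℝ (Fin m)}
    {σ : Fin d → EuclideanSpace ℝ (Fin m) → EuclideanSpace ℝ (Fin m)}
    {a : EuclideanSpace ℝ (Fin m)} {T : ℝ}
    {b : ℝ → EuclideanSpace ℝ (Fin d)} {y : ℝ → EuclideanSpace ℝ (Fin m)}

/-- The drift and the diffusion coefficients as one field, driven by the path `t ↦ (t, b t)`. -/
noncomputable def driftDiffusion (μ : EuclideanSpace ℝ (Fin m) → EuclideanSpace ℝ (Fin m))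
    (σ : Fin d → EuclideanSpace ℝ (Fin m) → EuclideanSpace ℝ (Fin m))
    (y : EuclideanSpace ℝ (Fin m)) :
    (ℝ × EuclideanSpace ℝ (Fin d)) →L[ℝ] EuclideanSpace ℝ (Fin m) :=
  ContinuousLinearMap.smulRightL ℝ (ℝ × EuclideanSpace ℝ (Fin d)) (EuclideanSpace ℝ (Fin m))
      (ContinuousLinearMap.fst ℝ ℝ _) (μ y) +
    ∑ j, ContinuousLinearMap.smulRightL ℝ (ℝ × EuclideanSpace ℝ (Fin d))
      (EuclideanSpace ℝ (Fin m))
      ((EuclideanSpace.proj j).comp (ContinuousLinearMap.snd ℝ ℝ _)) (σ j y)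

lemma driftDiffusion_apply (y : EuclideanSpace ℝ (Fin m)) (h : ℝ × EuclideanSpace ℝ (Fin d)) :
    driftDiffusion μ σ y h = h.1 • μ y + ∑ j, h.2 j • σ j y := by
  simp [driftDiffusion, ContinuousLinearMap.smulRightL]

/-- The coefficients enter through fixed continuous linear maps, so their bounds carry over by
composition and summation. -/
lemma exists_isBoundedField_driftDiffusion (hμ : IsCb 2 μ) (hσ : ∀ j, IsCb 2 (σ j)) :
    ∃ K, IsBoundedField (driftDiffusion μ σ) K := by
  obtain ⟨K, hK⟩ := hμ.exists_isBoundedField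
  obtain ⟨K', hK'⟩ := exists_isBoundedField_sum Finset.univ (f := fun j y =>
    ContinuousLinearMap.smulRightL ℝ (ℝ × EuclideanSpace ℝ (Fin d)) (EuclideanSpace ℝ (Fin m))
      ((EuclideanSpace.proj j).comp (ContinuousLinearMap.snd ℝ ℝ _)) (σ j y))
    (fun j => by
      obtain ⟨L, hL⟩ := (hσ j).exists_isBoundedField
      exact ⟨_, hL.clm_comp _⟩)
  exact ⟨_, (hK.clm_comp _).add hK'⟩

lemma IsYoungSolution.apply_zero (hT : 0 ≤ T) (hy : IsYoungSolution μ σ a T b y) : y 0 = a := by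
  obtain ⟨J, hJ, h⟩ := hy.2 0 ⟨le_rfl, hT⟩
  have hJ0 : ∀ j, J j = 0 := fun j => (hJ j).eq_zero
  simpa [hJ0] using h

lemma abs_apply_sub_le (v w : EuclideanSpace ℝ (Fin d)) (j : Fin d) : |v j - w j| ≤ ‖v - w‖ := by
  simpa using PiLp.norm_apply_le (v - w) j

/-- Young solutions have first order expansions with remainders of order greater than `1`. -/
lemma IsYoungSolution.exists_eulerRemainder_le (hμ : IsCb 2 μ) (hσ : ∀ j, IsCb 2 (σ j))
    (hT : 0 < T) (hy : IsYoungSolution μ σ a T b y) {α N : ℝ} (hα : 1 / 2 < α) (hα1 : α < 1)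
    (hN : 0 ≤ N)
    (hb : ∀ s ∈ Set.Icc 0 T, ∀ t ∈ Set.Icc 0 T, s ≤ t → ‖b t - b s‖ ≤ N * (t - s) ^ α) :
    ∃ C θ : ℝ, 1 < θ ∧ ∀ s ∈ Set.Icc 0 T, ∀ t ∈ Set.Icc 0 T, s ≤ t →
      ‖eulerRemainder (driftDiffusion μ σ) (fun t => (t, b t)) y s t‖ ≤ C * (t - s) ^ θ := by
  obtain ⟨⟨β, C, hβ, hC⟩, hint⟩ := hy
  have hβ' : (1 / 2 : ℝ) < β := by exact_mod_cast hβ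
  have hhol : ∀ s ∈ Set.Icc 0 T, ∀ t ∈ Set.Icc 0 T, s ≤ t →
      ‖y t - y s‖ ≤ C * (t - s) ^ (β : ℝ) := by
    intro s hs t ht hst
    have := hC.dist_le ht hs
    rwa [dist_eq_norm, Real.dist_eq, abs_of_nonneg (sub_nonneg.2 hst)] at this
  have hcont : ContinuousOn y (Set.Icc 0 T) := hC.continuousOn (by
    rw [← NNReal.coe_pos]; linarith)
  obtain ⟨Kμ, hKμ⟩ := hμ.exists_isBoundedField
  choose K hK using fun j => (hσ j).exists_isBoundedField
  have hK0 : ∀ j, 0 ≤ K j := fun j => by linarith [(hK j).one_le]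
  have hKμ0 : 0 ≤ Kμ := by linarith [hKμ.one_le]
  -- The order `β` of the solution is only known to exceed `1 / 2`, but `θ > 1` is all that
  -- `solution_local_holder` needs to upgrade the remainder to order `2 * α`.
  set θ := α + β with hθ
  refine ⟨Kμ * C * T ^ (1 - α) + ∑ j, sewingConst θ * (N * (K j * C)), θ, by linarith, ?_⟩
  intro s hs t ht hst
  have hts : 0 ≤ t - s := sub_nonneg.2 hst
  obtain ⟨I, hI, hyI⟩ := hint s hs
  obtain ⟨J, hJ, hyJ⟩ := hint t ht
  have hsub : Set.Icc s t ⊆ Set.Icc 0 T := Set.Icc_subset_Icc hs.1 ht.2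
  have hμcont : Continuous μ := by
    refine (LipschitzWith.of_dist_le_mul (K := ⟨Kμ, hKμ0⟩) fun p q => ?_).continuous
    rw [dist_eq_norm, dist_eq_norm]
    exact hKμ.lipschitz p q
  have hii : ∀ p ∈ Set.Icc 0 T, ∀ q ∈ Set.Icc 0 T,
      IntervalIntegrable (fun r => μ (y r)) volume p q := fun p hp q hq =>
    (hμcont.comp_continuousOn (hcont.mono (Set.uIcc_subset_Icc hp hq))).intervalIntegrable
  have h0 : (0 : ℝ) ∈ Set.Icc 0 T := ⟨le_rfl, hT.le⟩
  have hdrift : ‖(∫ r in (0 : ℝ)..t, μ (y r)) - (∫ r in (0 : ℝ)..s, μ (y r)) -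
      (t - s) • μ (y s)‖ ≤ Kμ * C * T ^ (1 - α) * (t - s) ^ θ := by
    rw [intervalIntegral.integral_interval_sub_left (hii 0 h0 t ht) (hii 0 h0 s hs),
      ← intervalIntegral.integral_const, ← intervalIntegral.integral_sub (hii s hs t ht)
        intervalIntegrable_const]
    have hbd : ∀ r ∈ Set.uIoc s t, ‖μ (y r) - μ (y s)‖ ≤ Kμ * (C * (t - s) ^ (β : ℝ)) := by
      intro r hr
      rw [Set.uIoc_of_le hst] at hr
      refine (hKμ.lipschitz _ _).trans (mul_le_mul_of_nonneg_left
        ((hhol s hs r (hsub ⟨hr.1.le, hr.2⟩) hr.1.le).trans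
          (mul_le_mul_of_nonneg_left ?_ C.2)) hKμ0)
      exact Real.rpow_le_rpow (by linarith [hr.1]) (by linarith [hr.2]) β.2
    refine (intervalIntegral.norm_integral_le_of_norm_le_const hbd).trans ?_
    rw [abs_of_nonneg hts]
    have e1 : (t - s) ^ θ = (t - s) ^ α * (t - s) ^ (β : ℝ) :=
      Real.rpow_add_of_nonneg hts (by linarith) β.2
    have e2 : t - s = (t - s) ^ (1 - α) * (t - s) ^ α := by
      rw [← Real.rpow_add_of_nonneg hts (by linarith) (by linarith)]; simp
    have e3 : (t - s) ^ (1 - α) ≤ T ^ (1 - α) :=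
      Real.rpow_le_rpow hts (by linarith [hs.1, ht.2]) (by linarith)
    calc Kμ * (C * (t - s) ^ (β : ℝ)) * (t - s)
        = Kμ * (C * (t - s) ^ (β : ℝ)) * ((t - s) ^ (1 - α) * (t - s) ^ α) := by rw [← e2]
      _ = Kμ * C * (t - s) ^ (1 - α) * (t - s) ^ θ := by rw [e1]; ring
      _ ≤ _ := by gcongr
  have hdiff : ∀ j, ‖J j - I j - (b t j - b s j) • σ j (y s)‖ ≤
      sewingConst θ * (N * (K j * C)) * (t - s) ^ θ := by
    intro j
    refine (hI j).norm_increment_sub_le (by linarith) (by linarith) (by linarith)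
      (mul_nonneg (hK0 j) C.2) hN hs.1 hst (hJ j) ?_ ?_
    · intro p hp q hq hpq
      rw [mul_assoc]
      exact ((hK j).lipschitz _ _).trans
        (mul_le_mul_of_nonneg_left (hhol p (hsub hp) q (hsub hq) hpq) (hK0 j))
    · intro p hp q hq hpq
      exact (abs_apply_sub_le _ _ j).trans (hb p (hsub hp) q (hsub hq) hpq)
  have hdec : eulerRemainder (driftDiffusion μ σ) (fun t => (t, b t)) y s t =
      ((∫ r in (0 : ℝ)..t, μ (y r)) - (∫ r in (0 : ℝ)..s, μ (y r)) - (t - s) • μ (y s)) +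
        ∑ j, (J j - I j - (b t j - b s j) • σ j (y s)) := by
    have hinc : y t - y s = ((∫ r in (0 : ℝ)..t, μ (y r)) - (∫ r in (0 : ℝ)..s, μ (y r))) +
        (∑ j, J j - ∑ j, I j) := by
      rw [hyI, hyJ]; abel
    rw [eulerRemainder, driftDiffusion_apply, hinc]
    simp only [Finset.sum_sub_distrib, Prod.fst_sub, Prod.snd_sub, PiLp.sub_apply]
    abel
  rw [hdec, add_mul, Finset.sum_mul]
  exact (norm_add_le _ _).trans (add_le_add hdrift (norm_sum_le_of_le _ fun j _ => hdiff j))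

/-- The Euler scheme in terms of the field `driftDiffusion`. -/
lemma eulerPath_eq_of_mem_cell (hT : 0 < T) {M : ℕ} (hM : 1 ≤ M) (k : ℕ) {t : ℝ}
    (ht : t ∈ Set.Icc ((k : ℝ) * T / M) ((k + 1 : ℕ) * T / M)) :
    eulerPath μ σ a T b M t = eulerPath μ σ a T b M (k * T / M) +
      driftDiffusion μ σ (eulerPath μ σ a T b M (k * T / M))
        ((t, b t) - (k * T / M, b (k * T / M))) := by
  have hM' : (0 : ℝ) < M := by positivity
  have hstep : eulerPath μ σ a T b M t =
      eulerStep μ σ b (k * T / M) t (eulerGrid μ σ a T b M k) := by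
    -- At the right end of the closed cell the floor is already `k + 1`; there the path agrees with
    -- the full step from `k`.
    rcases ht.2.eq_or_lt with rfl | hlt
    · rw [eulerPath_grid μ σ a hT b hM (k + 1), eulerGrid]
    · have : ⌊t * M / T⌋₊ = k := by
        have ht0 : 0 ≤ t := le_trans (by positivity) ht.1
        rw [Nat.floor_eq_iff (by positivity)]
        have h1 := ht.1
        rw [div_le_iff₀ hM'] at h1
        rw [lt_div_iff₀ hM'] at hlt
        push_cast at hlt
        exact ⟨(le_div_iff₀ hT).2 h1, (div_lt_iff₀ hT).2 hlt⟩
      rw [eulerPath, this]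
  rw [hstep, eulerPath_grid μ σ a hT b hM k, driftDiffusion_apply, eulerStep, add_assoc]
  simp

end Solution

end FractionalEuler

namespace FractionalEuler

/-! ### Hölder continuity from dyadic increments -/

/-- Ensures that refining `dyadicFloor` by one level costs at most one dyadic increment. -/
lemma floor_two_mul {x : ℝ} (hx : 0 ≤ x) : ⌊2 * x⌋₊ = 2 * ⌊x⌋₊ ∨ ⌊2 * x⌋₊ = 2 * ⌊x⌋₊ + 1 := by
  have h1 := Nat.floor_le hx
  have h2 := Nat.lt_floor_add_one x
  have h3 : 2 * ⌊x⌋₊ ≤ ⌊2 * x⌋₊ := Nat.le_floor (by push_cast; linarith)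
  have h4 : ⌊2 * x⌋₊ < 2 * ⌊x⌋₊ + 2 := (Nat.floor_lt (by linarith)).2 (by push_cast; linarith)
  omega

/-- The dyadic approximation from below of a time in `[0, T]`. -/
noncomputable def dyadicFloor (T : ℝ) (n : ℕ) (t : ℝ) : ℝ :=
  (⌊t * 2 ^ n / T⌋₊ : ℝ) * T / 2 ^ n

lemma dyadicFloor_le {T : ℝ} (hT : 0 < T) (n : ℕ) {t : ℝ} (ht : 0 ≤ t) :
    dyadicFloor T n t ≤ t := by
  have := Nat.floor_le (by positivity : 0 ≤ t * 2 ^ n / T)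
  rw [le_div_iff₀ hT] at this
  rwa [dyadicFloor, div_le_iff₀ (by positivity)]

lemma lt_dyadicFloor_add {T : ℝ} (hT : 0 < T) (n : ℕ) (t : ℝ) :
    t < dyadicFloor T n t + T / 2 ^ n := by
  have := Nat.lt_floor_add_one (t * 2 ^ n / T)
  rw [div_lt_iff₀ hT] at this
  rw [dyadicFloor, ← add_div, lt_div_iff₀ (by positivity)]
  linarith

lemma floor_mul_pow_le {T : ℝ} (hT : 0 < T) (n : ℕ) {t : ℝ} (ht : t ≤ T) :
    ⌊t * 2 ^ n / T⌋₊ ≤ 2 ^ n := by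
  refine Nat.floor_le_of_le ?_
  rw [div_le_iff₀ hT]
  push_cast
  rw [mul_comm]
  gcongr

/-- A continuous path whose increments over dyadic intervals are of order `α` is Hölder
continuous of order `α`. -/
lemma exists_holder_of_dyadic {F : Type*} [NormedAddCommGroup F] {α : ℝ} (hα : 0 < α) :
    ∃ c, 0 ≤ c ∧ ∀ (T R : ℝ) (f : ℝ → F), 0 < T → 0 ≤ R → ContinuousOn f (Set.Icc 0 T) →
      (∀ n k : ℕ, k < 2 ^ n →
        ‖f ((k + 1 : ℕ) * T / 2 ^ n) - f (k * T / 2 ^ n)‖ ≤ R * (T / 2 ^ n) ^ α) →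
      ∀ s ∈ Set.Icc 0 T, ∀ t ∈ Set.Icc 0 T, s ≤ t → ‖f t - f s‖ ≤ c * R * (t - s) ^ α := by
  set r : ℝ := (1 / 2) ^ α with hr
  have hr0 : 0 < r := by positivity
  have hr1 : r < 1 := Real.rpow_lt_one (by norm_num) (by norm_num) hα
  set c₀ := (1 - r)⁻¹ with hc₀
  have hc₀0 : 0 < c₀ := inv_pos.2 (by linarith)
  refine ⟨(2 * c₀ + 1) * 2 ^ α, by positivity, ?_⟩
  intro T R f hT hR hf hdy s hs t ht hst
  set h : ℕ → ℝ := fun n => T / 2 ^ n with hh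
  have hpos : ∀ n, 0 < h n := fun n => by simp only [hh]; positivity
  have hsucc : ∀ n, h (n + 1) = 1 / 2 * h n := fun n => by
    simp only [hh, pow_succ]; field_simp
  have hsuccα : ∀ n, h (n + 1) ^ α = r * h n ^ α := fun n => by
    rw [hsucc, Real.mul_rpow (by norm_num) (hpos n).le]
  have hadj : ∀ n k l : ℕ, l ≤ 2 ^ n → (l = k ∨ l = k + 1) →
      ‖f (l * T / 2 ^ n) - f (k * T / 2 ^ n)‖ ≤ R * h n ^ α := by
    rintro n k l hl (rfl | rfl)
    · rw [sub_self, norm_zero]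
      exact mul_nonneg hR (Real.rpow_nonneg (hpos n).le _)
    · exact hdy n k hl
  have hone : ∀ t ∈ Set.Icc 0 T, ∀ n,
      ‖f (dyadicFloor T (n + 1) t) - f (dyadicFloor T n t)‖ ≤ R * h (n + 1) ^ α := by
    intro t ht n
    have h1 : dyadicFloor T n t = ((2 * ⌊t * 2 ^ n / T⌋₊ : ℕ) : ℝ) * T / 2 ^ (n + 1) := by
      rw [dyadicFloor, pow_succ]; push_cast; field_simp
    have h2 : t * 2 ^ (n + 1) / T = 2 * (t * 2 ^ n / T) := by rw [pow_succ]; ring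
    have h3 : ⌊t * 2 ^ (n + 1) / T⌋₊ = 2 * ⌊t * 2 ^ n / T⌋₊ ∨
        ⌊t * 2 ^ (n + 1) / T⌋₊ = 2 * ⌊t * 2 ^ n / T⌋₊ + 1 := by
      rw [h2]
      exact floor_two_mul (div_nonneg (mul_nonneg ht.1 (by positivity)) hT.le)
    rw [h1, dyadicFloor]
    exact hadj (n + 1) _ _ (floor_mul_pow_le hT _ ht.2) h3
  -- Chaining over levels. The geometric sum is kept in telescoped form, with the last term
  -- subtracted, so that the induction closes.
  have hmany : ∀ t ∈ Set.Icc 0 T, ∀ n m,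
      ‖f (dyadicFloor T (n + m) t) - f (dyadicFloor T n t)‖ ≤
        c₀ * R * (h n ^ α - h (n + m) ^ α) := by
    intro t ht n m
    induction m with
    | zero => simp
    | succ m ih =>
      have h1 := hone t ht (n + m)
      have h2 : R * h (n + m + 1) ^ α ≤ c₀ * R * (h (n + m) ^ α - h (n + m + 1) ^ α) := by
        have h3 : c₀ * R * (h (n + m) ^ α - h (n + m + 1) ^ α) = R * h (n + m) ^ α := by
          rw [hsuccα]
          have : c₀ * (1 - r) = 1 := inv_mul_cancel₀ (by linarith)
          linear_combination (R * h (n + m) ^ α) * this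
        rw [h3, hsuccα]
        have : 0 ≤ h (n + m) ^ α := Real.rpow_nonneg (hpos _).le _
        exact mul_le_mul_of_nonneg_left (mul_le_of_le_one_left this hr1.le) hR
      have h4 : ‖f (dyadicFloor T (n + m + 1) t) - f (dyadicFloor T n t)‖ ≤
          ‖f (dyadicFloor T (n + m + 1) t) - f (dyadicFloor T (n + m) t)‖ +
            ‖f (dyadicFloor T (n + m) t) - f (dyadicFloor T n t)‖ :=
        norm_sub_le_norm_sub_add_norm_sub _ _ _
      rw [← add_assoc]
      linarith
  have hlim : ∀ t ∈ Set.Icc 0 T, ∀ n, ‖f t - f (dyadicFloor T n t)‖ ≤ c₀ * R * h n ^ α := by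
    intro t ht n
    have hh0 : Filter.Tendsto (fun m : ℕ => T / 2 ^ (n + m)) Filter.atTop (nhds 0) := by
      have : Filter.Tendsto (fun m : ℕ => T / 2 ^ n * (1 / 2 : ℝ) ^ m) Filter.atTop
          (nhds (T / 2 ^ n * 0)) :=
        (tendsto_pow_atTop_nhds_zero_of_lt_one (by norm_num) (by norm_num)).const_mul _
      rw [mul_zero] at this
      refine this.congr fun m => ?_
      rw [pow_add, one_div, inv_pow]
      field_simp
    have htend : Filter.Tendsto (fun m => dyadicFloor T (n + m) t) Filter.atTop (nhds t) := by
      have hlow : Filter.Tendsto (fun m : ℕ => t - T / 2 ^ (n + m)) Filter.atTop (nhds t) := by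
        simpa using hh0.const_sub t
      refine tendsto_of_tendsto_of_tendsto_of_le_of_le hlow tendsto_const_nhds (fun m => ?_)
        (fun m => dyadicFloor_le hT _ ht.1)
      have := lt_dyadicFloor_add hT (n + m) t
      dsimp only
      linarith
    have htendIcc : Filter.Tendsto (fun m => dyadicFloor T (n + m) t) Filter.atTop
        (nhdsWithin t (Set.Icc 0 T)) := by
      refine tendsto_nhdsWithin_iff.2 ⟨htend, Filter.Eventually.of_forall fun m => ⟨?_, ?_⟩⟩
      · rw [dyadicFloor]; positivity
      · exact (dyadicFloor_le hT _ ht.1).trans ht.2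
    have hft := ((hf t ht).tendsto.comp htendIcc).sub_const (f (dyadicFloor T n t)) |>.norm
    refine le_of_tendsto' hft fun m => (hmany t ht n m).trans ?_
    refine mul_le_mul_of_nonneg_left ?_ (by positivity)
    have := Real.rpow_nonneg (hpos (n + m)).le α
    linarith
  rcases hst.eq_or_lt with rfl | hlt
  · rw [sub_self, norm_zero, sub_self, Real.zero_rpow hα.ne', mul_zero]
  -- The level with `h (n + 1) < t - s ≤ h n`: the dyadic floors of `s` and `t` are equal or
  -- adjacent, and `h n` is less than twice `t - s`.
  obtain ⟨n, hn1, hn2⟩ := exists_nat_pow_near_of_lt_one (x := (t - s) / T) (y := (1 / 2 : ℝ))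
    (div_pos (sub_pos.2 hlt) hT) (by rw [div_le_one hT]; linarith [hs.1, ht.2]) (by norm_num)
    (by norm_num)
  have hhn : ∀ k, (1 / 2 : ℝ) ^ k * T = h k := fun k => by
    simp only [hh]; rw [one_div, inv_pow]; field_simp
  rw [lt_div_iff₀ hT, hhn] at hn1
  rw [div_le_iff₀ hT, hhn] at hn2
  have hmid : ‖f (dyadicFloor T n t) - f (dyadicFloor T n s)‖ ≤ R * h n ^ α := by
    refine hadj n _ _ (floor_mul_pow_le hT _ ht.2) ?_
    have h0 : 0 ≤ s * 2 ^ n / T := div_nonneg (mul_nonneg hs.1 (by positivity)) hT.le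
    have h1 : s * 2 ^ n / T ≤ t * 2 ^ n / T := by gcongr
    have h2 : t * 2 ^ n / T ≤ s * 2 ^ n / T + 1 := by
      simp only [hh] at hn2
      rw [le_div_iff₀ (by positivity)] at hn2
      rw [div_add_one hT.ne']
      gcongr
      linarith
    have h3 := Nat.floor_mono h1
    have h4 := Nat.floor_mono h2
    rw [Nat.floor_add_one h0] at h4
    omega
  have hsplit : f t - f s = (f t - f (dyadicFloor T n t)) +
      (f (dyadicFloor T n t) - f (dyadicFloor T n s)) - (f s - f (dyadicFloor T n s)) := by abel
  have e1 := hlim t ht n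
  have e2 := hlim s hs n
  have e3 : h n ^ α ≤ 2 ^ α * (t - s) ^ α := by
    rw [← Real.mul_rpow (by norm_num) (by linarith)]
    refine Real.rpow_le_rpow (hpos n).le ?_ hα.le
    rw [hsucc] at hn1
    linarith
  calc ‖f t - f s‖ ≤ c₀ * R * h n ^ α + R * h n ^ α + c₀ * R * h n ^ α := by
        rw [hsplit]
        refine (norm_sub_le _ _).trans (add_le_add ((norm_add_le _ _).trans
          (add_le_add e1 hmid)) e2)
    _ = (2 * c₀ + 1) * R * h n ^ α := by ring
    _ ≤ (2 * c₀ + 1) * R * (2 ^ α * (t - s) ^ α) :=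
        mul_le_mul_of_nonneg_left e3 (by positivity)
    _ = _ := by ring

/-! ### Suprema of countable families of Gaussian variables -/

/-- Scaling to the standard Gaussian extracts `v ^ p` from the factor `x ^ (2 * p)`. Half of
Fernique's square exponent dominates `exp (η * x ^ 2)` and the other half the polynomial. The factor
`v ^ p` makes sums over a countable family converge. -/
lemma exists_lintegral_gaussianReal_le :
    ∃ c, 0 < c ∧ ∀ p : ℕ, ∃ A : ℝ≥0, ∀ (v : ℝ≥0) (η : ℝ), η * v ≤ c →
      ∫⁻ x, ENNReal.ofReal (x ^ (2 * p) * Real.exp (η * x ^ 2)) ∂(gaussianReal 0 v) ≤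
        A * (v : ℝ≥0∞) ^ p := by
  obtain ⟨C, hC, hint⟩ := IsGaussian.exists_integrable_exp_sq (gaussianReal 0 1)
  refine ⟨C / 2, by positivity, fun p => ?_⟩
  set D : ℝ := p.factorial * (2 / C) ^ p with hD
  have hD0 : 0 ≤ D := by positivity
  have hfin : ∫⁻ x, ENNReal.ofReal (Real.exp (C * ‖x‖ ^ 2)) ∂(gaussianReal 0 1) ≠ ∞ :=
    hint.lintegral_lt_top.ne
  refine ⟨D.toNNReal * (∫⁻ x, ENNReal.ofReal (Real.exp (C * ‖x‖ ^ 2))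
    ∂(gaussianReal 0 1)).toNNReal, fun v η hη => ?_⟩
  have hmap : gaussianReal 0 v = (gaussianReal 0 1).map (fun x => √v * x) := by
    rw [gaussianReal_map_const_mul, mul_zero]
    congr 1
    ext
    simp
  rw [hmap, lintegral_map (by fun_prop) (by fun_prop)]
  have hbound : ∀ x : ℝ, ENNReal.ofReal ((√v * x) ^ (2 * p) * Real.exp (η * (√v * x) ^ 2)) ≤
      ((v : ℝ≥0∞) ^ p * (D.toNNReal : ℝ≥0∞)) * ENNReal.ofReal (Real.exp (C * ‖x‖ ^ 2)) := by
    intro x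
    have h1 : (√v * x) ^ 2 = v * x ^ 2 := by rw [mul_pow, Real.sq_sqrt v.coe_nonneg]
    have h2 : Real.exp (η * (v * x ^ 2)) ≤ Real.exp (C / 2 * x ^ 2) :=
      Real.exp_le_exp.2 (by
        rw [← mul_assoc]; exact mul_le_mul_of_nonneg_right hη (sq_nonneg x))
    have h3 : (x ^ 2) ^ p ≤ D * Real.exp (C / 2 * x ^ 2) := by
      have h4 := Real.pow_div_factorial_le_exp (C / 2 * x ^ 2) (by positivity) p
      rw [div_le_iff₀ (by positivity), mul_pow] at h4
      have h5 : (x ^ 2) ^ p = (2 / C) ^ p * ((C / 2) ^ p * (x ^ 2) ^ p) := by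
        rw [← mul_assoc, ← mul_pow, div_mul_div_cancel₀ hC.ne', div_self two_ne_zero, one_pow,
          one_mul]
      rw [h5, hD]
      calc _ ≤ (2 / C) ^ p * (Real.exp (C / 2 * x ^ 2) * p.factorial) := by gcongr
        _ = _ := by ring
    have h6 : (√v * x) ^ (2 * p) * Real.exp (η * (√v * x) ^ 2) ≤
        ((v : ℝ) ^ p * D) * Real.exp (C * ‖x‖ ^ 2) := by
      rw [pow_mul, h1, mul_pow, Real.norm_eq_abs, sq_abs]
      calc (v : ℝ) ^ p * (x ^ 2) ^ p * Real.exp (η * (v * x ^ 2)) ≤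
            (v : ℝ) ^ p * (D * Real.exp (C / 2 * x ^ 2)) * Real.exp (C / 2 * x ^ 2) := by gcongr
        _ = (v : ℝ) ^ p * D * (Real.exp (C / 2 * x ^ 2) * Real.exp (C / 2 * x ^ 2)) := by ring
        _ = _ := by rw [← Real.exp_add]; ring_nf
    refine (ENNReal.ofReal_le_ofReal h6).trans_eq ?_
    rw [ENNReal.ofReal_mul (by positivity), ENNReal.ofReal_mul (by positivity),
      ENNReal.ofReal_pow v.coe_nonneg, ENNReal.ofReal_coe_nnreal]
    rfl
  refine (lintegral_mono hbound).trans_eq ?_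
  rw [lintegral_const_mul _ (by fun_prop), ENNReal.coe_mul, ENNReal.coe_toNNReal hfin]
  ring

/-- The supremum of a countable family of centered Gaussian variables whose variances are summable
to some power has Gaussian tails. -/
lemma exists_sup_gaussian {Ω : Type*} [MeasurableSpace Ω] {P : Measure Ω} [IsProbabilityMeasure P]
    {ι : Type*} [Countable ι] {X : ι → Ω → ℝ} {v : ι → ℝ≥0} (hX : ∀ q, AEMeasurable (X q) P)
    (hlaw : ∀ q, P.map (X q) = gaussianReal 0 (v q)) {p : ℕ} (hp : p ≠ 0)
    (hv : Summable fun q => (v q : ℝ) ^ p) :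
    ∃ N : Ω → ℝ, AEMeasurable N P ∧ (∀ ω, 0 ≤ N ω) ∧ (∀ᵐ ω ∂P, ∀ q, |X q ω| ≤ N ω) ∧
      ∃ η, 0 < η ∧ Integrable (fun ω => Real.exp (η * N ω ^ 2)) P := by
  obtain ⟨c, hc, hmom⟩ := exists_lintegral_gaussianReal_le
  obtain ⟨A, hA⟩ := hmom p
  -- a common bound for the variances
  obtain ⟨v₀, hv₀, hvv⟩ : ∃ v₀ : ℝ, 0 < v₀ ∧ ∀ q, (v q : ℝ) ≤ v₀ := by
    refine ⟨∑' q, (v q : ℝ) ^ p + 1, by positivity, fun q => ?_⟩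
    have h1 : (v q : ℝ) ^ p ≤ ∑' q, (v q : ℝ) ^ p := hv.le_tsum q fun _ _ => by positivity
    rcases le_total (v q : ℝ) 1 with h | h
    · have : 0 ≤ ∑' q, (v q : ℝ) ^ p := tsum_nonneg fun _ => by positivity
      linarith
    · have := le_self_pow₀ h hp
      linarith
  set η := c / v₀ with hη
  have hη0 : 0 < η := by positivity
  have hηv : ∀ q, η * v q ≤ c := fun q => by
    calc η * v q ≤ η * v₀ := mul_le_mul_of_nonneg_left (hvv q) hη0.le
      _ = c := by rw [hη]; field_simp
  -- The power makes the expectations summable, the exponential controls the tails. The sum `Ψ` of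
  -- all `φ (X q)` is integrable and dominates each of them.
  let φ : ℝ → ℝ := fun x => x ^ (2 * p) * Real.exp (η * x ^ 2)
  have hφmono : ∀ x y, 0 ≤ x → x ≤ |y| → φ x ≤ φ y := by
    intro x y hx hxy
    have h1 : x ^ 2 ≤ y ^ 2 := by rw [← sq_abs y]; gcongr
    simp only [φ, pow_mul]
    gcongr
  have hφm : Measurable φ := by fun_prop
  have hφ0 : ∀ x, 0 ≤ φ x := fun x => by simp only [φ, pow_mul]; positivity
  have hterm : ∀ q, ∫⁻ ω, ENNReal.ofReal (φ (X q ω)) ∂P ≤ A * ENNReal.ofReal ((v q : ℝ) ^ p) := by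
    intro q
    have := hA (v q) η (hηv q)
    rw [← hlaw q, lintegral_map' (by fun_prop) (hX q)] at this
    refine this.trans_eq ?_
    rw [ENNReal.ofReal_pow (v q).coe_nonneg, ENNReal.ofReal_coe_nnreal]
  have hΨm : ∀ q, AEMeasurable (fun ω => ENNReal.ofReal (φ (X q ω))) P := fun q =>
    (hφm.comp_aemeasurable (hX q)).ennreal_ofReal
  set Ψ : Ω → ℝ≥0∞ := fun ω => ∑' q, ENNReal.ofReal (φ (X q ω)) with hΨ
  have hΨfin : ∫⁻ ω, Ψ ω ∂P ≠ ∞ := by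
    rw [hΨ, lintegral_tsum hΨm]
    refine ne_top_of_le_ne_top ?_ (ENNReal.tsum_le_tsum hterm)
    rw [ENNReal.tsum_mul_left]
    exact ENNReal.mul_ne_top ENNReal.coe_ne_top hv.tsum_ofReal_ne_top
  set S : Ω → ℝ≥0∞ := fun ω => ⨆ q, ENNReal.ofReal |X q ω| with hS
  have hSm : AEMeasurable S P := AEMeasurable.iSup fun q => (hX q).abs.ennreal_ofReal
  have hSfin : ∀ᵐ ω ∂P, S ω < ∞ := by
    filter_upwards [ae_lt_top' (AEMeasurable.tsum hΨm) hΨfin] with ω hω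
    refine lt_of_le_of_lt (iSup_le fun q => ?_) (ENNReal.add_lt_top.2 ⟨ENNReal.one_lt_top, hω⟩)
    have h1 : ENNReal.ofReal (φ (X q ω)) ≤ Ψ ω :=
      ENNReal.le_tsum (f := fun q => ENNReal.ofReal (φ (X q ω))) q
    refine le_trans ?_ (add_le_add_right h1 1)
    rw [← ENNReal.ofReal_one, ← ENNReal.ofReal_add zero_le_one (hφ0 _)]
    refine ENNReal.ofReal_le_ofReal ?_
    have h2 : |X q ω| ^ (2 * p) ≤ φ (X q ω) := by
      have : |X q ω| ^ (2 * p) = X q ω ^ (2 * p) := by rw [pow_mul, sq_abs, ← pow_mul]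
      rw [this]
      refine le_mul_of_one_le_right (by rw [pow_mul]; positivity) (Real.one_le_exp (by positivity))
    rcases le_total |X q ω| 1 with h | h
    · have := hφ0 (X q ω)
      linarith
    · have := le_self_pow₀ h (by omega : 2 * p ≠ 0)
      linarith
  have hle : ∀ᵐ ω ∂P, ∀ q, |X q ω| ≤ (S ω).toReal := by
    filter_upwards [hSfin] with ω hω q
    rw [← ENNReal.ofReal_le_iff_le_toReal hω.ne]
    exact le_iSup (fun q => ENNReal.ofReal |X q ω|) q
  refine ⟨fun ω => (S ω).toReal, hSm.ennreal_toReal, fun ω => ENNReal.toReal_nonneg, hle,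
    η / 4, by positivity, ?_⟩
  -- The supremum need not be attained, but when positive some `|X q|` exceeds half of it; hence the
  -- exponent `η / 4`.
  have hkey : ∀ᵐ ω ∂P, ENNReal.ofReal (φ ((S ω).toReal / 2)) ≤ Ψ ω := by
    filter_upwards [hSfin] with ω hω
    rcases (ENNReal.toReal_nonneg (a := S ω)).eq_or_lt with h | h
    · rw [← h]
      simp [φ, hp]
    · have h1 : ENNReal.ofReal ((S ω).toReal / 2) < S ω := by
        rw [ENNReal.ofReal_lt_iff_lt_toReal (by positivity) hω.ne]
        linarith
      obtain ⟨q, hq⟩ := lt_iSup_iff.1 h1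
      have h2 : (S ω).toReal / 2 ≤ |X q ω| := (ENNReal.ofReal_lt_ofReal_iff'.1 hq).1.le
      exact (ENNReal.ofReal_le_ofReal (hφmono _ _ (by positivity) h2)).trans
        (ENNReal.le_tsum (f := fun q => ENNReal.ofReal (φ (X q ω))) q)
  refine ⟨(by fun_prop : AEMeasurable _ P).aestronglyMeasurable, ?_⟩
  rw [hasFiniteIntegral_iff_ofReal (Filter.Eventually.of_forall fun ω => (Real.exp_pos _).le)]
  refine lt_of_le_of_lt (lintegral_mono_ae (g := fun ω => ENNReal.ofReal (Real.exp η) + Ψ ω) ?_) ?_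
  · filter_upwards [hkey] with ω hω
    refine le_trans ?_ (add_le_add_right hω _)
    have h0 := hφ0 ((S ω).toReal / 2)
    rw [← ENNReal.ofReal_add (Real.exp_pos _).le h0]
    refine ENNReal.ofReal_le_ofReal ?_
    set x := (S ω).toReal / 2 with hx
    have hxx : η / 4 * (S ω).toReal ^ 2 = η * x ^ 2 := by rw [hx]; ring
    have hx0 : 0 ≤ x := by positivity
    rw [hxx]
    rcases le_total x 1 with h | h
    · have h1 : η * x ^ 2 ≤ η := mul_le_of_le_one_right hη0.le (pow_le_one₀ hx0 h)
      have := Real.exp_le_exp.2 h1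
      linarith
    · have h1 : Real.exp (η * x ^ 2) ≤ φ x :=
        le_mul_of_one_le_left (Real.exp_pos _).le (one_le_pow₀ h)
      have := Real.exp_pos η
      linarith
  · rw [lintegral_add_left measurable_const, lintegral_const]
    simp only [measure_univ, mul_one]
    exact ENNReal.add_lt_top.2 ⟨ENNReal.ofReal_lt_top, hΨfin.lt_top⟩

/-- Gaussian tails give exponential moments of powers less than two. -/
lemma integrable_exp_rpow {Ω : Type*} [MeasurableSpace Ω] {P : Measure Ω} [IsProbabilityMeasure P]
    {N : Ω → ℝ} (hN : AEMeasurable N P) (hN0 : ∀ ω, 0 ≤ N ω) {η : ℝ} (hη : 0 < η)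
    (hint : Integrable (fun ω => Real.exp (η * N ω ^ 2)) P) {c q : ℝ} (hc : 0 ≤ c) (hq0 : 0 < q)
    (hq : q < 2) : Integrable (fun ω => Real.exp (c * N ω ^ q)) P := by
  -- above the threshold `x₀` the power `q` is dominated
  set x₀ := (c / η) ^ (1 / (2 - q)) with hx₀
  have hx₀0 : 0 ≤ x₀ := by positivity
  refine (hint.const_mul (Real.exp (c * x₀ ^ q))).mono'
    (by fun_prop : AEMeasurable _ P).aestronglyMeasurable (Filter.Eventually.of_forall fun ω => ?_)
  rw [Real.norm_of_nonneg (Real.exp_pos _).le, ← Real.exp_add]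
  refine Real.exp_le_exp.2 ?_
  have hn := hN0 ω
  rcases le_total (N ω) x₀ with h | h
  · have h1 : N ω ^ q ≤ x₀ ^ q := Real.rpow_le_rpow hn h hq0.le
    have h2 := mul_le_mul_of_nonneg_left h1 hc
    have h3 : 0 ≤ η * N ω ^ 2 := by positivity
    linarith
  · have h1 : x₀ ^ (2 - q) ≤ N ω ^ (2 - q) := Real.rpow_le_rpow hx₀0 h (by linarith)
    rw [hx₀, ← Real.rpow_mul (by positivity), one_div_mul_cancel (by linarith), Real.rpow_one,
      div_le_iff₀ hη] at h1
    have h2 : N ω ^ (2 - q) * N ω ^ q = N ω ^ 2 := by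
      rw [← Real.rpow_add' hn (by norm_num), ← Real.rpow_natCast]; norm_num
    have h3 : 0 ≤ N ω ^ q := by positivity
    have h4 := mul_le_mul_of_nonneg_right h1 h3
    have h5 : N ω ^ (2 - q) * η * N ω ^ q = η * N ω ^ 2 := by rw [← h2]; ring
    have h6 : 0 ≤ c * x₀ ^ q := by positivity
    linarith

end FractionalEuler

namespace FractionalEuler

/-! ### Fractional Brownian motion -/

section FractionalBrownianMotion

variable {Ω : Type*} [MeasurableSpace Ω] {P : Measure Ω} {d : ℕ} {H T : ℝ}
  {B : ℝ → Ω → EuclideanSpace ℝ (Fin d)}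

lemma IsFractionalBrownianMotion.hasGaussianLaw_apply (hB : IsFractionalBrownianMotion P H T B)
    {t : ℝ} (ht : t ∈ Set.Icc 0 T) (i : Fin d) : HasGaussianLaw (fun ω => B t ω i) P :=
  (hB.gaussian.hasGaussianLaw_eval ⟨t, ht⟩).map_fun (EuclideanSpace.proj i)

lemma IsFractionalBrownianMotion.aemeasurable_apply (hB : IsFractionalBrownianMotion P H T B)
    {t : ℝ} (ht : t ∈ Set.Icc 0 T) (i : Fin d) : AEMeasurable (fun ω => B t ω i) P :=
  (hB.hasGaussianLaw_apply ht i).aemeasurable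

/-- The increments of fractional Brownian motion are centered Gaussian with variance
`|t - s| ^ (2 * H)`. -/
lemma IsFractionalBrownianMotion.map_increment (hB : IsFractionalBrownianMotion P H T B)
    (hH : 0 < H) {s t : ℝ} (hs : s ∈ Set.Icc 0 T) (ht : t ∈ Set.Icc 0 T) (i : Fin d) :
    P.map (fun ω => B t ω i - B s ω i) = gaussianReal 0 (|t - s| ^ (2 * H)).toNNReal := by
  have ht' := hB.hasGaussianLaw_apply ht i
  have hs' := hB.hasGaussianLaw_apply hs i
  have hlaw : HasGaussianLaw (fun ω => B t ω i - B s ω i) P := by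
    have := (hB.gaussian.hasGaussianLaw_sub (s := ⟨t, ht⟩) (t := ⟨s, hs⟩)).map_fun
      (EuclideanSpace.proj i)
    simpa using this
  have hmean : ∫ ω, (B t ω i - B s ω i) ∂P = 0 := by
    rw [integral_sub ht'.integrable hs'.integrable, hB.centered t ht i,
      hB.centered s hs i, sub_zero]
  have hvar : Var[fun ω => B t ω i - B s ω i; P] = |t - s| ^ (2 * H) := by
    rw [variance_of_integral_eq_zero hlaw.aemeasurable hmean]
    have htt : Integrable (fun ω => B t ω i * B t ω i) P :=
      ht'.memLp_two.integrable_mul ht'.memLp_two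
    have hts : Integrable (fun ω => B t ω i * B s ω i) P :=
      ht'.memLp_two.integrable_mul hs'.memLp_two
    have hss : Integrable (fun ω => B s ω i * B s ω i) P :=
      hs'.memLp_two.integrable_mul hs'.memLp_two
    have hexp : (fun ω => (B t ω i - B s ω i) ^ 2) = fun ω =>
        B t ω i * B t ω i - 2 * (B t ω i * B s ω i) + B s ω i * B s ω i := by
      funext ω; ring
    have h0 : (0 : ℝ) ^ (2 * H) = 0 := Real.zero_rpow (by linarith)
    have hsub : Integrable (fun ω => B t ω i * B t ω i - 2 * (B t ω i * B s ω i)) P :=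
      htt.sub (hts.const_mul 2)
    rw [hexp, integral_add hsub hss, integral_sub htt (hts.const_mul 2),
      integral_const_mul, hB.covariance t ht t ht, hB.covariance t ht s hs,
      hB.covariance s hs s hs]
    simp only [if_true, sub_self, abs_zero, h0]
    ring
  rw [hlaw.map_eq_gaussianReal, hmean, hvar]

lemma norm_le_of_abs_apply_le (v : EuclideanSpace ℝ (Fin d)) {r : ℝ} (hr : ∀ i, |v i| ≤ r) :
    ‖v‖ ≤ d * r := by
  have h1 : v = ∑ i, v i • EuclideanSpace.single i (1 : ℝ) := by
    ext j
    simp [Pi.single_apply]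
  rw [h1]
  refine (norm_sum_le _ _).trans ?_
  have h2 : ∀ i ∈ Finset.univ, ‖v i • EuclideanSpace.single i (1 : ℝ)‖ ≤ r := fun i _ => by
    rw [norm_smul, PiLp.norm_single, norm_one, mul_one]
    exact hr i
  refine (Finset.sum_le_card_nsmul _ _ _ h2).trans_eq ?_
  simp

/-- Fractional Brownian motion is Hölder continuous of every order less than the Hurst parameter,
with a Hölder constant that has Gaussian tails. -/
lemma IsFractionalBrownianMotion.exists_holder [IsProbabilityMeasure P]
    (hB : IsFractionalBrownianMotion P H T B) (hT : 0 < T) {α : ℝ} (hα : 0 < α) (hαH : α < H) :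
    ∃ N : Ω → ℝ, AEMeasurable N P ∧ (∀ ω, 0 ≤ N ω) ∧
      (∀ᵐ ω ∂P, ∀ s ∈ Set.Icc 0 T, ∀ t ∈ Set.Icc 0 T, s ≤ t →
        ‖B t ω - B s ω‖ ≤ N ω * (t - s) ^ α) ∧
      ∃ η, 0 < η ∧ Integrable (fun ω => Real.exp (η * N ω ^ 2)) P := by
  -- Normalized increments at level `n` have variance `h n ^ (2 * (H - α))`. With `p * (H - α) > 1`
  -- its `p`-th power is `O(4 ^ (-n))`, summable over the `2 ^ n` intervals of each level.
  obtain ⟨p, hp⟩ := exists_nat_gt (1 / (H - α))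
  have hHα : 0 < H - α := sub_pos.2 hαH
  have hp0 : p ≠ 0 := by
    rintro rfl
    have : 0 < 1 / (H - α) := by positivity
    rw [Nat.cast_zero] at hp
    linarith
  rw [div_lt_iff₀ hHα] at hp
  set h : ℕ → ℝ := fun n => T / 2 ^ n with hh
  have hpos : ∀ n, 0 < h n := fun n => by simp only [hh]; positivity
  have hmem : ∀ n k : ℕ, k ≤ 2 ^ n → (k : ℝ) * T / 2 ^ n ∈ Set.Icc 0 T := fun n k hk => by
    have := grid_mem_Icc hT (Nat.one_le_two_pow (n := n)) hk
    rwa [Nat.cast_pow, Nat.cast_ofNat] at this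
  have hdiff : ∀ n k : ℕ, ((k + 1 : ℕ) : ℝ) * T / 2 ^ n - k * T / 2 ^ n = h n := fun n k => by
    simp only [hh]; push_cast; ring
  let X : (Σ n : ℕ, Fin (2 ^ n) × Fin d) → Ω → ℝ := fun q ω => (h q.1 ^ α)⁻¹ *
    (B ((q.2.1 + 1 : ℕ) * T / 2 ^ q.1) ω q.2.2 - B ((q.2.1 : ℕ) * T / 2 ^ q.1) ω q.2.2)
  let v : (Σ n : ℕ, Fin (2 ^ n) × Fin d) → ℝ≥0 := fun q =>
    NNReal.mk ((h q.1 ^ α)⁻¹ ^ 2) (sq_nonneg _) * (|h q.1| ^ (2 * H)).toNNReal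
  have hm : ∀ q : (Σ n : ℕ, Fin (2 ^ n) × Fin d), AEMeasurable (fun ω =>
      B ((q.2.1 + 1 : ℕ) * T / 2 ^ q.1) ω q.2.2 - B ((q.2.1 : ℕ) * T / 2 ^ q.1) ω q.2.2) P :=
    fun q => (hB.aemeasurable_apply (hmem _ _ q.2.1.2) _).sub
      (hB.aemeasurable_apply (hmem _ _ q.2.1.2.le) _)
  have hX : ∀ q, AEMeasurable (X q) P := fun q => (hm q).const_mul _
  have hlaw : ∀ q, P.map (X q) = gaussianReal 0 (v q) := by
    intro q
    have h1 := hB.map_increment (by linarith) (hmem q.1 q.2.1 q.2.1.2.le)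
      (hmem q.1 (q.2.1 + 1) q.2.1.2) q.2.2
    rw [hdiff] at h1
    have h2 : X q = (fun x => (h q.1 ^ α)⁻¹ * x) ∘ fun ω =>
      B ((q.2.1 + 1 : ℕ) * T / 2 ^ q.1) ω q.2.2 - B ((q.2.1 : ℕ) * T / 2 ^ q.1) ω q.2.2 := rfl
    rw [h2, ← AEMeasurable.map_map_of_aemeasurable (by fun_prop) (hm q), h1,
      gaussianReal_map_const_mul, mul_zero]
  have hvp : ∀ q, (v q : ℝ) ^ p ≤ T ^ (2 * (H - α) * p) * (1 / 4) ^ q.1 := by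
    rintro ⟨n, k, i⟩
    have h1 : (v ⟨n, k, i⟩ : ℝ) = h n ^ (2 * (H - α)) := by
      simp only [v]
      rw [NNReal.coe_mul, Real.coe_toNNReal _ (by positivity), abs_of_pos (hpos n)]
      show (h n ^ α)⁻¹ ^ 2 * _ = _
      rw [← Real.rpow_neg (hpos n).le, ← Real.rpow_natCast, ← Real.rpow_mul (hpos n).le,
        ← Real.rpow_add (hpos n)]
      congr 1
      push_cast
      ring
    rw [h1, ← Real.rpow_natCast, ← Real.rpow_mul (hpos n).le]
    simp only [hh]
    rw [Real.div_rpow hT.le (by positivity), div_eq_mul_inv]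
    refine mul_le_mul_of_nonneg_left ?_ (by positivity)
    rw [one_div, inv_pow]
    refine inv_anti₀ (by positivity) ?_
    have h2 : (4 : ℝ) ^ n = (2 ^ n : ℝ) ^ (2 : ℝ) := by
      rw [Real.rpow_two, ← pow_mul, mul_comm, pow_mul]; norm_num
    rw [h2]
    refine Real.rpow_le_rpow_of_exponent_le (one_le_pow₀ (by norm_num)) ?_
    linarith
  have hsum : Summable fun q => (v q : ℝ) ^ p := by
    refine Summable.of_nonneg_of_le (fun q => by positivity) hvp ?_
    refine (summable_sigma_of_nonneg fun q => by positivity).2 ⟨fun n => ?_, ?_⟩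
    · exact Summable.of_finite
    · have h1 : (fun n : ℕ => ∑' _ : Fin (2 ^ n) × Fin d,
          T ^ (2 * (H - α) * p) * (1 / 4 : ℝ) ^ n) =
          fun n : ℕ => d * T ^ (2 * (H - α) * p) * (1 / 2 : ℝ) ^ n := by
        funext n
        rw [tsum_fintype, Finset.sum_const, Finset.card_univ, Fintype.card_prod, Fintype.card_fin,
          Fintype.card_fin, nsmul_eq_mul]
        have : (1 / 2 : ℝ) ^ n = 2 ^ n * (1 / 4) ^ n := by rw [← mul_pow]; norm_num
        rw [this]
        push_cast
        ring
      rw [h1]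
      exact (summable_geometric_of_lt_one (by norm_num) (by norm_num)).mul_left _
  obtain ⟨N, hNm, hN0, hN, η, hη, hint⟩ := exists_sup_gaussian hX hlaw hp0 hsum
  obtain ⟨c, hc0, hc⟩ := exists_holder_of_dyadic (F := EuclideanSpace ℝ (Fin d)) hα
  -- The `+ 1` keeps `A` positive when `c * d = 0`, so that `η / A ^ 2` makes sense.
  set A := c * d + 1 with hA
  have hA0 : 0 < A := by positivity
  refine ⟨fun ω => A * N ω, hNm.const_mul _, fun ω => mul_nonneg hA0.le (hN0 ω), ?_,
    η / A ^ 2, by positivity, ?_⟩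
  · filter_upwards [hN, hB.continuous_paths] with ω hω hcont s hs t ht hst
    refine (hc T (d * N ω) (fun t => B t ω) hT (mul_nonneg (Nat.cast_nonneg d) (hN0 ω)) hcont ?_
      s hs t ht hst).trans ?_
    · intro n k hk
      rw [mul_assoc]
      refine norm_le_of_abs_apply_le _ fun i => ?_
      have h1 := hω ⟨n, ⟨k, hk⟩, i⟩
      have h2 : 0 < h n ^ α := Real.rpow_pos_of_pos (hpos n) _
      simp only [X] at h1
      rw [abs_mul, abs_inv, abs_of_pos h2, inv_mul_le_iff₀ h2, mul_comm (h n ^ α)] at h1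
      exact h1
    · refine mul_le_mul_of_nonneg_right ?_ (Real.rpow_nonneg (sub_nonneg.2 hst) _)
      rw [hA]
      have := hN0 ω
      linarith
  · refine hint.congr (Filter.Eventually.of_forall fun ω => ?_)
    dsimp only
    congr 1
    field_simp

end FractionalBrownianMotion

/-! ### Moments of the error constant -/

/-- By `(A + N)² ≤ 2 A² + 2 N²`, a shift costs half the exponent. It is needed since the time
component adds a constant to the Hölder constant of the driver. -/
lemma integrable_exp_sq_const_add {Ω : Type*} [MeasurableSpace Ω] {P : Measure Ω} {N : Ω → ℝ}
    (hN : AEMeasurable N P) {η : ℝ} (hη : 0 ≤ η)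
    (hint : Integrable (fun ω => Real.exp (η * N ω ^ 2)) P) (A : ℝ) :
    Integrable (fun ω => Real.exp (η / 2 * (A + N ω) ^ 2)) P := by
  refine (hint.const_mul (Real.exp (η * A ^ 2))).mono'
    (by fun_prop : AEMeasurable _ P).aestronglyMeasurable (Filter.Eventually.of_forall fun ω => ?_)
  rw [Real.norm_of_nonneg (Real.exp_pos _).le, ← Real.exp_add]
  refine Real.exp_le_exp.2 ?_
  nlinarith [mul_nonneg hη (sq_nonneg (A - N ω))]

/-- A power of an exponential is an exponential with a larger rate, hence the hypothesis for every
`c`. -/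
lemma memLp_const_mul_exp {Ω : Type*} [MeasurableSpace Ω] {P : Measure Ω} {X : Ω → ℝ}
    (hX : AEMeasurable X P)
    (hint : ∀ c, 0 ≤ c → Integrable (fun ω => Real.exp (c * X ω)) P) {Γ : ℝ} (hΓ : 0 ≤ Γ)
    {p : ℝ≥0∞} (hp : p ≠ ∞) : MemLp (fun ω => Γ * Real.exp (Γ * X ω)) p P := by
  have hm : AEStronglyMeasurable (fun ω => Γ * Real.exp (Γ * X ω)) P :=
    (by fun_prop : AEMeasurable _ P).aestronglyMeasurable
  rcases eq_or_ne p 0 with rfl | h0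
  · exact memLp_zero_iff_aestronglyMeasurable.2 hm
  rw [← integrable_norm_rpow_iff hm h0 hp]
  refine ((hint (p.toReal * Γ) (by positivity)).const_mul (Γ ^ p.toReal)).congr
    (Filter.Eventually.of_forall fun ω => ?_)
  dsimp only
  rw [Real.norm_of_nonneg (by positivity), Real.mul_rpow hΓ (Real.exp_pos _).le, ← Real.exp_mul]
  ring_nf

/-! ### Measurability of the Euler scheme -/

section Measurability

variable {Ω : Type*} [MeasurableSpace Ω] {P : Measure Ω} {m d : ℕ} {T : ℝ}
    {μ : EuclideanSpace ℝ (Fin m) → EuclideanSpace ℝ (Fin m)}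
    {σ : Fin d → EuclideanSpace ℝ (Fin m) → EuclideanSpace ℝ (Fin m)}
    {B : ℝ → Ω → EuclideanSpace ℝ (Fin d)}

lemma aemeasurable_eulerStep (hμ : Measurable μ) (hσ : ∀ j, Measurable (σ j)) {s t : ℝ}
    (hs : ∀ j, AEMeasurable (fun ω => B s ω j) P) (ht : ∀ j, AEMeasurable (fun ω => B t ω j) P)
    {Z : Ω → EuclideanSpace ℝ (Fin m)} (hZ : AEMeasurable Z P) :
    AEMeasurable (fun ω => eulerStep μ σ (fun r => B r ω) s t (Z ω)) P := by
  unfold eulerStep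
  have h1 : AEMeasurable (fun ω => (t - s) • μ (Z ω)) P :=
    (hμ.comp_aemeasurable hZ).const_smul (t - s)
  have h2 : ∀ j, AEMeasurable (fun ω => (B t ω j - B s ω j) • σ j (Z ω)) P := fun j =>
    ((ht j).sub (hs j)).smul ((hσ j).comp_aemeasurable hZ)
  exact (hZ.add h1).add (Finset.aemeasurable_fun_sum _ fun j _ => h2 j)

lemma aemeasurable_eulerPath (hT : 0 < T) (hμ : Measurable μ) (hσ : ∀ j, Measurable (σ j))
    (a : EuclideanSpace ℝ (Fin m))
    (hB : ∀ t ∈ Set.Icc 0 T, ∀ j, AEMeasurable (fun ω => B t ω j) P) {M : ℕ} (hM : 1 ≤ M) {t : ℝ}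
    (ht : t ∈ Set.Icc 0 T) :
    AEMeasurable (fun ω => eulerPath μ σ a T (fun r => B r ω) M t) P := by
  have hgrid : ∀ k ≤ M, AEMeasurable (fun ω => eulerGrid μ σ a T (fun r => B r ω) M k) P := by
    intro k
    induction k with
    | zero => intro _; exact aemeasurable_const
    | succ k ih =>
      intro hk
      exact aemeasurable_eulerStep hμ hσ (hB _ (grid_mem_Icc hT hM (by omega)))
        (hB _ (grid_mem_Icc hT hM hk)) (ih (by omega))
  have hk : ⌊t * M / T⌋₊ ≤ M := by
    refine Nat.floor_le_of_le ?_
    rw [div_le_iff₀ hT, mul_comm]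
    exact mul_le_mul_of_nonneg_left ht.2 (Nat.cast_nonneg M)
  exact aemeasurable_eulerStep hμ hσ (hB _ (grid_mem_Icc hT hM hk)) (hB t ht) (hgrid _ hk)

end Measurability

/-! ### The Hölder norm -/

/-- A bound for the Hölder norm of a path that starts from zero. -/
lemma holderNorm_le_of_le {E : Type*} [NormedAddCommGroup E] {f : ℝ → E} {T α R : ℝ} {γ : ℝ≥0}
    (hT : 0 < T) (hR : 0 ≤ R) (hγα : γ ≤ α) (h0 : f 0 = 0)
    (hf : ∀ s ∈ Set.Icc 0 T, ∀ t ∈ Set.Icc 0 T, s ≤ t → ‖f t - f s‖ ≤ R * (t - s) ^ α) :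
    holderNorm γ T f ≤ ENNReal.ofReal ((T ^ α + T ^ (α - γ)) * R) := by
  have hα : 0 ≤ α := γ.coe_nonneg.trans hγα
  rw [add_mul, ENNReal.ofReal_add (by positivity) (by positivity), holderNorm]
  refine add_le_add (iSup_le fun t => ?_) ?_
  · rw [← ofReal_norm]
    refine ENNReal.ofReal_le_ofReal ?_
    have h1 := hf 0 ⟨le_rfl, hT.le⟩ t t.2 t.2.1
    rw [h0, sub_zero, sub_zero] at h1
    rw [mul_comm]
    exact h1.trans (mul_le_mul_of_nonneg_left (Real.rpow_le_rpow t.2.1 t.2.2 hα) hR)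
  · have hle : ∀ s t : Set.Icc (0 : ℝ) T, (s : ℝ) ≤ t →
        ‖f t - f s‖ ≤ T ^ (α - γ) * R * (t - s : ℝ) ^ (γ : ℝ) := by
      intro s t hst
      have hts : (0 : ℝ) ≤ t - s := sub_nonneg.2 hst
      refine (hf s s.2 t t.2 hst).trans ?_
      have h1 : (t - s : ℝ) ^ α = (t - s : ℝ) ^ (α - γ) * (t - s : ℝ) ^ (γ : ℝ) := by
        rw [← Real.rpow_add_of_nonneg hts (sub_nonneg.2 hγα) γ.coe_nonneg, sub_add_cancel]
      have h2 : (t - s : ℝ) ^ (α - γ) ≤ T ^ (α - γ) :=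
        Real.rpow_le_rpow hts (by linarith [s.2.1, t.2.2]) (sub_nonneg.2 hγα)
      rw [h1, mul_comm (T ^ (α - γ)), ← mul_assoc]
      gcongr
    have hdist : ∀ s t : Set.Icc (0 : ℝ) T,
        dist (f s) (f t) ≤ T ^ (α - γ) * R * dist s t ^ (γ : ℝ) := by
      intro s t
      rw [Subtype.dist_eq, Real.dist_eq]
      rcases le_total (s : ℝ) t with h | h
      · rw [abs_sub_comm, abs_of_nonneg (sub_nonneg.2 h), dist_comm, dist_eq_norm]
        exact hle s t h
      · rw [abs_of_nonneg (sub_nonneg.2 h), dist_eq_norm]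
        exact hle t s h
    refine HolderWith.eHolderNorm_le (C := (T ^ (α - γ) * R).toNNReal) fun s t => ?_
    rw [edist_dist, edist_dist, ENNReal.ofReal_rpow_of_nonneg dist_nonneg γ.coe_nonneg,
      ← ENNReal.ofReal, ← ENNReal.ofReal_mul (by positivity)]
    exact ENNReal.ofReal_le_ofReal (hdist s t)

end FractionalEuler

/-! ### The Euler scheme driven by fractional Brownian motion -/

namespace FractionalEuler

/-- Pathwise error bound for the Euler scheme, with an error constant of finite moments. -/
theorem exists_moments_euler_error {Ω : Type*} [MeasurableSpace Ω] {P : Measure Ω}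
    [IsProbabilityMeasure P] {m d : ℕ} {H T α : ℝ} (hT : 0 < T) (hα : 1 / 2 < α) (hα1 : α < 1)
    (hαH : α < H) {μ : EuclideanSpace ℝ (Fin m) → EuclideanSpace ℝ (Fin m)}
    {σ : Fin d → EuclideanSpace ℝ (Fin m) → EuclideanSpace ℝ (Fin m)}
    (hμ : IsCb 2 μ) (hσ : ∀ j, IsCb 2 (σ j)) {a : EuclideanSpace ℝ (Fin m)}
    {B : ℝ → Ω → EuclideanSpace ℝ (Fin d)} (hB : IsFractionalBrownianMotion P H T B)
    {Y : ℝ → Ω → EuclideanSpace ℝ (Fin m)}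
    (hY : ∀ᵐ ω ∂P, IsYoungSolution μ σ a T (fun t => B t ω) (fun t => Y t ω)) :
    ∃ D : Ω → ℝ, (∀ ω, 0 ≤ D ω) ∧ (∀ p : ℝ≥0∞, p ≠ ∞ → MemLp D p P) ∧
      ∀ᵐ ω ∂P, ∀ M : ℕ, 1 ≤ M →
        Y 0 ω - eulerPath μ σ a T (fun s => B s ω) M 0 = 0 ∧
        ∀ s ∈ Set.Icc 0 T, ∀ t ∈ Set.Icc 0 T, s ≤ t →
          ‖(Y t ω - eulerPath μ σ a T (fun s => B s ω) M t) -
            (Y s ω - eulerPath μ σ a T (fun s => B s ω) M s)‖ ≤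
              D ω * (M : ℝ) ^ (1 - 2 * α) * (t - s) ^ α := by
  obtain ⟨K, hK⟩ := exists_isBoundedField_driftDiffusion hμ hσ
  obtain ⟨Γ, hΓ0, hΓ⟩ := euler_error hK hα hα1 hT
  obtain ⟨N, hNm, hN0, hN, η, hη, hint⟩ := hB.exists_holder hT (by linarith : 0 < α) hαH
  -- `T ^ (1 - α)` is a Hölder constant of `t ↦ t` on `[0, T]`; the `1` provides the bound `1 ≤ N`
  -- required by `euler_error`.
  set A := 1 + T ^ (1 - α) with hA
  have hA0 : 0 ≤ A := by positivity
  have hint' := integrable_exp_sq_const_add hNm hη.le hint A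
  -- The decisive use of `α > 1 / 2` in the moments: `1 / α < 2` stays below the Gaussian exponent.
  have hexp : ∀ c, 0 ≤ c → Integrable (fun ω => Real.exp (c * (A + N ω) ^ (1 / α))) P :=
    fun c hc => integrable_exp_rpow (hNm.const_add A) (fun ω => add_nonneg hA0 (hN0 ω))
      (half_pos hη) hint' hc (by positivity)
      (by rw [div_lt_iff₀ (by linarith)]; linarith)
  refine ⟨fun ω => Γ * Real.exp (Γ * (A + N ω) ^ (1 / α)), fun ω => by positivity,
    fun p hp => memLp_const_mul_exp ((hNm.const_add A).pow_const _) hexp hΓ0 hp, ?_⟩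
  filter_upwards [hN, hY] with ω hNω hYω M hM
  have hstart : Y 0 ω = eulerPath μ σ a T (fun s => B s ω) M 0 := by
    have h1 := eulerPath_grid μ σ a hT (fun s => B s ω) hM 0
    rw [Nat.cast_zero, zero_mul, zero_div, eulerGrid] at h1
    rw [h1]
    exact hYω.apply_zero hT.le
  refine ⟨sub_eq_zero.2 hstart, ?_⟩
  have hT1 : 0 ≤ T ^ (1 - α) := by positivity
  refine hΓ (A + N ω) (by linarith [hN0 ω]) (fun t => (t, B t ω)) (fun t => Y t ω) ?_
    (hYω.exists_eulerRemainder_le hμ hσ hT hα hα1 (hN0 ω) hNω) M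
    (eulerPath μ σ a T (fun s => B s ω) M) hM
    (fun k _ t ht => eulerPath_eq_of_mem_cell hT hM k ht) hstart
  intro s hs t ht hst
  have hts : 0 ≤ t - s := sub_nonneg.2 hst
  have hW : 0 ≤ (t - s) ^ α := Real.rpow_nonneg hts _
  rw [Prod.mk_sub_mk, Prod.norm_mk, max_le_iff]
  constructor
  · have h1 : t - s = (t - s) ^ (1 - α) * (t - s) ^ α := by
      rw [← Real.rpow_add_of_nonneg hts (by linarith) (by linarith)]; simp
    have h2 : (t - s) ^ (1 - α) ≤ T ^ (1 - α) :=
      Real.rpow_le_rpow hts (by linarith [hs.1, ht.2]) (by linarith)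
    rw [Real.norm_of_nonneg hts]
    calc t - s = (t - s) ^ (1 - α) * (t - s) ^ α := h1
      _ ≤ _ := mul_le_mul_of_nonneg_right (by linarith [hN0 ω]) hW
  · exact (hNω s hs t ht hst).trans (mul_le_mul_of_nonneg_right (by linarith) hW)

lemma IsCb.measurable {E F : Type*} [NormedAddCommGroup E] [NormedSpace ℝ E]
    [NormedAddCommGroup F] [NormedSpace ℝ F] [MeasurableSpace E] [BorelSpace E]
    [MeasurableSpace F] [BorelSpace F] {f : E → F} (hf : IsCb 2 f) : Measurable f := by
  obtain ⟨K, hK⟩ := hf.exists_isBoundedField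
  refine (LipschitzWith.of_dist_le_mul (K := K.toNNReal) fun p q => ?_).continuous.measurable
  rw [dist_eq_norm, dist_eq_norm, Real.coe_toNNReal _ (by linarith [hK.one_le])]
  exact hK.lipschitz p q

end FractionalEuler

theorem proposition4p2 {Ω : Type*} [MeasurableSpace Ω] (P : Measure Ω) [IsProbabilityMeasure P]
    {m d : ℕ} (H T : ℝ) (hH : 1 / 2 < H) (hH1 : H < 1) (hT : 0 < T)
    (μ : EuclideanSpace ℝ (Fin m) → EuclideanSpace ℝ (Fin m))
    (σ : Fin d → EuclideanSpace ℝ (Fin m) → EuclideanSpace ℝ (Fin m))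
    (hμ : IsCb 2 μ) (hσ : ∀ j, IsCb 2 (σ j))
    (a : EuclideanSpace ℝ (Fin m))
    (B : ℝ → Ω → EuclideanSpace ℝ (Fin d)) (hB : IsFractionalBrownianMotion P H T B)
    (Y : ℝ → Ω → EuclideanSpace ℝ (Fin m))
    (hY : ∀ᵐ ω ∂P, IsYoungSolution μ σ a T (fun t => B t ω) (fun t => Y t ω))
    (γ : ℝ≥0) (hγ : 0 < γ) (hγH : (γ : ℝ) < H) :
    (∃ C : Ω → ℝ, (∀ p : ℝ≥0∞, p ≠ ∞ → MemLp C p P) ∧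
      ∀ᵐ ω ∂P, ∀ M : ℕ, 1 ≤ M →
        holderNorm γ T (fun t => Y t ω - eulerPath μ σ a T (fun s => B s ω) M t) ≤
          ENNReal.ofReal (C ω * (M : ℝ) ^ (1 - 2 * (γ : ℝ)))) ∧
    ∃ K : ℝ, ∀ M : ℕ, 1 ≤ M → ∀ τ ∈ Set.Icc (0 : ℝ) T,
      MemLp (fun ω => Y τ ω - eulerPath μ σ a T (fun s => B s ω) M τ) 2 P ∧
      Real.sqrt (∫ ω, ‖Y τ ω - eulerPath μ σ a T (fun s => B s ω) M τ‖ ^ 2 ∂P) ≤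
        K * (M : ℝ) ^ (1 - 2 * (γ : ℝ)) ∧
      ∫ ω, ‖Y τ ω - eulerPath μ σ a T (fun s => B s ω) M τ‖ ^ 2 ∂P ≤
        K * (M : ℝ) ^ (1 - 2 * (γ : ℝ)) := by
  -- The Young estimates need an exponent above `1 / 2`, which `γ` may fail to be; a larger exponent
  -- gives a better rate and a stronger norm.
  obtain ⟨α, hα⟩ : ∃ α, max (γ : ℝ) (1 / 2) < α ∧ α < H := exists_between (max_lt hγH hH)
  have hγα : (γ : ℝ) < α := (le_max_left _ _).trans_lt hα.1
  have hα2 : 1 / 2 < α := (le_max_right _ _).trans_lt hα.1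
  obtain ⟨D, hD0, hDp, hD⟩ :=
    exists_moments_euler_error hT hα2 (hα.2.trans hH1) hα.2 hμ hσ (a := a) hB hY
  have hrate : ∀ M : ℕ, 1 ≤ M → (M : ℝ) ^ (1 - 2 * α) ≤ (M : ℝ) ^ (1 - 2 * (γ : ℝ)) :=
    fun M hM => Real.rpow_le_rpow_of_exponent_le (by exact_mod_cast hM) (by linarith)
  have hrate0 : ∀ M : ℕ, 0 ≤ (M : ℝ) ^ (1 - 2 * α) := fun M => by positivity
  refine ⟨⟨fun ω => (T ^ α + T ^ (α - γ)) * D ω, fun p hp => (hDp p hp).const_mul _, ?_⟩, ?_⟩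
  · filter_upwards [hD] with ω hω M hM
    obtain ⟨h0, h1⟩ := hω M hM
    refine (holderNorm_le_of_le hT (mul_nonneg (hD0 ω) (hrate0 M)) hγα.le h0 h1).trans
      (ENNReal.ofReal_le_ofReal ?_)
    rw [← mul_assoc]
    exact mul_le_mul_of_nonneg_left (hrate M hM) (mul_nonneg (by positivity) (hD0 ω))
  -- the error at a fixed time
  set Z : ℕ → ℝ → Ω → EuclideanSpace ℝ (Fin m) := fun M τ ω =>
    Y τ ω - eulerPath μ σ a T (fun s => B s ω) M τ with hZ
  set G : Ω → ℝ := fun ω => T ^ α * D ω with hG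
  have hG0 : ∀ ω, 0 ≤ G ω := fun ω => mul_nonneg (by positivity) (hD0 ω)
  have hG2 : MemLp G 2 P := (hDp 2 (by simp)).const_mul _
  have hpt : ∀ᵐ ω ∂P, ∀ M : ℕ, 1 ≤ M → ∀ τ ∈ Set.Icc (0 : ℝ) T,
      ‖Z M τ ω‖ ≤ G ω * (M : ℝ) ^ (1 - 2 * α) := by
    filter_upwards [hD] with ω hω M hM τ hτ
    obtain ⟨h0, h1⟩ := hω M hM
    have h2 := h1 0 ⟨le_rfl, hT.le⟩ τ hτ hτ.1
    rw [h0, sub_zero, sub_zero] at h2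
    refine h2.trans ?_
    have h3 : τ ^ α ≤ T ^ α := Real.rpow_le_rpow hτ.1 hτ.2 (by linarith)
    calc _ ≤ D ω * (M : ℝ) ^ (1 - 2 * α) * T ^ α :=
          mul_le_mul_of_nonneg_left h3 (mul_nonneg (hD0 ω) (hrate0 M))
      _ = _ := by rw [hG]; ring
  have hpath : ∀ M : ℕ, 1 ≤ M → ∀ τ ∈ Set.Icc (0 : ℝ) T,
      AEStronglyMeasurable (fun ω => eulerPath μ σ a T (fun s => B s ω) M τ) P :=
    fun M hM τ hτ => (aemeasurable_eulerPath hT hμ.measurable (fun j => (hσ j).measurable) a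
      (fun t ht j => hB.aemeasurable_apply ht j) hM hτ).aestronglyMeasurable
  -- Measurability of `Y τ` is inherited from the schemes, which converge to it almost surely
  -- because `1 - 2 * α < 0`.
  have hYm : ∀ τ ∈ Set.Icc (0 : ℝ) T, AEStronglyMeasurable (Y τ) P := by
    intro τ hτ
    refine aestronglyMeasurable_of_tendsto_ae Filter.atTop
      (f := fun M ω => eulerPath μ σ a T (fun s => B s ω) (M + 1) τ)
      (fun M => hpath (M + 1) (by omega) τ hτ) ?_
    filter_upwards [hpt] with ω hω
    have hlim : Filter.Tendsto (fun M : ℕ => G ω * ((M + 1 : ℕ) : ℝ) ^ (1 - 2 * α)) Filter.atTop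
        (nhds (G ω * 0)) := by
      refine Filter.Tendsto.const_mul _ ?_
      have h1 := (tendsto_rpow_neg_atTop (by linarith : 0 < 2 * α - 1)).comp
        (tendsto_natCast_atTop_atTop.comp (Filter.tendsto_add_atTop_nat 1))
      refine h1.congr fun M => ?_
      simp only [Function.comp_apply, neg_sub]
    rw [mul_zero] at hlim
    rw [tendsto_iff_norm_sub_tendsto_zero]
    refine squeeze_zero (fun _ => norm_nonneg _) (fun M => ?_) hlim
    rw [norm_sub_rev]
    exact hω (M + 1) (by omega) τ hτ
  set E := ∫ ω, G ω ^ 2 ∂P with hE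
  have hE0 : 0 ≤ E := integral_nonneg fun ω => sq_nonneg _
  -- `√E` serves the root mean square error and `E` the mean square error; the latter decays like `M
  -- ^ (2 * (1 - 2 * α))`, and one factor is bounded by `1`.
  refine ⟨E + √E, fun M hM τ hτ => ?_⟩
  have hM1 : (M : ℝ) ^ (1 - 2 * α) ≤ 1 :=
    Real.rpow_le_one_of_one_le_of_nonpos (by exact_mod_cast hM) (by linarith)
  have hmem : MemLp (Z M τ) 2 P := by
    refine (hG2.mul_const ((M : ℝ) ^ (1 - 2 * α))).mono' ((hYm τ hτ).sub (hpath M hM τ hτ)) ?_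
    filter_upwards [hpt] with ω hω
    exact hω M hM τ hτ
  have hsq : ∫ ω, ‖Z M τ ω‖ ^ 2 ∂P ≤ E * ((M : ℝ) ^ (1 - 2 * α)) ^ 2 := by
    rw [hE, ← integral_mul_const]
    refine integral_mono_ae (hmem.integrable_norm_pow two_ne_zero)
      (hG2.integrable_sq.mul_const _) ?_
    filter_upwards [hpt] with ω hω
    rw [← mul_pow]
    exact pow_le_pow_left₀ (norm_nonneg _) (hω M hM τ hτ) 2
  refine ⟨hmem, ?_, ?_⟩
  · calc √(∫ ω, ‖Z M τ ω‖ ^ 2 ∂P) ≤ √(E * ((M : ℝ) ^ (1 - 2 * α)) ^ 2) := Real.sqrt_le_sqrt hsq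
      _ = √E * (M : ℝ) ^ (1 - 2 * α) := by
        rw [Real.sqrt_mul hE0, Real.sqrt_sq (hrate0 M)]
      _ ≤ (E + √E) * (M : ℝ) ^ (1 - 2 * (γ : ℝ)) :=
        mul_le_mul (by linarith) (hrate M hM) (hrate0 M) (by positivity)
  · calc ∫ ω, ‖Z M τ ω‖ ^ 2 ∂P ≤ E * ((M : ℝ) ^ (1 - 2 * α)) ^ 2 := hsq
      _ ≤ E * (M : ℝ) ^ (1 - 2 * α) := by
        refine mul_le_mul_of_nonneg_left ?_ hE0
        rw [sq]
        exact mul_le_of_le_one_left (hrate0 M) hM1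
      _ ≤ (E + √E) * (M : ℝ) ^ (1 - 2 * (γ : ℝ)) :=
        mul_le_mul (by linarith [Real.sqrt_nonneg E]) (hrate M hM) (hrate0 M) (by positivity)
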